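/- Let $T>0$ and let $p\ge 2$ be even. For $N\in\mathbb{N}$, $N\ge 1$, consider the uniform mesh $t_j=jh$, $j=0,\dots,N$, of $[0,T]$ with $h=T/N$. Let $H^2_{0,\bullet}(0,T)=\{u\in H^2(0,T): u(0)=0\}$, let $S_h:=S_h^{p,1}(0,T)$ be the space of $C^1$ functions on $[0,T]$ that vanish at $t=0$ and are polynomials of degree at most $p$ on every mesh interval, let $S_h^{p-1,0}(0,T)$ be the space of continuous piecewise polynomials of degree at most $p-1$, and let $S_h^{p-2,-1}(0,T)$ be the space of discontinuous piecewise polynomials of degree at most $p-2$ on this mesh. Then $S_h\subset H^2_{0,\bullet}(0,T)$ and the following hold. (i) For every $N\ge1$ and $v\in H^1(0,T)$ there is a unique $\mathcal{P}_h^{p-1}v\in S_h^{p-1,0}(0,T)$ such that $$\mathcal{P}_h^{p-1}v(T)=v(T),\qquad (\mathcal{P}_h^{p-1}v,e^{-\bullet/T}q_h)_{L^2(0,T)}=(v,e^{-\bullet/T}q_h)_{L^2(0,T)}\quad\text{for all } q_h\in S_h^{p-2,-1}(0,T),$$ and $\mathcal P_h^{p-1}$ is linear. For every $u\in H^2_{0,\bullet}(0,T)$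 there is a unique $Q_hu\in S_h$ such that $$\partial_tQ_hu(T)=\partial_tu(T),\qquad (\partial_tQ_hu,e^{-\bullet/T}\partial_t^2w_h)_{L^2(0,T)}=(\partial_tu,e^{-\bullet/T}\partial_t^2w_h)_{L^2(0,T)}\quad\text{for all } w_h\in S_h.$$ The operator $Q_h:H^2_{0,\bullet}(0,T)\to S_h$ is a linear projection onto $S_h$, and $Q_hu(t)=\int_0^t\mathcal{P}_h^{p-1}\partial_tu(s)\,ds$ for $t\in[0,T]$. (ii) There is a constant $C>0$ depending only on $p$ and $T$ such that, for all $N\ge1$ and all $u\in H^2_{0,\bullet}(0,T)\cap W^{p+2}_\infty(0,T)$, $$\|\partial_tu-\partial_tQ_hu\|_{L^2(0,T)}\le C\,h^p\left(\|\partial_t^{p+1}u\|_{L^\infty(0,T)}+\|\partial_t^{p+2}u\|_{L^\infty(0,T)}\right).$$ (iii) For $\mu>0$ let $a_\mu(u,w)=(\partial_t^2u,\partial_tw)_{L^2(0,T)}+\partial_tu(0)\,\partial_tw(0)+\mu(u,\partial_tw)_{L^2(0,T)}$ and $\mathcal{L}_Tw(t)=\int_0^te^{-s/T}\partial_sw(s)\,ds$.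 Let $\mu>0$, $f\in L^2(0,T)$, and let $u\in H^2_{0,\bullet}(0,T)$ satisfy $a_\mu(u,w)=(f,\partial_tw)_{L^2(0,T)}$ for all $w\in H^2_{0,\bullet}(0,T)$. If $u\in W^{p+2}_\infty(0,T)$, then there is a constant $C_\mu>0$, depending on $u,p,T,\mu$ but not on $h$, such that for every $N\ge1$ the problem: find $u_h\in S_h$ with $a_\mu(u_h,\mathcal{L}_Tw_h)=(f,\partial_t\mathcal{L}_Tw_h)_{L^2(0,T)}$ for all $w_h\in S_h$, has a unique solution $u_h$, and $$\|\partial_t^\ell u-\partial_t^\ell u_h\|_{L^2(0,T)}\le C_\mu\,h^{p+1-\ell},\qquad \ell=0,1,2.$$ -/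

import Mathlib

open Set MeasureTheory
open scoped ENNReal

noncomputable section

namespace WaveSpline

/-- `∂_t^k u` on `[0,T]` (one-sided derivatives at the end points). Where a derivative fails to
exist the value is `0`; for the functions used below this is a null set, off which the value is the
weak derivative. The derivatives of order `k ≥ 1` are `0` off `[0,T]`. -/
def tD (T : ℝ) (k : ℕ) (u : ℝ → ℝ) : ℝ → ℝ := iteratedDerivWithin k u (Icc 0 T)

/-- The norm of `L^r(0,T)`, with values in `[0,∞]`. -/
def normL (T : ℝ) (r : ℝ≥0∞) (g : ℝ → ℝ) : ℝ≥0∞ := eLpNorm g r (volume.restrict (Ioo 0 T))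

/-- The Sobolev space `W^{m+1,r}(0,T)`, note the shift in the order. In one dimension its elements
are (the continuous representatives of) the functions `u ∈ C^m([0,T])` such that `∂_t^m u` is
absolutely continuous on `[0,T]` and `∂_t^{m+1} u`, which then exists almost everywhere, is in
`L^r(0,T)`. Functions on `[0,T]` are represented by their extension by zero to `ℝ`. -/
def sobolev {T : ℝ} (hT : 0 < T) (m : ℕ) (r : ℝ≥0∞) : Submodule ℝ (ℝ → ℝ) where
  carrier := {u | (∀ t, t ∉ Icc 0 T → u t = 0) ∧ ContDiffOn ℝ m u (Icc 0 T) ∧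
    AbsolutelyContinuousOnInterval (tD T m u) 0 T ∧
    MemLp (tD T (m + 1) u) r (volume.restrict (Ioo 0 T))}
  zero_mem' := by
    have h : ∀ k : ℕ, tD T k (0 : ℝ → ℝ) = 0 := by
      intro k
      induction k with
      | zero => exact iteratedDerivWithin_zero
      | succ k ih =>
        unfold tD at ih ⊢
        rw [iteratedDerivWithin_succ, ih]
        ext x
        simp
    refine ⟨fun _ _ => rfl, contDiffOn_const, ?_, ?_⟩
    · rw [h]
      exact (contDiffOn_const (𝕜 := ℝ) (E := ℝ) (c := (0 : ℝ))).absolutelyContinuousOnInterval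
    · rw [h]
      exact MemLp.zero'
  add_mem' := by
    rintro u v ⟨hu0, hu1, hu2, hu3⟩ ⟨hv0, hv1, hv2, hv3⟩
    have hU : uIcc 0 T = Icc 0 T := uIcc_of_le hT.le
    have hadd : EqOn (tD T m (u + v)) (tD T m u + tD T m v) (Icc 0 T) := fun x hx =>
      iteratedDerivWithin_add hx (uniqueDiffOn_Icc hT) (hu1 x hx) (hv1 x hx)
    refine ⟨fun t ht => by simp [hu0 t ht, hv0 t ht], hu1.add hv1, ?_, ?_⟩
    · refine (hu2.add hv2).congr' ?_
      filter_upwards [Filter.mem_inf_of_right (Filter.mem_principal_self _)] with E hE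
      refine Finset.sum_congr rfl fun i hi => ?_
      have := hE.1 i hi
      rw [hU] at this
      rw [hadd this.1, hadd this.2]
    · refine MemLp.ae_eq ?_ (hu3.add hv3)
      refine (ae_restrict_iff' measurableSet_Ioo).2 ?_
      filter_upwards [hu2.ae_differentiableAt, hv2.ae_differentiableAt] with x h1 h2 hx
      have hx' := Ioo_subset_Icc_self hx
      have d1 := (h1 (hU ▸ hx')).differentiableWithinAt (s := Icc 0 T)
      have d2 := (h2 (hU ▸ hx')).differentiableWithinAt (s := Icc 0 T)
      unfold tD at *
      rw [iteratedDerivWithin_succ, Pi.add_apply, iteratedDerivWithin_succ,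
        iteratedDerivWithin_succ, derivWithin_congr hadd (hadd hx'), derivWithin_add d1 d2]
  smul_mem' := by
    rintro c u ⟨hu0, hu1, hu2, hu3⟩
    have h : ∀ k : ℕ, tD T k (c • u) = c • tD T k u := fun k => by
      ext x
      exact iteratedDerivWithin_const_smul_field c u
    refine ⟨fun t ht => by simp [hu0 t ht], hu1.const_smul c, ?_, ?_⟩
    · rw [h]
      exact hu2.const_smul c
    · rw [h]
      exact hu3.const_smul c

/-- `H^1(0,T)`. -/
abbrev H1 {T : ℝ} (hT : 0 < T) : Submodule ℝ (ℝ → ℝ) := sobolev hT 0 2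

/-- `H^2_{0,•}(0,T)`: the functions `u ∈ H^2(0,T)` with `u(0) = 0`. -/
def H20 {T : ℝ} (hT : 0 < T) : Submodule ℝ (ℝ → ℝ) :=
  sobolev hT 1 2 ⊓ LinearMap.ker (LinearMap.proj (R := ℝ) (φ := fun _ : ℝ => ℝ) 0)

/-- The derivative `∂_t : H^2_{0,•}(0,T) → H^1(0,T)`. -/
def dt {T : ℝ} (hT : 0 < T) (u : H20 hT) : H1 hT :=
  ⟨tD T 1 u, by
    obtain ⟨u, ⟨-, h1, h2, h3⟩, -⟩ := u
    have e : ∀ k, tD T k (tD T 1 u) = tD T (k + 1) u := fun k => by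
      unfold tD
      rw [iteratedDerivWithin_succ' (n := k), iteratedDerivWithin_succ' (n := 0),
        iteratedDerivWithin_zero]
    refine ⟨fun t ht => ?_, ?_, ?_, ?_⟩
    · change iteratedDerivWithin (0 + 1) u (Icc 0 T) t = 0
      rw [iteratedDerivWithin_succ]
      exact derivWithin_zero_of_notMem_closure (by rwa [isClosed_Icc.closure_eq])
    · have := h2.continuousOn
      rw [uIcc_of_le hT.le] at this
      simpa using this
    · rwa [e 0]
    · rwa [e 1]⟩

/-- The `j`-th element `[t_j, t_{j+1}]`, `t_j = j h`, of the uniform mesh of size `h = T / N`. -/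
def elt (T : ℝ) (N j : ℕ) : Set ℝ := Icc (j * (T / N)) ((j + 1) * (T / N))

/-- `S_h^{q,0}(0,T)`, `h = T / N`: the continuous piecewise polynomials of degree at most `q`. -/
def cpw (T : ℝ) (N q : ℕ) : Submodule ℝ (ℝ → ℝ) where
  carrier := {w | (∀ t, t ∉ Icc 0 T → w t = 0) ∧ ContinuousOn w (Icc 0 T) ∧
    ∀ j < N, ∃ P : Polynomial ℝ, P.natDegree ≤ q ∧ EqOn w (fun t => P.eval t) (elt T N j)}
  zero_mem' := ⟨fun _ _ => rfl, continuousOn_const, fun _ _ => ⟨0, by simp, fun _ _ => by simp⟩⟩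
  add_mem' := by
    rintro u v ⟨hu0, hu1, hu2⟩ ⟨hv0, hv1, hv2⟩
    refine ⟨fun t ht => by simp [hu0 t ht, hv0 t ht], hu1.add hv1, fun j hj => ?_⟩
    obtain ⟨P, hP, hP'⟩ := hu2 j hj
    obtain ⟨R, hR, hR'⟩ := hv2 j hj
    exact ⟨P + R, Polynomial.natDegree_add_le_of_degree_le hP hR,
      fun t ht => by simp [hP' ht, hR' ht]⟩
  smul_mem' := by
    rintro c u ⟨hu0, hu1, hu2⟩
    refine ⟨fun t ht => by simp [hu0 t ht], hu1.const_smul c, fun j hj => ?_⟩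
    obtain ⟨P, hP, hP'⟩ := hu2 j hj
    exact ⟨c • P, (Polynomial.natDegree_smul_le c P).trans hP, fun t ht => by simp [hP' ht]⟩

/-- `S_h^{p,1}(0,T)`, `h = T / N`: the `C^1` splines of degree `p` that vanish at `t = 0`. -/
def spline (T : ℝ) (N p : ℕ) : Submodule ℝ (ℝ → ℝ) where
  carrier := {w | w ∈ cpw T N p ∧ ContDiffOn ℝ 1 w (Icc 0 T) ∧ w 0 = 0}
  zero_mem' := ⟨zero_mem _, contDiffOn_const, rfl⟩
  add_mem' := fun ⟨a, b, c⟩ ⟨a', b', c'⟩ => ⟨add_mem a a', b.add b', by simp [c, c']⟩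
  smul_mem' := fun k _ ⟨a, b, c⟩ => ⟨Submodule.smul_mem _ k a, b.const_smul k, by simp [c]⟩

/-- `r ∈ S_h^{q-1,-1}(0,T)`, `h = T / N`: a discontinuous piecewise polynomial of degree less than
`q`; the values at the nodes are irrelevant. -/
def IsDiscPw (T : ℝ) (N q : ℕ) (r : ℝ → ℝ) : Prop :=
  ∀ j < N, ∃ P : Polynomial ℝ, P.degree < q ∧
    EqOn r (fun t => P.eval t) (interior (elt T N j))

/-- `w = 𝒫_h^q v`, `h = T / N`, for the projection `𝒫_h^q : H^1(0,T) → S_h^{q,0}(0,T)` that is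
fixed by the value at the final time `T` and by orthogonality, with weight `e^{-t/T}`, of the error
to the discontinuous piecewise polynomials of degree `q - 1`. -/
def IsNodalProj (T : ℝ) (N q : ℕ) (v w : ℝ → ℝ) : Prop :=
  w ∈ cpw T N q ∧ w T = v T ∧
    ∀ r, IsDiscPw T N q r →
      ∫ t in 0..T, w t * (Real.exp (-t / T) * r t) = ∫ t in 0..T, v t * (Real.exp (-t / T) * r t)

/-- The defining conditions of the projection operator `Q_h` onto the discrete space `S`:
`w ∈ S`, `∂_t w(T) = ∂_t u(T)` and
`(∂_t w, e^{-•/T} ∂_t^2 w_h) = (∂_t u, e^{-•/T} ∂_t^2 w_h)` for all `w_h ∈ S`. -/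
def IsWeightedProj (T : ℝ) (S : Submodule ℝ (ℝ → ℝ)) (u w : ℝ → ℝ) : Prop :=
  w ∈ S ∧ tD T 1 w T = tD T 1 u T ∧
    ∀ wh ∈ S, ∫ t in 0..T, tD T 1 w t * (Real.exp (-t / T) * tD T 2 wh t) =
      ∫ t in 0..T, tD T 1 u t * (Real.exp (-t / T) * tD T 2 wh t)

/-- The bilinear form `a_μ(u,w) = (∂_t^2 u, ∂_t w) + ∂_t u(0) ∂_t w(0) + μ (u, ∂_t w)`. -/
def aForm (T μ : ℝ) (u w : ℝ → ℝ) : ℝ :=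
  (∫ t in 0..T, tD T 2 u t * tD T 1 w t) + tD T 1 u 0 * tD T 1 w 0 +
    μ * ∫ t in 0..T, u t * tD T 1 w t

/-- The operator `ℒ_T w(t) = ∫_0^t e^{-s/T} ∂_s w(s) ds` on `[0,T]`. -/
def opL (T : ℝ) (w : ℝ → ℝ) : ℝ → ℝ :=
  (Icc 0 T).indicator fun t => ∫ s in 0..t, Real.exp (-s / T) * tD T 1 w s

/-- `u` solves the variational problem: `u ∈ H^2_{0,•}(0,T)` and `a_μ(u,w) = (f, ∂_t w)` for all
`w ∈ H^2_{0,•}(0,T)`. -/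
def IsSolution {T : ℝ} (hT : 0 < T) (μ : ℝ) (f u : ℝ → ℝ) : Prop :=
  u ∈ H20 hT ∧ ∀ w ∈ H20 hT, aForm T μ u w = ∫ t in 0..T, f t * tD T 1 w t

/-- `u_h` solves the discrete problem in `S`: `u_h ∈ S` and
`a_μ(u_h, ℒ_T w_h) = (f, ∂_t ℒ_T w_h)` for all `w_h ∈ S`. -/
def IsDiscreteSolution (T μ : ℝ) (f : ℝ → ℝ) (S : Submodule ℝ (ℝ → ℝ)) (uh : ℝ → ℝ) : Prop :=
  uh ∈ S ∧ ∀ wh ∈ S, aForm T μ uh (opL T wh) = ∫ t in 0..T, f t * tD T 1 (opL T wh) t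

end WaveSpline

end

/-!
The argument reduces everything to one projection on the reference element `[0,1]`. Put `q = p - 1`
and `ε = h / T = 1 / N`. Since every discontinuous piecewise polynomial is the second derivative of
a spline, `Q_h u` is the primitive of `𝒫_h^q ∂_t u` (`isWeightedProj_iff`), and because the weight is
exponential, `𝒫_h^q` is computed element by element, backwards from `T`: on each element one solves
the local problem `IsLocalProj` with the value at the right end point passed on from the next
element. This gives existence, uniqueness and linearity.

*Approximation.* The nodal errors of `𝒫_h^q` satisfy `E_j = ρ_j + A E_{j+1}` with local errors
`ρ_j = O(h^{q+1})` and the amplification factor `A = L(0)`, where `L` is the local projection of `0`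
with `L(1) = 1`. Since `L` has degree `q` and no real root outside `(0,1)`, `A < 0` for odd `q`,
while testing with `L'` gives `A² ≤ 1 + O(ε)` (`IsLocalProj.amplification`). A negative factor makes
the local errors of neighbouring elements cancel (`abs_le_of_alternating`); only the differences
`ρ_{j+1} - ρ_j`, which are one order smaller when one more derivative is bounded, accumulate. Hence
the full order `h^p` in the maximum norm (`exists_nodalProj_error`). This is where `p` even is used.

*Galerkin errors.* The form `(u, w) ↦ a_μ(u, ℒ_T w)` is coercive in `‖∂_t u‖`, as the weight
`e^{-t/T}` turns the terms `(∂_t² u, ∂_t u)` and `(u, ∂_t u)` into positive ones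
(`weightedForm_coercive`). This gives unique solvability, and it bounds `Q_h u - u_h`: by the choice
of the weighted projection, only terms of lower order of the consistency error survive
(`energy_estimate`). The bound for `∂_t²` follows by an inverse inequality, and the bound in `L²` by
duality with the backward problem `ψ'' + μ ψ = u - u_h` (`exists_duality_estimate`).
-/

namespace WaveSpline

open scoped Polynomial

/-! ### Weighted inner products of polynomials on the reference element -/

/-- A positive definite bilinear form on a finite-dimensional space represents every linear
functional. -/
theorem exists_repr_of_posDef {V : Type*} [AddCommGroup V] [Module ℝ V] [FiniteDimensional ℝ V]
    (B : V →ₗ[ℝ] V →ₗ[ℝ] ℝ) (hB : ∀ x, B x x = 0 → x = 0) (l : V →ₗ[ℝ] ℝ) :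
    ∃ x, ∀ y, B x y = l y := by
  have hinj : Function.Injective (B : V →ₗ[ℝ] Module.Dual ℝ V) := by
    rw [← LinearMap.ker_eq_bot, LinearMap.ker_eq_bot']
    intro x hx
    exact hB x (by rw [hx]; rfl)
  have hsurj := (LinearMap.injective_iff_surjective_of_finrank_eq_finrank
    (Subspace.dual_finrank_eq (K := ℝ) (V := V)).symm).1 hinj
  obtain ⟨x, hx⟩ := hsurj l
  exact ⟨x, fun y => by rw [hx]⟩

/-- The bilinear form `(P, R) ↦ ∫_0^1 κ P R` on polynomials of degree less than `n`. -/
noncomputable def wform (κ : ℝ → ℝ) (hκ : Continuous κ) (n : ℕ) :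
    Polynomial.degreeLT ℝ n →ₗ[ℝ] Polynomial.degreeLT ℝ n →ₗ[ℝ] ℝ :=
  LinearMap.mk₂ ℝ (fun P R => ∫ s in 0..1, κ s * ((P : ℝ[X]).eval s * (R : ℝ[X]).eval s))
    (fun P P' R => by
      rw [← intervalIntegral.integral_add
        (by apply Continuous.intervalIntegrable; fun_prop)
        (by apply Continuous.intervalIntegrable; fun_prop)]
      congr 1; ext s; simp; ring)
    (fun c P R => by
      rw [smul_eq_mul, ← intervalIntegral.integral_const_mul]
      congr 1; ext s; simp; ring)
    (fun P R R' => by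
      rw [← intervalIntegral.integral_add
        (by apply Continuous.intervalIntegrable; fun_prop)
        (by apply Continuous.intervalIntegrable; fun_prop)]
      congr 1; ext s; simp; ring)
    (fun c P R => by
      rw [smul_eq_mul, ← intervalIntegral.integral_const_mul]
      congr 1; ext s; simp; ring)

theorem wform_apply (κ : ℝ → ℝ) (hκ : Continuous κ) (n : ℕ) (P R : Polynomial.degreeLT ℝ n) :
    wform κ hκ n P R = ∫ s in 0..1, κ s * ((P : ℝ[X]).eval s * (R : ℝ[X]).eval s) := rfl

theorem polynomial_eq_zero_of_eqOn {P : ℝ[X]} {a b : ℝ} (hab : a < b)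
    (h : ∀ s ∈ Ioo a b, P.eval s = 0) : P = 0 :=
  P.eq_zero_of_infinite_isRoot ((Ioo_infinite hab).mono fun s hs => h s hs)

/-- A polynomial whose square has zero integral against a weight that is positive on `(0,1)`
vanishes. -/
theorem polynomial_eq_zero_of_integral {κ : ℝ → ℝ} (hκ : Continuous κ)
    (hpos : ∀ s ∈ Ioo (0 : ℝ) 1, 0 < κ s) {P : ℝ[X]}
    (h : ∫ s in 0..1, κ s * (P.eval s * P.eval s) = 0) : P = 0 := by
  by_contra hP
  have hκ0 : ∀ s ∈ Icc (0 : ℝ) 1, 0 ≤ κ s := by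
    have hcl : closure (Ioo (0 : ℝ) 1) = Icc 0 1 := closure_Ioo (by norm_num)
    intro s hs
    rw [← hcl] at hs
    exact closure_minimal (fun t ht => (hpos t ht).le) (isClosed_le continuous_const hκ) hs
  have : ∃ c ∈ Ioo (0 : ℝ) 1, P.eval c ≠ 0 := by
    by_contra hne
    push Not at hne
    exact hP (polynomial_eq_zero_of_eqOn one_pos hne)
  obtain ⟨c, hc, hPc⟩ := this
  have := intervalIntegral.integral_pos (f := fun s => κ s * (P.eval s * P.eval s)) one_pos
    (by fun_prop) (fun s hs => mul_nonneg (hκ0 s (Ioc_subset_Icc_self hs)) (mul_self_nonneg _))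
    ⟨c, Ioo_subset_Icc_self hc, mul_pos (hpos c hc) (mul_self_pos.2 hPc)⟩
  exact this.ne' h

theorem wform_posDef {κ : ℝ → ℝ} (hκ : Continuous κ)
    (hpos : ∀ s ∈ Ioo (0 : ℝ) 1, 0 < κ s) (n : ℕ) (P : Polynomial.degreeLT ℝ n)
    (h : wform κ hκ n P P = 0) : P = 0 :=
  Subtype.ext (polynomial_eq_zero_of_integral hκ hpos h)

theorem integral_weight_sq_nonneg (P : ℝ[X]) :
    0 ≤ ∫ s in (0:ℝ)..1, (1 - s) * (P.eval s * P.eval s) :=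
  intervalIntegral.integral_nonneg zero_le_one fun s hs =>
    mul_nonneg (by linarith [hs.2]) (mul_self_nonneg _)

theorem exists_linear_functional_bound (n : ℕ) (l : Polynomial.degreeLT ℝ n →ₗ[ℝ] ℝ) :
    ∃ C : ℝ, 0 ≤ C ∧ ∀ R : Polynomial.degreeLT ℝ n,
      (l R) ^ 2 ≤ C * ∫ s in (0:ℝ)..1, (1 - s) * ((R : ℝ[X]).eval s * (R : ℝ[X]).eval s) := by
  have hκ : Continuous fun s : ℝ => 1 - s := by fun_prop
  obtain ⟨x, hx⟩ := exists_repr_of_posDef (wform _ hκ n)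
    (wform_posDef hκ (fun s hs => by linarith [hs.2]) n) l
  refine ⟨wform _ hκ n x x, integral_weight_sq_nonneg _, fun R => ?_⟩
  have := LinearMap.BilinForm.apply_mul_apply_le_of_forall_zero_le (wform _ hκ n)
    (fun x => integral_weight_sq_nonneg _) x R
  have hsymm : wform _ hκ n R x = wform _ hκ n x R := by
    rw [wform_apply, wform_apply]; congr 1; ext s; ring
  rw [hsymm, hx, ← sq] at this
  exact this

theorem coeff_bound (n : ℕ) : ∃ C : ℝ, 0 ≤ C ∧ ∀ R : ℝ[X], R.degree < n → ∀ i,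
    (R.coeff i) ^ 2 ≤ C * ∫ s in (0:ℝ)..1, (1 - s) * (R.eval s * R.eval s) := by
  choose C hC0 hC using fun i : ℕ => exists_linear_functional_bound n
    ((Polynomial.lcoeff ℝ i).comp (Polynomial.degreeLT ℝ n).subtype)
  refine ⟨∑ i ∈ Finset.range n, C i, Finset.sum_nonneg fun i _ => hC0 i, fun R hR i => ?_⟩
  by_cases hi : i < n
  · refine (hC i ⟨R, Polynomial.mem_degreeLT.2 hR⟩).trans ?_
    exact mul_le_mul_of_nonneg_right
      (Finset.single_le_sum (fun i _ => hC0 i) (Finset.mem_range.2 hi))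
      (integral_weight_sq_nonneg _)
  · rw [Polynomial.coeff_eq_zero_of_degree_lt (hR.trans_le (by exact_mod_cast not_lt.1 hi))]
    have := mul_nonneg (Finset.sum_nonneg fun i (_ : i ∈ Finset.range n) => hC0 i)
      (integral_weight_sq_nonneg R)
    simpa using this

/-- All norms of polynomials of bounded degree are equivalent: values and derivatives on `[0,1]`
are controlled by the `L²` norm with weight `1 - s`, which is the norm that the stability estimate
of the local projection provides. -/
theorem eval_bound (n : ℕ) : ∃ C : ℝ, 0 < C ∧ ∀ R : ℝ[X], R.degree < n → ∀ s ∈ Icc (0:ℝ) 1,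
    (R.eval s) ^ 2 ≤ C * (∫ s in (0:ℝ)..1, (1 - s) * (R.eval s * R.eval s)) ∧
    (R.derivative.eval s) ^ 2 ≤ C * ∫ s in (0:ℝ)..1, (1 - s) * (R.eval s * R.eval s) := by
  obtain ⟨C, hC0, hC⟩ := coeff_bound n
  refine ⟨(n * n) ^ 2 * C + 1, by positivity, fun R hR s hs => ?_⟩
  set I := ∫ s in (0:ℝ)..1, (1 - s) * (R.eval s * R.eval s)
  have hI : 0 ≤ I := integral_weight_sq_nonneg R
  have habs : ∀ i, |R.coeff i| ≤ √(C * I) := fun i => by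
    rw [← Real.sqrt_sq_eq_abs]; exact Real.sqrt_le_sqrt (hC R hR i)
  have hpow : ∀ k : ℕ, |s ^ k| ≤ 1 := fun k => by
    rw [abs_of_nonneg (pow_nonneg hs.1 _)]; exact pow_le_one₀ hs.1 hs.2
  have key : ∀ x : ℝ, |x| ≤ n * n * √(C * I) → x ^ 2 ≤ ((n * n) ^ 2 * C + 1) * I := fun x hx => by
    have h1 : x ^ 2 ≤ (n * n * √(C * I)) ^ 2 := sq_le_sq' (by linarith [neg_abs_le x])
      ((le_abs_self x).trans hx)
    rw [mul_pow, Real.sq_sqrt (by positivity)] at h1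
    nlinarith
  have hsqrt := Real.sqrt_nonneg (C * I)
  have hnn : (n : ℝ) ≤ n * n := by exact_mod_cast Nat.le_mul_self n
  rcases eq_or_ne R 0 with rfl | hR0
  · simp [I]
  have hdeg : R.natDegree < n := (Polynomial.natDegree_lt_iff_degree_lt hR0).2 hR
  constructor
  · apply key
    rw [Polynomial.eval_eq_sum_range' hdeg]
    calc |∑ i ∈ Finset.range n, R.coeff i * s ^ i|
        ≤ ∑ i ∈ Finset.range n, |R.coeff i * s ^ i| := Finset.abs_sum_le_sum_abs _ _
      _ ≤ ∑ i ∈ Finset.range n, √(C * I) := Finset.sum_le_sum fun i _ => by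
          rw [abs_mul]
          exact (mul_le_mul (habs i) (hpow i) (abs_nonneg _) hsqrt).trans_eq (mul_one _)
      _ = n * √(C * I) := by simp
      _ ≤ n * n * √(C * I) := mul_le_mul_of_nonneg_right hnn hsqrt
  · apply key
    rw [Polynomial.derivative_eval, Polynomial.sum_over_range' _ (by simp) n hdeg]
    calc |∑ i ∈ Finset.range n, R.coeff i * i * s ^ (i - 1)|
        ≤ ∑ i ∈ Finset.range n, |R.coeff i * i * s ^ (i - 1)| := Finset.abs_sum_le_sum_abs _ _
      _ ≤ ∑ i ∈ Finset.range n, n * √(C * I) := Finset.sum_le_sum fun i hi => by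
          rw [abs_mul, abs_mul, mul_comm (n : ℝ), Nat.abs_cast]
          have hin : (i : ℝ) ≤ n := by exact_mod_cast (Finset.mem_range.1 hi).le
          exact (mul_le_mul (mul_le_mul (habs i) hin (by positivity) hsqrt) (hpow _)
            (abs_nonneg _) (by positivity)).trans_eq (mul_one _)
      _ = n * n * √(C * I) := by simp [mul_assoc]

/-! ### The local projection on the reference element -/

/-- `P` solves the local problem on the reference element `[0,1]` with weight `e^{-ε s}`: it has
degree at most `q`, the value `b` at the right end point, and `P - g` is orthogonal to all
polynomials of degree less than `q`. -/
structure IsLocalProj (ε : ℝ) (q : ℕ) (g : ℝ → ℝ) (b : ℝ) (P : ℝ[X]) : Prop where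
  natDegree_le : P.natDegree ≤ q
  eval_one : P.eval 1 = b
  orth : ∀ R : ℝ[X], R.degree < q →
    ∫ s in 0..1, Real.exp (-ε * s) * (P.eval s * R.eval s) =
      ∫ s in 0..1, Real.exp (-ε * s) * (g s * R.eval s)

theorem intervalIntegrable_exp_mul {ε : ℝ} {g : ℝ → ℝ} (hg : ContinuousOn g (Icc 0 1)) (R : ℝ[X]) :
    IntervalIntegrable (fun s => Real.exp (-ε * s) * (g s * R.eval s)) volume 0 1 := by
  apply ContinuousOn.intervalIntegrable_of_Icc zero_le_one
  fun_prop

theorem IsLocalProj.sub {ε : ℝ} {q : ℕ} {g g' : ℝ → ℝ} {b b' : ℝ} {P P' : ℝ[X]}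
    (hg : ContinuousOn g (Icc 0 1)) (hg' : ContinuousOn g' (Icc 0 1))
    (h : IsLocalProj ε q g b P) (h' : IsLocalProj ε q g' b' P') :
    IsLocalProj ε q (fun s => g s - g' s) (b - b') (P - P') where
  natDegree_le := (Polynomial.natDegree_sub_le_of_le h.natDegree_le h'.natDegree_le).trans_eq
    (max_self q)
  eval_one := by simp [h.eval_one, h'.eval_one]
  orth R hR := by
    have e : ∀ f f' : ℝ → ℝ, ContinuousOn f (Icc 0 1) → ContinuousOn f' (Icc 0 1) →
        ∫ s in (0:ℝ)..1, Real.exp (-ε * s) * ((f s - f' s) * R.eval s) =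
        (∫ s in (0:ℝ)..1, Real.exp (-ε * s) * (f s * R.eval s)) -
          ∫ s in (0:ℝ)..1, Real.exp (-ε * s) * (f' s * R.eval s) := fun f f' hf hf' => by
      rw [← intervalIntegral.integral_sub (intervalIntegrable_exp_mul hf R)
        (intervalIntegrable_exp_mul hf' R)]
      congr 1; ext s; ring
    simp only [Polynomial.eval_sub]
    rw [e _ _ (by fun_prop) (by fun_prop), e _ _ hg hg', h.orth R hR, h'.orth R hR]

theorem IsLocalProj.smul {ε : ℝ} {q : ℕ} {g : ℝ → ℝ} {b : ℝ} {P : ℝ[X]}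
    (h : IsLocalProj ε q g b P) (c : ℝ) :
    IsLocalProj ε q (fun s => c * g s) (c * b) (c • P) where
  natDegree_le := (Polynomial.natDegree_smul_le c P).trans h.natDegree_le
  eval_one := by simp [h.eval_one]
  orth R hR := by
    have e : ∀ f : ℝ → ℝ, ∫ s in (0:ℝ)..1, Real.exp (-ε * s) * ((c * f s) * R.eval s) =
        c * ∫ s in (0:ℝ)..1, Real.exp (-ε * s) * (f s * R.eval s) := fun f => by
      rw [← intervalIntegral.integral_const_mul]
      congr 1; ext s; ring
    simp only [Polynomial.eval_smul, smul_eq_mul]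
    rw [e, e, h.orth R hR]

/-- A polynomial is its own local projection. -/
theorem isLocalProj_self {ε : ℝ} {q : ℕ} {P : ℝ[X]} (hP : P.natDegree ≤ q) :
    IsLocalProj ε q (fun s => P.eval s) (P.eval 1) P :=
  ⟨hP, rfl, fun _ _ => rfl⟩

theorem degree_lt_of_eq_mul {q : ℕ} {a : ℝ} {P R : ℝ[X]} (hP : P.natDegree ≤ q)
    (h : P = (Polynomial.X - Polynomial.C a) * R) : R.degree < q := by
  rcases eq_or_ne R 0 with rfl | hR
  · simp
  rw [h, Polynomial.natDegree_mul (Polynomial.X_sub_C_ne_zero a) hR,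
    Polynomial.natDegree_X_sub_C] at hP
  exact (Polynomial.natDegree_lt_iff_degree_lt hR).1 (by omega)

/-- Uniform stability of the local projection: writing `P = b - (1 - s) R` and testing with `R`. -/
theorem IsLocalProj.exists_bound (q : ℕ) : ∃ C : ℝ, 0 < C ∧ ∀ ε ∈ Icc (0:ℝ) 1,
    ∀ (g : ℝ → ℝ) (b M : ℝ) (P : ℝ[X]), ContinuousOn g (Icc 0 1) → (∀ s ∈ Icc (0:ℝ) 1, |g s| ≤ M) → |b| ≤ M →
    IsLocalProj ε q g b P → ∀ s ∈ Icc (0:ℝ) 1, |P.eval s| ≤ C * M := by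
  obtain ⟨C, hC0, hC⟩ := eval_bound q
  refine ⟨1 + 2 * Real.exp 1 * C, by positivity, fun ε hε g b M P hg hgM hbM hP s hs => ?_⟩
  have hM : 0 ≤ M := (abs_nonneg b).trans hbM
  obtain ⟨R, hR⟩ : (Polynomial.X - Polynomial.C 1) ∣ (P - Polynomial.C b) := by
    rw [Polynomial.dvd_iff_isRoot]; simp [hP.eval_one]
  have hdeg : R.degree < q := degree_lt_of_eq_mul
    ((Polynomial.natDegree_sub_le_of_le hP.natDegree_le (Polynomial.natDegree_C b).le).trans
      (by simp)) hR
  have hev : ∀ s, P.eval s = b + (s - 1) * R.eval s := fun s => by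
    have := congrArg (Polynomial.eval s) hR
    simp at this
    linarith
  set I := ∫ s in (0:ℝ)..1, (1 - s) * (R.eval s * R.eval s)
  have hI : 0 ≤ I := integral_weight_sq_nonneg R
  set y := √(C * I)
  have hy : 0 ≤ y := Real.sqrt_nonneg _
  have hRy : ∀ s ∈ Icc (0:ℝ) 1, |R.eval s| ≤ y := fun s hs => by
    rw [← Real.sqrt_sq_eq_abs]; exact Real.sqrt_le_sqrt (hC R hdeg s hs).1
  have h1 : ∫ s in (0:ℝ)..1, Real.exp (-ε * s) * ((1 - s) * (R.eval s * R.eval s)) =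
      ∫ s in (0:ℝ)..1, Real.exp (-ε * s) * ((b - g s) * R.eval s) := by
    have e1 : ∀ s, Real.exp (-ε * s) * ((1 - s) * (R.eval s * R.eval s)) =
        Real.exp (-ε * s) * (b * R.eval s) - Real.exp (-ε * s) * (P.eval s * R.eval s) :=
      fun s => by rw [hev]; ring
    have e2 : ∀ s, Real.exp (-ε * s) * ((b - g s) * R.eval s) =
        Real.exp (-ε * s) * (b * R.eval s) - Real.exp (-ε * s) * (g s * R.eval s) :=
      fun s => by ring
    simp_rw [e1, e2]
    rw [intervalIntegral.integral_sub (intervalIntegrable_exp_mul (by fun_prop) R)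
        (intervalIntegrable_exp_mul (by fun_prop) R),
      intervalIntegral.integral_sub (intervalIntegrable_exp_mul (by fun_prop) R)
        (intervalIntegrable_exp_mul hg R), hP.orth R hdeg]
  have hexp : ∀ s ∈ Icc (0:ℝ) 1, Real.exp (-1) ≤ Real.exp (-ε * s) ∧ Real.exp (-ε * s) ≤ 1 :=
    fun s hs => by
      constructor
      · apply Real.exp_le_exp.2; nlinarith [hε.1, hε.2, hs.1, hs.2]
      · apply Real.exp_le_one_iff.2; nlinarith [hε.1, hε.2, hs.1, hs.2]
  have h2 : Real.exp (-1) * I ≤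
      ∫ s in (0:ℝ)..1, Real.exp (-ε * s) * ((1 - s) * (R.eval s * R.eval s)) := by
    rw [← intervalIntegral.integral_const_mul]
    refine intervalIntegral.integral_mono_on zero_le_one
      (by apply Continuous.intervalIntegrable; fun_prop)
      (by apply Continuous.intervalIntegrable; fun_prop) fun s hs => ?_
    exact mul_le_mul_of_nonneg_right (hexp s hs).1
      (mul_nonneg (by linarith [hs.2]) (mul_self_nonneg _))
  have h3 : ∫ s in (0:ℝ)..1, Real.exp (-ε * s) * ((b - g s) * R.eval s) ≤ 2 * M * y := by
    have : ∫ s in (0:ℝ)..1, (2 * M * y) = 2 * M * y := by simp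
    rw [← this]
    refine intervalIntegral.integral_mono_on zero_le_one
      (intervalIntegrable_exp_mul (by fun_prop) R) (by simp) fun s hs => ?_
    refine (le_abs_self _).trans ?_
    rw [abs_mul, abs_mul, Real.abs_exp]
    have hb : |b - g s| ≤ 2 * M := (abs_sub _ _).trans (by linarith [hgM s hs])
    calc _ ≤ 1 * (2 * M * y) := mul_le_mul (hexp s hs).2
          (mul_le_mul hb (hRy s hs) (abs_nonneg _) (by positivity)) (by positivity) zero_le_one
      _ = _ := one_mul _
  have h4 : I ≤ Real.exp 1 * (2 * M * y) := by
    have : I = Real.exp 1 * (Real.exp (-1) * I) := by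
      rw [← mul_assoc, ← Real.exp_add]; simp
    rw [this]
    exact mul_le_mul_of_nonneg_left (h2.trans (h1.le.trans h3)) (Real.exp_pos _).le
  have h5 : y ≤ 2 * Real.exp 1 * C * M := by
    rcases hy.eq_or_lt with h0 | h0
    · rw [← h0]; positivity
    · have hyy : y * y = C * I := Real.mul_self_sqrt (by positivity)
      have : y * y ≤ (2 * Real.exp 1 * C * M) * y := by
        rw [hyy]
        calc C * I ≤ C * (Real.exp 1 * (2 * M * y)) := mul_le_mul_of_nonneg_left h4 hC0.le
          _ = _ := by ring
      exact le_of_mul_le_mul_right this h0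
  rw [hev]
  calc |b + (s - 1) * R.eval s| ≤ |b| + |s - 1| * |R.eval s| := by
        rw [← abs_mul]; exact abs_add_le _ _
    _ ≤ M + 1 * y := by
        have : |s - 1| ≤ 1 := by rw [abs_le]; constructor <;> linarith [hs.1, hs.2]
        exact add_le_add hbM (mul_le_mul this (hRy s hs) (abs_nonneg _) zero_le_one)
    _ ≤ (1 + 2 * Real.exp 1 * C) * M := by linarith

theorem IsLocalProj.unique {ε : ℝ} (hε : ε ∈ Icc (0:ℝ) 1) {q : ℕ} {g : ℝ → ℝ} {b : ℝ} {P P' : ℝ[X]}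
    (hg : ContinuousOn g (Icc 0 1))
    (h : IsLocalProj ε q g b P) (h' : IsLocalProj ε q g b P') : P = P' := by
  obtain ⟨C, -, hC⟩ := IsLocalProj.exists_bound q
  rw [← sub_eq_zero]
  refine polynomial_eq_zero_of_eqOn one_pos fun s hs => ?_
  have := hC ε hε _ _ 0 _ (hg.sub hg) (by simp) (by simp) (h.sub hg hg h') s
    (Ioo_subset_Icc_self hs)
  rwa [mul_zero, abs_nonpos_iff] at this

theorem exists_isLocalProj (ε : ℝ) (q : ℕ) {g : ℝ → ℝ} (hg : ContinuousOn g (Icc 0 1)) (b : ℝ) :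
    ∃ P, IsLocalProj ε q g b P := by
  have hκ : Continuous fun s : ℝ => Real.exp (-ε * s) * (1 - s) := by fun_prop
  let l : Polynomial.degreeLT ℝ q →ₗ[ℝ] ℝ :=
    { toFun := fun R => ∫ s in (0:ℝ)..1, Real.exp (-ε * s) * ((g s - b) * (R : ℝ[X]).eval s)
      map_add' := fun R R' => by
        rw [← intervalIntegral.integral_add (intervalIntegrable_exp_mul (by fun_prop) _)
          (intervalIntegrable_exp_mul (by fun_prop) _)]
        congr 1; ext s; simp; ring
      map_smul' := fun c R => by
        rw [RingHom.id_apply, smul_eq_mul, ← intervalIntegral.integral_const_mul]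
        congr 1; ext s; simp; ring }
  obtain ⟨⟨R, hRdeg⟩, hR⟩ := exists_repr_of_posDef (wform _ hκ q)
    (wform_posDef hκ (fun s hs => mul_pos (Real.exp_pos _) (by linarith [hs.2])) q) l
  rw [Polynomial.mem_degreeLT] at hRdeg
  refine ⟨Polynomial.C b + (1 - Polynomial.X) * R, ?_, by simp, fun S hS => ?_⟩
  · refine Polynomial.natDegree_add_le_of_degree_le (by simp) ?_
    rcases eq_or_ne R 0 with rfl | hR0
    · simp
    · have h1 := (Polynomial.natDegree_lt_iff_degree_lt hR0).2 hRdeg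
      have h2 : (1 - Polynomial.X : ℝ[X]).natDegree ≤ 1 := by
        refine (Polynomial.natDegree_sub_le _ _).trans ?_
        simp
      exact Polynomial.natDegree_mul_le.trans (by omega)
  · have h1 := hR ⟨S, Polynomial.mem_degreeLT.2 hS⟩
    change ∫ s in (0:ℝ)..1, Real.exp (-ε * s) * (1 - s) * (R.eval s * S.eval s) =
      ∫ s in (0:ℝ)..1, Real.exp (-ε * s) * ((g s - b) * S.eval s) at h1
    have e1 : ∀ s, Real.exp (-ε * s) * (1 - s) * (R.eval s * S.eval s) =
        Real.exp (-ε * s) * ((Polynomial.C b + (1 - Polynomial.X) * R).eval s * S.eval s) -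
        Real.exp (-ε * s) * (b * S.eval s) := fun s => by simp; ring
    have e2 : ∀ s, Real.exp (-ε * s) * ((g s - b) * S.eval s) =
        Real.exp (-ε * s) * (g s * S.eval s) - Real.exp (-ε * s) * (b * S.eval s) :=
      fun s => by ring
    simp_rw [e1, e2] at h1
    rw [intervalIntegral.integral_sub (intervalIntegrable_exp_mul (by fun_prop) S)
        (intervalIntegrable_exp_mul (by fun_prop) S),
      intervalIntegral.integral_sub (intervalIntegrable_exp_mul hg S)
        (intervalIntegrable_exp_mul (by fun_prop) S)] at h1
    linarith

/-! ### The amplification factor of the local projection -/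

theorem IsLocalProj.degree_eq {ε : ℝ} {q : ℕ} {L : ℝ[X]} (h : IsLocalProj ε q 0 1 L) :
    L.natDegree = q := by
  refine h.natDegree_le.antisymm (not_lt.1 fun hlt => ?_)
  have hL0 : L ≠ 0 := by rintro rfl; simpa using h.eval_one
  refine hL0 (polynomial_eq_zero_of_integral (κ := fun s => Real.exp (-ε * s)) (by fun_prop)
    (fun s _ => Real.exp_pos _) ?_)
  rw [h.orth L ((Polynomial.natDegree_lt_iff_degree_lt hL0).1 hlt)]
  simp

/-- The roots of an orthogonal polynomial lie in the open interval: if `L = (X - a) R` with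
`a ∉ (0,1)`, then testing with `R` gives a contradiction. -/
theorem IsLocalProj.eval_ne_zero {ε : ℝ} {q : ℕ} {L : ℝ[X]} (h : IsLocalProj ε q 0 1 L) {a : ℝ}
    (ha : a ∉ Ioo (0:ℝ) 1) : L.eval a ≠ 0 := by
  intro hLa
  have hL0 : L ≠ 0 := by rintro rfl; simpa using h.eval_one
  obtain ⟨R, hR⟩ : (Polynomial.X - Polynomial.C a) ∣ L := Polynomial.dvd_iff_isRoot.2 hLa
  have h0 := h.orth R (degree_lt_of_eq_mul h.natDegree_le hR)
  simp only [Pi.zero_apply, zero_mul, mul_zero, intervalIntegral.integral_zero] at h0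
  have hR0 : R ≠ 0 := by rintro rfl; exact hL0 (by simpa using hR)
  rw [hR] at h0
  rcases le_or_gt a 0 with ha0 | ha0
  · refine hR0 (polynomial_eq_zero_of_integral (κ := fun s => Real.exp (-ε * s) * (s - a))
      (by fun_prop) (fun s hs => mul_pos (Real.exp_pos _) (by linarith [hs.1])) ?_)
    rw [← h0]; congr 1; ext s; simp; ring
  · have ha1 : 1 ≤ a := not_lt.1 fun h1 => ha ⟨ha0, h1⟩
    refine hR0 (polynomial_eq_zero_of_integral (κ := fun s => Real.exp (-ε * s) * (a - s))
      (by fun_prop) (fun s hs => mul_pos (Real.exp_pos _) (by linarith [hs.2])) ?_)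
    rw [← neg_eq_zero, ← intervalIntegral.integral_neg, ← h0]; congr 1; ext s; simp; ring

/-- For odd degree the orthogonal polynomial takes values of opposite signs at the end points of
the element, because it has no roots outside the element and opposite limits at `±∞`. -/
theorem IsLocalProj.eval_zero_neg {ε : ℝ} {q : ℕ} (hq : Odd q) {L : ℝ[X]}
    (h : IsLocalProj ε q 0 1 L) : L.eval 0 < 0 := by
  have hdeg := h.degree_eq
  have hqpos : 0 < q := hq.pos
  have hdegpos : 0 < L.degree := Polynomial.natDegree_pos_iff_degree_pos.1 (by omega)
  have hlc : 0 ≤ L.leadingCoeff := by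
    by_contra hneg
    have htend := L.tendsto_atBot_of_leadingCoeff_nonpos hdegpos (not_le.1 hneg).le
    obtain ⟨x, hx, hx1⟩ := ((htend.eventually (Filter.eventually_le_atBot 0)).and
      (Filter.eventually_ge_atTop 1)).exists
    obtain ⟨c, hc, hc0⟩ := intermediate_value_Icc' hx1 L.continuous.continuousOn
      (show (0:ℝ) ∈ Icc _ _ from ⟨hx, by rw [h.eval_one]; exact zero_le_one⟩)
    exact h.eval_ne_zero (fun h' => by linarith [h'.2, hc.1]) hc0
  by_contra hneg
  have hcomp : (L.comp (-Polynomial.X)).leadingCoeff = -L.leadingCoeff := by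
    rw [Polynomial.leadingCoeff_comp (by simp), hdeg, Polynomial.leadingCoeff_neg,
      Polynomial.leadingCoeff_X, hq.neg_one_pow]
    ring
  have hdeg' : 0 < (L.comp (-Polynomial.X)).degree := by
    rw [← Polynomial.natDegree_pos_iff_degree_pos, Polynomial.natDegree_comp]
    simp; omega
  have htend := (L.comp (-Polynomial.X)).tendsto_atBot_of_leadingCoeff_nonpos hdeg'
    (by rw [hcomp]; linarith)
  obtain ⟨x, hx, hx1⟩ := ((htend.eventually (Filter.eventually_le_atBot 0)).and
      (Filter.eventually_ge_atTop 0)).exists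
  simp only [Polynomial.eval_comp, Polynomial.eval_neg, Polynomial.eval_X] at hx
  obtain ⟨c, hc, hc0⟩ := intermediate_value_Icc (show -x ≤ 0 by linarith)
    L.continuous.continuousOn (show (0:ℝ) ∈ Icc _ _ from ⟨hx, not_lt.1 hneg⟩)
  exact h.eval_ne_zero (fun h' => by linarith [h'.1, hc.2]) hc0

/-- Energy identity for the orthogonal polynomial, from testing with its derivative. -/
theorem IsLocalProj.eval_zero_sq {ε : ℝ} {q : ℕ} {L : ℝ[X]} (h : IsLocalProj ε q 0 1 L) :
    (L.eval 0) ^ 2 = Real.exp (-ε) +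
      ε * ∫ s in (0:ℝ)..1, Real.exp (-ε * s) * (L.eval s * L.eval s) := by
  have hder : ∫ s in (0:ℝ)..1, Real.exp (-ε * s) * (L.eval s * L.derivative.eval s) = 0 := by
    rcases eq_or_ne L.natDegree 0 with h0 | h0
    · rw [Polynomial.derivative_of_natDegree_zero h0]; simp
    · rw [h.orth]
      · simp
      · refine (Polynomial.degree_derivative_lt (by rintro rfl; simp at h0)).trans_le ?_
        exact Polynomial.natDegree_le_iff_degree_le.1 h.natDegree_le
  have hftc := intervalIntegral.integral_eq_sub_of_hasDerivAt (a := 0) (b := 1)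
    (f := fun s => Real.exp (-ε * s) * (L.eval s * L.eval s))
    (f' := fun s => -ε * (Real.exp (-ε * s) * (L.eval s * L.eval s)) +
      2 * (Real.exp (-ε * s) * (L.eval s * L.derivative.eval s)))
    (fun s _ => by
      have h1 : HasDerivAt (fun s => Real.exp (-ε * s)) (Real.exp (-ε * s) * (-ε * 1)) s :=
        ((hasDerivAt_id s).const_mul (-ε)).exp
      have h2 := L.hasDerivAt s
      refine (h1.mul (h2.mul h2)).congr_deriv ?_
      simp only [Pi.mul_apply]
      ring)
    (by apply Continuous.intervalIntegrable; fun_prop)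
  rw [intervalIntegral.integral_add (by apply Continuous.intervalIntegrable; fun_prop)
      (by apply Continuous.intervalIntegrable; fun_prop), intervalIntegral.integral_const_mul,
    intervalIntegral.integral_const_mul, hder] at hftc
  simp only [h.eval_one, mul_one, mul_zero, Real.exp_zero, one_mul] at hftc
  nlinarith

/-- The orthogonal polynomials are uniformly bounded, and in odd degree their value at `0` is
negative and exceeds `1` in modulus by at most `O(ε)`. -/
theorem IsLocalProj.amplification {q : ℕ} (hq : Odd q) : ∃ C : ℝ, 0 < C ∧
    ∀ ε ∈ Icc (0:ℝ) 1, ∀ L : ℝ[X], IsLocalProj ε q 0 1 L →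
      (∀ s ∈ Icc (0:ℝ) 1, |L.eval s| ≤ C) ∧ L.eval 0 < 0 ∧ |L.eval 0| ≤ 1 + C * ε := by
  obtain ⟨C, hC0, hC⟩ := IsLocalProj.exists_bound q
  refine ⟨C + C ^ 2, by positivity, fun ε hε L hL => ?_⟩
  have hb : ∀ s ∈ Icc (0:ℝ) 1, |L.eval s| ≤ C := fun s hs => by
    have := hC ε hε 0 1 1 L continuousOn_const (by simp) (by simp) hL s hs
    rwa [mul_one] at this
  refine ⟨fun s hs => (hb s hs).trans (by nlinarith), hL.eval_zero_neg hq, ?_⟩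
  have hI : ∫ s in (0:ℝ)..1, Real.exp (-ε * s) * (L.eval s * L.eval s) ≤ C ^ 2 := by
    have : ∫ s in (0:ℝ)..1, C ^ 2 = C ^ 2 := by simp
    rw [← this]
    refine intervalIntegral.integral_mono_on zero_le_one
      (by apply Continuous.intervalIntegrable; fun_prop) (by simp) fun s hs => ?_
    have h1 : Real.exp (-ε * s) ≤ 1 := Real.exp_le_one_iff.2 (by nlinarith [hε.1, hs.1])
    have h2 : L.eval s * L.eval s ≤ C ^ 2 := by
      rw [← abs_mul_abs_self, sq]
      exact mul_self_le_mul_self (abs_nonneg _) (hb s hs)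
    calc _ ≤ 1 * (L.eval s * L.eval s) := mul_le_mul_of_nonneg_right h1 (mul_self_nonneg _)
      _ ≤ _ := by rwa [one_mul]
  have hsq := hL.eval_zero_sq
  have he : Real.exp (-ε) ≤ 1 := Real.exp_le_one_iff.2 (by linarith [hε.1])
  refine abs_le_of_sq_le_sq ?_ (by have := hε.1; positivity)
  have h3 := mul_le_mul_of_nonneg_left hI hε.1
  have h4 := mul_nonneg hC0.le hε.1
  have h5 := mul_nonneg (sq_nonneg C) hε.1
  have h6 := sq_nonneg ((C + C ^ 2) * ε)
  nlinarith

/-! ### Taylor polynomials on the reference element -/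

theorem exists_antiderivative {q : ℕ} {P : ℝ[X]} (hP : P.natDegree ≤ q) :
    ∃ Q : ℝ[X], Q.derivative = P ∧ Q.natDegree ≤ q + 1 := by
  refine ⟨∑ i ∈ Finset.range (q + 1), Polynomial.monomial (i + 1) (P.coeff i / (i + 1)), ?_, ?_⟩
  · conv_rhs => rw [P.as_sum_range' (q + 1) (by omega)]
    rw [Polynomial.derivative_sum]
    refine Finset.sum_congr rfl fun i _ => ?_
    rw [Polynomial.derivative_monomial]
    congr 1
    push_cast
    field_simp
  · refine Polynomial.natDegree_sum_le_of_forall_le _ _ fun i hi => ?_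
    exact (Polynomial.natDegree_monomial_le _).trans (by have := Finset.mem_range.1 hi; omega)

/-- Taylor approximation on `[0,1]` of a function given with its successive derivatives. -/
theorem exists_taylor (q : ℕ) : ∀ (g : ℕ → ℝ → ℝ) (M : ℝ),
    (∀ i ≤ q, ∀ s ∈ Icc (0:ℝ) 1, HasDerivWithinAt (g i) (g (i + 1) s) (Icc 0 1) s) →
    (∀ s ∈ Icc (0:ℝ) 1, |g (q + 1) s| ≤ M) →
    ∃ P : ℝ[X], P.natDegree ≤ q ∧ ∀ s ∈ Icc (0:ℝ) 1, |g 0 s - P.eval s| ≤ M ∧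
      |g 1 s - P.derivative.eval s| ≤ M := by
  have key : ∀ (g : ℕ → ℝ → ℝ) (M : ℝ) (P : ℝ[X]),
      (∀ s ∈ Icc (0:ℝ) 1, HasDerivWithinAt (g 0) (g 1 s) (Icc 0 1) s) →
      (∀ s ∈ Icc (0:ℝ) 1, |g 1 s - P.derivative.eval s| ≤ M) → P.eval 0 = g 0 0 →
      ∀ s ∈ Icc (0:ℝ) 1, |g 0 s - P.eval s| ≤ M := by
    intro g M P hg hM h0 s hs
    have := (convex_Icc (0:ℝ) 1).norm_image_sub_le_of_norm_hasDerivWithin_le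
      (f := fun s => g 0 s - P.eval s) (f' := fun s => g 1 s - P.derivative.eval s) (C := M)
      (fun s hs => (hg s hs).sub (P.hasDerivAt s).hasDerivWithinAt) hM
      (show (0:ℝ) ∈ Icc (0:ℝ) 1 by simp) hs
    simp only [h0, sub_self, sub_zero, Real.norm_eq_abs] at this
    refine this.trans ?_
    rw [abs_of_nonneg hs.1]
    exact mul_le_of_le_one_right ((abs_nonneg _).trans (hM 0 (by simp))) hs.2
  induction q with
  | zero =>
    intro g M hg hM
    have hM' : ∀ s ∈ Icc (0:ℝ) 1, |g 1 s - (Polynomial.C (g 0 0)).derivative.eval s| ≤ M :=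
      fun s hs => by simpa using hM s hs
    exact ⟨Polynomial.C (g 0 0), by simp, fun s hs =>
      ⟨key g M _ (hg 0 le_rfl) hM' (by simp) s hs, hM' s hs⟩⟩
  | succ q ih =>
    intro g M hg hM
    obtain ⟨P, hP, hPM⟩ := ih (fun i => g (i + 1)) M (fun i hi => hg (i + 1) (by omega)) hM
    obtain ⟨Q, hQ, hQdeg⟩ := exists_antiderivative hP
    have hM' : ∀ s ∈ Icc (0:ℝ) 1,
        |g 1 s - (Q + Polynomial.C (g 0 0 - Q.eval 0)).derivative.eval s| ≤ M :=
      fun s hs => by simpa [hQ] using (hPM s hs).1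
    exact ⟨Q + Polynomial.C (g 0 0 - Q.eval 0), (Polynomial.natDegree_add_C.trans_le hQdeg),
      fun s hs => ⟨key g M _ (hg 0 (by omega)) hM' (by simp) s hs, hM' s hs⟩⟩

/-- Markov-type inequality: derivatives of polynomials of bounded degree are controlled by their
values. -/
theorem exists_derivative_bound (q : ℕ) : ∃ C : ℝ, 0 < C ∧ ∀ (P : ℝ[X]) (M : ℝ), P.natDegree ≤ q →
    (∀ s ∈ Icc (0:ℝ) 1, |P.eval s| ≤ M) → ∀ s ∈ Icc (0:ℝ) 1, |P.derivative.eval s| ≤ C * M := by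
  obtain ⟨C, hC0, hC⟩ := eval_bound (q + 1)
  refine ⟨C + 1, by positivity, fun P M hP hM s hs => ?_⟩
  have hM0 : 0 ≤ M := (abs_nonneg _).trans (hM 0 (by simp))
  have hdeg : P.degree < (q + 1 : ℕ) :=
    (Polynomial.natDegree_le_iff_degree_le.1 hP).trans_lt (by exact_mod_cast Nat.lt_succ_self q)
  have hI : ∫ s in (0:ℝ)..1, (1 - s) * (P.eval s * P.eval s) ≤ M ^ 2 := by
    have : ∫ s in (0:ℝ)..1, M ^ 2 = M ^ 2 := by simp
    rw [← this]
    refine intervalIntegral.integral_mono_on zero_le_one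
      (by apply Continuous.intervalIntegrable; fun_prop) (by simp) fun s hs => ?_
    have h2 : P.eval s * P.eval s ≤ M ^ 2 := by
      rw [← abs_mul_abs_self, sq]
      exact mul_self_le_mul_self (abs_nonneg _) (hM s hs)
    calc _ ≤ 1 * (P.eval s * P.eval s) :=
          mul_le_mul_of_nonneg_right (by linarith [hs.1]) (mul_self_nonneg _)
      _ ≤ _ := by rwa [one_mul]
  refine abs_le_of_sq_le_sq ?_ (by positivity)
  refine ((hC P hdeg s hs).2.trans (mul_le_mul_of_nonneg_left hI hC0.le)).trans ?_
  nlinarith [mul_nonneg (sq_nonneg M) hC0.le, mul_nonneg (sq_nonneg M) (sq_nonneg C), sq_nonneg M]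

theorem exists_local_error (q : ℕ) : ∃ C : ℝ, 0 < C ∧ ∀ ε ∈ Icc (0:ℝ) 1, ∀ (g : ℕ → ℝ → ℝ) (M : ℝ)
    (G : ℝ[X]),
    (∀ i ≤ q, ∀ s ∈ Icc (0:ℝ) 1, HasDerivWithinAt (g i) (g (i + 1) s) (Icc 0 1) s) →
    (∀ s ∈ Icc (0:ℝ) 1, |g (q + 1) s| ≤ M) → IsLocalProj ε q (g 0) (g 0 1) G →
    ∀ s ∈ Icc (0:ℝ) 1, |G.eval s - g 0 s| ≤ C * M := by
  obtain ⟨C, hC0, hC⟩ := IsLocalProj.exists_bound q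
  refine ⟨C + 1, by positivity, fun ε hε g M G hg hM hG s hs => ?_⟩
  obtain ⟨P, hP, hPM⟩ := exists_taylor q g M hg hM
  have hcont : ContinuousOn (g 0) (Icc 0 1) := fun s hs =>
    (hg 0 (Nat.zero_le _) s hs).continuousWithinAt
  have h1 := hC ε hε _ _ M _ (hcont.sub (by fun_prop)) (fun s hs => (hPM s hs).1)
    ((hPM 1 (by simp)).1) (hG.sub hcont (by fun_prop) (isLocalProj_self hP)) s hs
  have h2 := (hPM s hs).1
  rw [Polynomial.eval_sub] at h1
  calc |G.eval s - g 0 s| = |(G.eval s - P.eval s) - (g 0 s - P.eval s)| := by congr 1; ring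
    _ ≤ |G.eval s - P.eval s| + |g 0 s - P.eval s| := abs_sub _ _
    _ ≤ (C + 1) * M := by linarith

/-- If a polynomial is close to a smooth function, so are the derivatives. -/
theorem exists_derivative_error (q : ℕ) : ∃ C : ℝ, 0 < C ∧ ∀ (g : ℕ → ℝ → ℝ) (M M' : ℝ) (P : ℝ[X]),
    (∀ i ≤ q, ∀ s ∈ Icc (0:ℝ) 1, HasDerivWithinAt (g i) (g (i + 1) s) (Icc 0 1) s) →
    (∀ s ∈ Icc (0:ℝ) 1, |g (q + 1) s| ≤ M) → P.natDegree ≤ q →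
    (∀ s ∈ Icc (0:ℝ) 1, |P.eval s - g 0 s| ≤ M') →
    ∀ s ∈ Icc (0:ℝ) 1, |P.derivative.eval s - g 1 s| ≤ C * (M + M') := by
  obtain ⟨C, hC0, hC⟩ := exists_derivative_bound q
  refine ⟨C + 1, by positivity, fun g M M' P hg hM hP hPM s hs => ?_⟩
  have hM'0 : 0 ≤ M' := (abs_nonneg _).trans (hPM s hs)
  obtain ⟨Q, hQ, hQM⟩ := exists_taylor q g M hg hM
  have h1 := hC (P - Q) (M + M')
    ((Polynomial.natDegree_sub_le_of_le hP hQ).trans_eq (max_self q)) (fun s hs => by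
      rw [Polynomial.eval_sub]
      calc |P.eval s - Q.eval s| = |(P.eval s - g 0 s) + (g 0 s - Q.eval s)| := by congr 1; ring
        _ ≤ |P.eval s - g 0 s| + |g 0 s - Q.eval s| := abs_add_le _ _
        _ ≤ _ := by linarith [hPM s hs, (hQM s hs).1]) s hs
  rw [Polynomial.derivative_sub, Polynomial.eval_sub] at h1
  calc |P.derivative.eval s - g 1 s|
      = |(P.derivative.eval s - Q.derivative.eval s) - (g 1 s - Q.derivative.eval s)| := by
        congr 1; ring
    _ ≤ |P.derivative.eval s - Q.derivative.eval s| + |g 1 s - Q.derivative.eval s| := abs_sub _ _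
    _ ≤ (C + 1) * (M + M') := by linarith [(hQM s hs).2]

/-! ### Bounded functions and functions with a bounded derivative off a countable set -/

/-- Essentially bounded measurable functions on `(0,T)`. -/
abbrev Bdd (T : ℝ) (f : ℝ → ℝ) : Prop := MemLp f ⊤ (volume.restrict (Ioo 0 T))

theorem Bdd.mul {T : ℝ} {f g : ℝ → ℝ} (hf : Bdd T f) (hg : Bdd T g) :
    Bdd T (fun t => f t * g t) :=
  MemLp.mul (p := ⊤) (q := ⊤) hg hf

theorem ae_restrict_Ioo {T : ℝ} {s : Set ℝ} (hs : s.Countable) {q : ℝ → Prop}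
    (h : ∀ t ∈ Ioo 0 T \ s, q t) : ∀ᵐ t ∂volume.restrict (Ioo 0 T), q t := by
  rw [ae_restrict_iff' measurableSet_Ioo]
  filter_upwards [hs.ae_notMem volume] with t ht ht'
  exact h t ⟨ht', ht⟩

theorem ContinuousOn.bdd {T : ℝ} {f : ℝ → ℝ} (hf : ContinuousOn f (Icc 0 T)) : Bdd T f := by
  obtain ⟨M, hM⟩ := isCompact_Icc.exists_bound_of_continuousOn hf
  refine memLp_top_of_bound ((hf.mono Ioo_subset_Icc_self).aestronglyMeasurable measurableSet_Ioo) M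
    (ae_restrict_Ioo countable_empty fun t ht => hM t (Ioo_subset_Icc_self ht.1))

theorem Bdd.intervalIntegrable {T : ℝ} (hT : 0 ≤ T) {f : ℝ → ℝ} (hf : Bdd T f) :
    IntervalIntegrable f volume 0 T := by
  rw [intervalIntegrable_iff_integrableOn_Ioo_of_le hT]
  exact hf.integrable le_top

theorem integral_congr_Ioo {T : ℝ} (hT : 0 ≤ T) {s : Set ℝ} (hs : s.Countable) {f g : ℝ → ℝ}
    (h : ∀ t ∈ Ioo 0 T \ s, f t = g t) : ∫ t in 0..T, f t = ∫ t in 0..T, g t := by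
  rw [intervalIntegral.integral_of_le hT, intervalIntegral.integral_of_le hT,
    integral_Ioc_eq_integral_Ioo, integral_Ioc_eq_integral_Ioo]
  exact integral_congr_ae (ae_restrict_Ioo hs h)

/-- `f` is continuous on `[0,T]` and, off a countable set, differentiable with the bounded
derivative `f'`. -/
structure HasPwDeriv (T : ℝ) (f f' : ℝ → ℝ) : Prop where
  continuousOn : ContinuousOn f (Icc 0 T)
  exists_bound : ∃ s : Set ℝ, s.Countable ∧ ∃ M : ℝ, ∀ t ∈ Ioo 0 T \ s,
    HasDerivAt f (f' t) t ∧ |f' t| ≤ M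

theorem HasPwDeriv.bdd {T : ℝ} {f f' : ℝ → ℝ} (h : HasPwDeriv T f f') : Bdd T f :=
  ContinuousOn.bdd h.continuousOn

theorem HasPwDeriv.bdd_deriv {T : ℝ} {f f' : ℝ → ℝ} (h : HasPwDeriv T f f') : Bdd T f' := by
  obtain ⟨s, hs, M, hM⟩ := h.exists_bound
  refine memLp_top_of_bound ?_ M (ae_restrict_Ioo hs fun t ht => (hM t ht).2)
  exact ((measurable_deriv f).aestronglyMeasurable).congr
    (ae_restrict_Ioo hs fun t ht => (hM t ht).1.deriv)

theorem HasPwDeriv.integral_eq {T : ℝ} {f f' : ℝ → ℝ} (h : HasPwDeriv T f f') {a b : ℝ}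
    (ha : a ∈ Icc 0 T) (hb : b ∈ Icc 0 T) : ∫ t in a..b, f' t = f b - f a := by
  obtain ⟨s, hs, M, hM⟩ := h.exists_bound
  have hsub : uIcc a b ⊆ Icc 0 T := uIcc_subset_Icc ha hb
  refine integral_eq_of_hasDerivAt_off_countable f f' hs (h.continuousOn.mono hsub)
    (fun t ht => (hM t ⟨⟨?_, ?_⟩, ht.2⟩).1) ?_
  · exact (le_min ha.1 hb.1).trans_lt ht.1.1
  · exact ht.1.2.trans_le (max_le ha.2 hb.2)
  · have hT : 0 ≤ T := ha.1.trans ha.2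
    exact (h.bdd_deriv.intervalIntegrable hT).mono_set (by rwa [uIcc_of_le hT])

theorem HasPwDeriv.lipschitz {T : ℝ} {f f' : ℝ → ℝ} (h : HasPwDeriv T f f') :
    ∃ K, LipschitzOnWith K f (Icc 0 T) := by
  obtain ⟨s, hs, M, hM⟩ := h.exists_bound
  refine ⟨Real.toNNReal M, LipschitzOnWith.of_dist_le_mul fun x hx y hy => ?_⟩
  rw [dist_comm, Real.dist_eq, ← h.integral_eq hx hy, dist_comm, Real.dist_eq]
  refine intervalIntegral.norm_integral_le_of_norm_le_const_ae (f := f') ?_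
  filter_upwards [hs.ae_notMem volume, (countable_singleton T).ae_notMem volume] with t ht htT ht'
  have h1 := uIoc_subset_uIcc ht'
  have h2 := uIcc_subset_Icc hx hy h1
  have h3 : 0 < t := (le_min hx.1 hy.1).trans_lt ht'.1
  exact ((hM t ⟨⟨h3, lt_of_le_of_ne h2.2 htT⟩, ht⟩).2).trans (Real.le_coe_toNNReal M)

theorem HasPwDeriv.sub {T : ℝ} {f f' g g' : ℝ → ℝ} (hf : HasPwDeriv T f f')
    (hg : HasPwDeriv T g g') : HasPwDeriv T (fun t => f t - g t) (fun t => f' t - g' t) := by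
  obtain ⟨s, hs, M, hM⟩ := hf.exists_bound
  obtain ⟨s', hs', M', hM'⟩ := hg.exists_bound
  refine ⟨hf.continuousOn.sub hg.continuousOn, s ∪ s', hs.union hs', M + M', fun t ht => ?_⟩
  have h1 := hM t ⟨ht.1, fun h => ht.2 (Or.inl h)⟩
  have h2 := hM' t ⟨ht.1, fun h => ht.2 (Or.inr h)⟩
  exact ⟨h1.1.sub h2.1, (abs_sub _ _).trans (add_le_add h1.2 h2.2)⟩

theorem HasPwDeriv.mul {T : ℝ} {f f' g g' : ℝ → ℝ} (hf : HasPwDeriv T f f')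
    (hg : HasPwDeriv T g g') :
    HasPwDeriv T (fun t => f t * g t) (fun t => f' t * g t + f t * g' t) := by
  obtain ⟨s, hs, M, hM⟩ := hf.exists_bound
  obtain ⟨s', hs', M', hM'⟩ := hg.exists_bound
  obtain ⟨F, hF⟩ := isCompact_Icc.exists_bound_of_continuousOn hf.continuousOn
  obtain ⟨G, hG⟩ := isCompact_Icc.exists_bound_of_continuousOn hg.continuousOn
  refine ⟨hf.continuousOn.mul hg.continuousOn, s ∪ s', hs.union hs', M * G + F * M', fun t ht => ?_⟩
  have h1 := hM t ⟨ht.1, fun h => ht.2 (Or.inl h)⟩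
  have h2 := hM' t ⟨ht.1, fun h => ht.2 (Or.inr h)⟩
  refine ⟨h1.1.mul h2.1, (abs_add_le _ _).trans ?_⟩
  rw [abs_mul, abs_mul]
  have h3 := hF t (Ioo_subset_Icc_self ht.1)
  have h4 := hG t (Ioo_subset_Icc_self ht.1)
  exact add_le_add (mul_le_mul h1.2 h4 (abs_nonneg _) ((abs_nonneg _).trans h1.2))
    (mul_le_mul h3 h2.2 (abs_nonneg _) ((abs_nonneg _).trans h3))

theorem hasPwDeriv_of_hasDerivWithinAt {T : ℝ} {f f' : ℝ → ℝ}
    (h : ∀ t ∈ Icc 0 T, HasDerivWithinAt f (f' t) (Icc 0 T) t) (hc : ContinuousOn f' (Icc 0 T)) :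
    HasPwDeriv T f f' := by
  obtain ⟨M, hM⟩ := isCompact_Icc.exists_bound_of_continuousOn hc
  exact ⟨fun t ht => (h t ht).continuousWithinAt, ∅, countable_empty, M, fun t ht =>
    ⟨(h t (Ioo_subset_Icc_self ht.1)).hasDerivAt (Icc_mem_nhds ht.1.1 ht.1.2),
      hM t (Ioo_subset_Icc_self ht.1)⟩⟩

/-! ### Iterated derivatives on the time interval -/

theorem tD_zero (T : ℝ) (u : ℝ → ℝ) : tD T 0 u = u := iteratedDerivWithin_zero

theorem tD_tD (T : ℝ) (k l : ℕ) (u : ℝ → ℝ) : tD T k (tD T l u) = tD T (k + l) u := by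
  unfold tD
  induction k with
  | zero => simp
  | succ k ih => rw [iteratedDerivWithin_succ, ih, Nat.succ_add, ← iteratedDerivWithin_succ]

theorem tD_succ (T : ℝ) (k : ℕ) (u : ℝ → ℝ) :
    tD T (k + 1) u = derivWithin (tD T k u) (Icc 0 T) := iteratedDerivWithin_succ

theorem tD_one (T : ℝ) (u : ℝ → ℝ) : tD T 1 u = derivWithin u (Icc 0 T) := by
  rw [tD_succ T 0, tD_zero]

theorem tD_succ_of_notMem {T : ℝ} {k : ℕ} {u : ℝ → ℝ} {t : ℝ} (ht : t ∉ Icc 0 T) :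
    tD T (k + 1) u t = 0 := by
  rw [tD_succ]
  exact derivWithin_zero_of_notMem_closure (by rwa [isClosed_Icc.closure_eq])

theorem tD_one_of_hasDerivWithinAt {T : ℝ} (hT : 0 < T) {u : ℝ → ℝ} {d t : ℝ} (ht : t ∈ Icc 0 T)
    (h : HasDerivWithinAt u d (Icc 0 T) t) : tD T 1 u t = d := by
  rw [tD_one]; exact h.derivWithin (uniqueDiffOn_Icc hT t ht)

theorem tD_one_of_hasDerivAt {T : ℝ} (hT : 0 < T) {u : ℝ → ℝ} {d t : ℝ} (ht : t ∈ Icc 0 T)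
    (h : HasDerivAt u d t) : tD T 1 u t = d :=
  tD_one_of_hasDerivWithinAt hT ht h.hasDerivWithinAt

theorem hasDerivWithinAt_tD {T : ℝ} (hT : 0 < T) {m : ℕ} {u : ℝ → ℝ}
    (hu : ContDiffOn ℝ m u (Icc 0 T)) {k : ℕ} (hk : k < m) {t : ℝ} (ht : t ∈ Icc 0 T) :
    HasDerivWithinAt (tD T k u) (tD T (k + 1) u t) (Icc 0 T) t := by
  rw [tD_succ]
  exact (hu.differentiableOn_iteratedDerivWithin (by exact_mod_cast hk) (uniqueDiffOn_Icc hT)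
    t ht).hasDerivWithinAt

theorem continuousOn_tD {T : ℝ} (hT : 0 < T) {m : ℕ} {u : ℝ → ℝ}
    (hu : ContDiffOn ℝ m u (Icc 0 T)) {k : ℕ} (hk : k ≤ m) : ContinuousOn (tD T k u) (Icc 0 T) :=
  hu.continuousOn_iteratedDerivWithin (by exact_mod_cast hk) (uniqueDiffOn_Icc hT)

theorem contDiffOn_one_of_hasDerivWithinAt {T : ℝ} (hT : 0 < T) {w w1 : ℝ → ℝ}
    (h : ∀ t ∈ Icc 0 T, HasDerivWithinAt w (w1 t) (Icc 0 T) t) (hc : ContinuousOn w1 (Icc 0 T)) :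
    ContDiffOn ℝ 1 w (Icc 0 T) := by
  rw [contDiffOn_one_iff_derivWithin (uniqueDiffOn_Icc hT)]
  refine ⟨fun t ht => (h t ht).differentiableWithinAt, hc.congr fun t ht => ?_⟩
  exact (h t ht).derivWithin (uniqueDiffOn_Icc hT t ht)

/-- A function with a derivative that has a bounded derivative off a countable set belongs to
`H²`. -/
theorem mem_H20_of_hasPwDeriv {T : ℝ} (hT : 0 < T) {w w1 w2 : ℝ → ℝ}
    (h0 : ∀ t, t ∉ Icc 0 T → w t = 0) (hw0 : w 0 = 0)
    (h : ∀ t ∈ Icc 0 T, HasDerivWithinAt w (w1 t) (Icc 0 T) t) (h1 : HasPwDeriv T w1 w2) :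
    w ∈ H20 hT := by
  have e1 : EqOn (tD T 1 w) w1 (Icc 0 T) := fun t ht => tD_one_of_hasDerivWithinAt hT ht (h t ht)
  refine ⟨⟨h0, contDiffOn_one_of_hasDerivWithinAt hT h h1.continuousOn, ?_, ?_⟩, hw0⟩
  · obtain ⟨K, hK⟩ := h1.lipschitz
    have : LipschitzOnWith K (tD T 1 w) (Icc 0 T) := fun x hx y hy => by
      rw [e1 hx, e1 hy]; exact hK hx hy
    exact LipschitzOnWith.absolutelyContinuousOnInterval (by rwa [uIcc_of_le hT.le])
  · obtain ⟨s, hs, M, hM⟩ := h1.exists_bound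
    refine (h1.bdd_deriv.mono_exponent le_top).ae_eq ?_
    refine ae_restrict_Ioo hs fun t ht => ?_
    have ht' := Ioo_subset_Icc_self ht.1
    rw [tD_succ, derivWithin_congr e1 (e1 ht'), ((hM t ht).1.hasDerivWithinAt).derivWithin
      (uniqueDiffOn_Icc hT t ht')]

/-- For a function as above the second derivative is the expected one. -/
theorem tD_two_of_hasDerivAt {T : ℝ} (hT : 0 < T) {w w1 : ℝ → ℝ} {d t : ℝ}
    (h : ∀ t ∈ Icc 0 T, HasDerivWithinAt w (w1 t) (Icc 0 T) t) (ht : t ∈ Icc 0 T)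
    (h1 : HasDerivAt w1 d t) : tD T 2 w t = d := by
  have e1 : EqOn (tD T 1 w) w1 (Icc 0 T) := fun t ht => tD_one_of_hasDerivWithinAt hT ht (h t ht)
  rw [tD_succ, derivWithin_congr e1 (e1 ht), h1.hasDerivWithinAt.derivWithin
      (uniqueDiffOn_Icc hT t ht)]

/-! ### Piecewise polynomials in reference coordinates -/

/-- The nodes of the uniform mesh (continued beyond `T`). -/
def nodes (T : ℝ) (N : ℕ) : Set ℝ := Set.range fun j : ℕ => (j : ℝ) * (T / N)

theorem countable_nodes (T : ℝ) (N : ℕ) : (nodes T N).Countable := countable_range _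

section Mesh

variable {T : ℝ} {N : ℕ}

theorem mesh_pos (hT : 0 < T) (hN : 1 ≤ N) : 0 < T / N := by
  have : (0:ℝ) < N := by exact_mod_cast hN
  positivity

theorem mesh_last (hN : 1 ≤ N) : (N : ℝ) * (T / N) = T := by
  have : (N:ℝ) ≠ 0 := by positivity
  field_simp

theorem ref_mem_elt (hT : 0 < T) (hN : 1 ≤ N) {j : ℕ} {s : ℝ} (hs : s ∈ Icc (0:ℝ) 1) :
    ((j : ℝ) + s) * (T / N) ∈ elt T N j := by
  have h := mesh_pos hT hN
  constructor
  · nlinarith [hs.1]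
  · nlinarith [hs.2]

theorem ref_mem_interior (hT : 0 < T) (hN : 1 ≤ N) {j : ℕ} {s : ℝ} (hs : s ∈ Ioo (0:ℝ) 1) :
    ((j : ℝ) + s) * (T / N) ∈ interior (elt T N j) := by
  have h := mesh_pos hT hN
  rw [elt, interior_Icc]
  constructor
  · nlinarith [hs.1]
  · nlinarith [hs.2]

theorem elt_subset (hT : 0 < T) (hN : 1 ≤ N) {j : ℕ} (hj : j < N) : elt T N j ⊆ Icc 0 T := by
  have h := mesh_pos hT hN
  have hj' : ((j:ℝ) + 1) ≤ N := by exact_mod_cast hj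
  intro t ht
  constructor
  · exact (by positivity : (0:ℝ) ≤ j * (T / N)).trans ht.1
  · calc t ≤ (j + 1) * (T / N) := ht.2
      _ ≤ N * (T / N) := mul_le_mul_of_nonneg_right hj' h.le
      _ = T := mesh_last hN

theorem ref_mem_Icc (hT : 0 < T) (hN : 1 ≤ N) {j : ℕ} (hj : j < N) {s : ℝ}
    (hs : s ∈ Icc (0:ℝ) 1) : ((j : ℝ) + s) * (T / N) ∈ Icc 0 T :=
  elt_subset hT hN hj (ref_mem_elt hT hN hs)

theorem exists_ref_of_mem_elt (hT : 0 < T) (hN : 1 ≤ N) {j : ℕ} {t : ℝ} (ht : t ∈ elt T N j) :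
    ∃ s ∈ Icc (0:ℝ) 1, t = ((j : ℝ) + s) * (T / N) := by
  have h := mesh_pos hT hN
  refine ⟨t / (T / N) - j, ⟨?_, ?_⟩, ?_⟩
  · rw [sub_nonneg, le_div_iff₀ h]; exact ht.1
  · rw [sub_le_iff_le_add', div_le_iff₀ h]; exact ht.2
  · rw [add_sub_cancel, div_mul_cancel₀ _ h.ne']

theorem exists_ref_of_mem_interior (hT : 0 < T) (hN : 1 ≤ N) {j : ℕ} {t : ℝ}
    (ht : t ∈ interior (elt T N j)) : ∃ s ∈ Ioo (0:ℝ) 1, t = ((j : ℝ) + s) * (T / N) := by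
  have h := mesh_pos hT hN
  rw [elt, interior_Icc] at ht
  refine ⟨t / (T / N) - j, ⟨?_, ?_⟩, ?_⟩
  · rw [sub_pos, lt_div_iff₀ h]; exact ht.1
  · rw [sub_lt_iff_lt_add', div_lt_iff₀ h]; exact ht.2
  · rw [add_sub_cancel, div_mul_cancel₀ _ h.ne']

theorem exists_ref (hT : 0 < T) (hN : 1 ≤ N) {t : ℝ} (ht : t ∈ Icc 0 T) :
    ∃ j < N, ∃ s ∈ Icc (0:ℝ) 1, t = ((j : ℝ) + s) * (T / N) := by
  have h := mesh_pos hT hN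
  rcases ht.2.eq_or_lt with rfl | hlt
  · refine ⟨N - 1, by omega, 1, by simp, ?_⟩
    rw [Nat.cast_sub hN]; push_cast
    rw [sub_add_cancel, mesh_last hN]
  · have h0 : 0 ≤ t / (T / N) := div_nonneg ht.1 h.le
    refine ⟨⌊t / (T / N)⌋₊, ?_, exists_ref_of_mem_elt hT hN ⟨?_, ?_⟩⟩
    · rw [Nat.floor_lt h0, div_lt_iff₀ h, mesh_last hN]; exact hlt
    · rw [← le_div_iff₀ h]; exact Nat.floor_le h0
    · rw [← div_le_iff₀ h]; exact (Nat.lt_floor_add_one _).le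

theorem exists_ref_interior (hT : 0 < T) (hN : 1 ≤ N) {t : ℝ} (ht : t ∈ Ioo 0 T)
    (hn : t ∉ nodes T N) : ∃ j < N, ∃ s ∈ Ioo (0:ℝ) 1, t = ((j : ℝ) + s) * (T / N) := by
  obtain ⟨j, hj, s, hs, rfl⟩ := exists_ref hT hN (Ioo_subset_Icc_self ht)
  refine ⟨j, hj, s, ⟨lt_of_le_of_ne hs.1 ?_, lt_of_le_of_ne hs.2 ?_⟩, rfl⟩
  · rintro rfl; exact hn ⟨j, by simp⟩
  · rintro rfl; exact hn ⟨j + 1, by simp⟩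

/-- A function that is continuous on every element is continuous. -/
theorem continuousOn_of_elt (hN : 1 ≤ N) (hT : 0 < T) {f : ℝ → ℝ}
    (hf : ∀ j < N, ContinuousOn f (elt T N j)) : ContinuousOn f (Icc 0 T) := by
  have h := mesh_pos hT hN
  have key : ∀ k ≤ N, ContinuousOn f (Icc 0 (k * (T / N))) := by
    intro k
    induction k with
    | zero => intro _; simp
    | succ k ih =>
      intro hk
      have h1 := (ih (by omega)).union_of_isClosed (hf k (by omega)) isClosed_Icc isClosed_Icc
      rwa [elt, Icc_union_Icc_eq_Icc (by positivity)
        (mul_le_mul_of_nonneg_right (by linarith) h.le), ← Nat.cast_succ] at h1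
  have := key N le_rfl
  rwa [mesh_last hN] at this

/-- An integral over `(0,T)` in reference coordinates. -/
theorem integral_eq_sum_ref (hT : 0 < T) (hN : 1 ≤ N) {f : ℝ → ℝ}
    (hf : IntervalIntegrable f volume 0 T) :
    ∫ t in 0..T, f t =
      ∑ j ∈ Finset.range N, (T / N) * ∫ s in (0:ℝ)..1, f (((j : ℝ) + s) * (T / N)) := by
  have h := mesh_pos hT hN
  have h1 := intervalIntegral.sum_integral_adjacent_intervals (f := f) (μ := volume)
    (a := fun k : ℕ => (k : ℝ) * (T / N)) (n := N) (fun k hk => by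
      refine hf.mono_set ?_
      rw [uIcc_of_le hT.le, uIcc_of_le (by push_cast; nlinarith)]
      have := elt_subset hT hN hk
      simpa [elt] using this)
  simp only [Nat.cast_zero, zero_mul, mesh_last hN] at h1
  rw [← h1]
  refine Finset.sum_congr rfl fun j _ => ?_
  have h2 := intervalIntegral.integral_comp_add_left (a := 0) (b := 1) (fun x => f (x * (T / N))) j
  rw [h2, intervalIntegral.integral_comp_mul_right (fun x => f x) h.ne', smul_eq_mul,
    mul_inv_cancel_left₀ h.ne']
  simp

theorem degree_comp_linear_lt {q : ℕ} {P : ℝ[X]} (hP : P.degree < q) (a b : ℝ) :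
    (P.comp (Polynomial.C a * Polynomial.X + Polynomial.C b)).degree < q := by
  rcases eq_or_ne P 0 with rfl | hP0
  · simp
  rcases eq_or_ne (P.comp (Polynomial.C a * Polynomial.X + Polynomial.C b)) 0 with h | h
  · rw [h]; simp
  · rw [← Polynomial.natDegree_lt_iff_degree_lt h]
    refine (Polynomial.natDegree_comp_le.trans
      (Nat.mul_le_mul_left _ (Polynomial.natDegree_linear_le))).trans_lt ?_
    rw [mul_one]
    exact (Polynomial.natDegree_lt_iff_degree_lt hP0).2 hP

theorem natDegree_comp_linear_le {q : ℕ} {P : ℝ[X]} (hP : P.natDegree ≤ q) (a b : ℝ) :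
    (P.comp (Polynomial.C a * Polynomial.X + Polynomial.C b)).natDegree ≤ q :=
  (Polynomial.natDegree_comp_le.trans
      (Nat.mul_le_mul_left _ (Polynomial.natDegree_linear_le))).trans (by rwa [mul_one])

/-- A continuous piecewise polynomial is given by polynomials in reference coordinates. -/
theorem exists_ref_of_mem_cpw (hT : 0 < T) (hN : 1 ≤ N) {q : ℕ} {w : ℝ → ℝ} (hw : w ∈ cpw T N q) :
    ∃ W : ℕ → ℝ[X], ∀ j < N, (W j).natDegree ≤ q ∧
      ∀ s ∈ Icc (0:ℝ) 1, w (((j : ℝ) + s) * (T / N)) = (W j).eval s := by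
  obtain ⟨-, -, h⟩ := hw
  choose! P hP hPw using h
  refine ⟨fun j => (P j).comp (Polynomial.C (T / N) * Polynomial.X + Polynomial.C (j * (T / N))),
    fun j hj => ⟨natDegree_comp_linear_le (hP j hj) _ _, fun s hs => ?_⟩⟩
  rw [hPw j hj (ref_mem_elt hT hN hs)]
  simp only [Polynomial.eval_comp, Polynomial.eval_add, Polynomial.eval_mul, Polynomial.eval_C,
    Polynomial.eval_X]
  congr 1; ring

/-- Membership in the space of continuous piecewise polynomials from reference coordinates. -/
theorem mem_cpw_of_ref (hT : 0 < T) (hN : 1 ≤ N) {q : ℕ} {w : ℝ → ℝ}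
    (h0 : ∀ t, t ∉ Icc 0 T → w t = 0) {W : ℕ → ℝ[X]}
    (hW : ∀ j < N, (W j).natDegree ≤ q)
    (h : ∀ j < N, ∀ s ∈ Icc (0:ℝ) 1, w (((j : ℝ) + s) * (T / N)) = (W j).eval s) :
    w ∈ cpw T N q := by
  have hpos := mesh_pos hT hN
  have hp : ∀ j < N, ∃ P : ℝ[X], P.natDegree ≤ q ∧ EqOn w (fun t => P.eval t) (elt T N j) := by
    refine fun j hj => ⟨(W j).comp (Polynomial.C (T / N)⁻¹ * Polynomial.X + Polynomial.C (-(j : ℝ))),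
      natDegree_comp_linear_le (hW j hj) _ _, fun t ht => ?_⟩
    obtain ⟨s, hs, rfl⟩ := exists_ref_of_mem_elt hT hN ht
    rw [h j hj s hs]
    simp only [Polynomial.eval_comp, Polynomial.eval_add, Polynomial.eval_mul, Polynomial.eval_C,
      Polynomial.eval_X]
    congr 1; field_simp; ring
  refine ⟨h0, continuousOn_of_elt hN hT fun j hj => ?_, hp⟩
  obtain ⟨P, -, hP⟩ := hp j hj
  exact P.continuous.continuousOn.congr hP

/-- Polynomials on the elements whose values match at the nodes can be glued. -/
theorem exists_glue (hT : 0 < T) (hN : 1 ≤ N) {q : ℕ} {W : ℕ → ℝ[X]}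
    (hW : ∀ j < N, (W j).natDegree ≤ q)
    (hmatch : ∀ j, j + 1 < N → (W j).eval 1 = (W (j + 1)).eval 0) :
    ∃ w ∈ cpw T N q, ∀ j < N, ∀ s ∈ Icc (0:ℝ) 1,
      w (((j : ℝ) + s) * (T / N)) = (W j).eval s := by
  have hpos := mesh_pos hT hN
  set k : ℝ → ℕ := fun t => min ⌊t / (T / N)⌋₊ (N - 1)
  set w : ℝ → ℝ := (Icc 0 T).indicator fun t => (W (k t)).eval (t / (T / N) - k t) with hw
  have hwW : ∀ j < N, ∀ s ∈ Icc (0:ℝ) 1, w (((j : ℝ) + s) * (T / N)) = (W j).eval s := by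
    intro j hj s hs
    rw [hw, indicator_of_mem (ref_mem_Icc hT hN hj hs)]
    have hdiv : ((j : ℝ) + s) * (T / N) / (T / N) = j + s := mul_div_cancel_right₀ _ hpos.ne'
    simp only [k, hdiv]
    rcases hs.2.eq_or_lt with rfl | hs1
    · have hf : ⌊(j : ℝ) + 1⌋₊ = j + 1 := by exact_mod_cast Nat.floor_natCast (j + 1)
      rw [hf]
      rcases Nat.lt_or_ge (j + 1) N with h1 | h1
      · rw [min_eq_left (by omega), hmatch j h1]; simp
      · rw [min_eq_right (by omega), show N - 1 = j by omega]; simp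
    · have hf : ⌊(j : ℝ) + s⌋₊ = j := by
        rw [Nat.floor_eq_iff (by have := hs.1; positivity)]
        constructor <;> linarith [hs.1]
      rw [hf, min_eq_left (by omega)]; simp
  exact ⟨w, mem_cpw_of_ref hT hN (fun t ht => indicator_of_notMem ht _) hW hwW, hwW⟩

theorem hasDerivAt_of_ref (hT : 0 < T) (hN : 1 ≤ N) {j : ℕ} {w : ℝ → ℝ} {W : ℝ[X]}
    (h : ∀ s ∈ Icc (0:ℝ) 1, w (((j : ℝ) + s) * (T / N)) = W.eval s) {s : ℝ}
    (hs : s ∈ Ioo (0:ℝ) 1) :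
    HasDerivAt w (W.derivative.eval s / (T / N)) (((j : ℝ) + s) * (T / N)) := by
  have hpos := mesh_pos hT hN
  have hdiv : ((j : ℝ) + s) * (T / N) / (T / N) - j = s := by
    rw [mul_div_cancel_right₀ _ hpos.ne']; ring
  have h1 : HasDerivAt (fun t => W.eval (t / (T / N) - j)) (W.derivative.eval s / (T / N))
      (((j : ℝ) + s) * (T / N)) := by
    have h2 : HasDerivAt (fun t : ℝ => t / (T / N) - j) (1 / (T / N)) (((j : ℝ) + s) * (T / N)) :=
      ((hasDerivAt_id _).div_const _).sub_const _
    have h3 := (W.hasDerivAt (((j : ℝ) + s) * (T / N) / (T / N) - j)).comp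
      (((j : ℝ) + s) * (T / N)) h2
    rw [hdiv] at h3
    exact h3.congr_deriv (by ring)
  refine h1.congr_of_eventuallyEq ?_
  filter_upwards [isOpen_interior.mem_nhds (ref_mem_interior hT hN hs)] with t ht
  obtain ⟨s', hs', rfl⟩ := exists_ref_of_mem_interior hT hN ht
  rw [h s' (Ioo_subset_Icc_self hs')]
  congr 1
  rw [mul_div_cancel_right₀ _ hpos.ne']; ring

theorem tD_one_ref (hT : 0 < T) (hN : 1 ≤ N) {j : ℕ} (hj : j < N) {w : ℝ → ℝ} {W : ℝ[X]}
    (h : ∀ s ∈ Icc (0:ℝ) 1, w (((j : ℝ) + s) * (T / N)) = W.eval s) {s : ℝ}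
    (hs : s ∈ Ioo (0:ℝ) 1) :
    tD T 1 w (((j : ℝ) + s) * (T / N)) = W.derivative.eval s / (T / N) :=
  tD_one_of_hasDerivAt hT (ref_mem_Icc hT hN hj (Ioo_subset_Icc_self hs))
    (hasDerivAt_of_ref hT hN h hs)

theorem exists_uniform_bound (W : ℕ → ℝ[X]) (N : ℕ) :
    ∃ M : ℝ, ∀ j < N, ∀ s ∈ Icc (0:ℝ) 1, |(W j).eval s| ≤ M := by
  choose M hM using fun j => isCompact_Icc.exists_bound_of_continuousOn
    ((W j).continuous.continuousOn (s := Icc (0:ℝ) 1))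
  refine ⟨∑ j ∈ Finset.range N, M j, fun j hj s hs => (hM j s hs).trans ?_⟩
  exact Finset.single_le_sum (fun i _ => (norm_nonneg _).trans (hM i s hs))
    (Finset.mem_range.2 hj)

theorem hasPwDeriv_of_mem_cpw (hT : 0 < T) (hN : 1 ≤ N) {q : ℕ} {w : ℝ → ℝ} (hw : w ∈ cpw T N q) :
    HasPwDeriv T w (tD T 1 w) := by
  have hpos := mesh_pos hT hN
  obtain ⟨W, hW⟩ := exists_ref_of_mem_cpw hT hN hw
  obtain ⟨M, hM⟩ := exists_uniform_bound (fun j => (W j).derivative) N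
  refine ⟨hw.2.1, nodes T N, countable_nodes T N, M / (T / N), fun t ht => ?_⟩
  obtain ⟨j, hj, s, hs, rfl⟩ := exists_ref_interior hT hN ht.1 ht.2
  have h1 := hasDerivAt_of_ref hT hN (hW j hj).2 hs
  rw [tD_one_ref hT hN hj (hW j hj).2 hs]
  refine ⟨h1, ?_⟩
  rw [abs_div, abs_of_pos hpos]
  exact div_le_div_of_nonneg_right (hM j hj s (Ioo_subset_Icc_self hs)) hpos.le

/-- The derivative of a continuous piecewise polynomial is a discontinuous one. -/
theorem isDiscPw_tD_one (hT : 0 < T) (hN : 1 ≤ N) {q : ℕ} {w : ℝ → ℝ} (hw : w ∈ cpw T N q) :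
    IsDiscPw T N q (tD T 1 w) := by
  obtain ⟨-, -, h⟩ := hw
  intro j hj
  obtain ⟨P, hP, hPw⟩ := h j hj
  refine ⟨P.derivative, ?_, fun t ht => ?_⟩
  · rcases eq_or_ne P 0 with rfl | hP0
    · simp
    · exact (Polynomial.degree_derivative_lt hP0).trans_le
        (Polynomial.natDegree_le_iff_degree_le.1 hP)
  · refine tD_one_of_hasDerivAt hT (elt_subset hT hN hj (interior_subset ht)) ?_
    refine (P.hasDerivAt t).congr_of_eventuallyEq ?_
    filter_upwards [isOpen_interior.mem_nhds ht] with x hx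
    exact hPw (interior_subset hx)

theorem IsDiscPw.exists_ref (hT : 0 < T) (hN : 1 ≤ N) {q : ℕ} {r : ℝ → ℝ}
    (hr : IsDiscPw T N q r) : ∃ R : ℕ → ℝ[X], ∀ j < N, (R j).degree < q ∧
      ∀ s ∈ Ioo (0:ℝ) 1, r (((j : ℝ) + s) * (T / N)) = (R j).eval s := by
  unfold IsDiscPw at hr
  choose! P hP hPw using hr
  refine ⟨fun j => (P j).comp (Polynomial.C (T / N) * Polynomial.X + Polynomial.C (j * (T / N))),
    fun j hj => ⟨degree_comp_linear_lt (hP j hj) _ _, fun s hs => ?_⟩⟩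
  rw [hPw j hj (ref_mem_interior hT hN hs)]
  simp only [Polynomial.eval_comp, Polynomial.eval_add, Polynomial.eval_mul, Polynomial.eval_C,
    Polynomial.eval_X]
  congr 1; ring

/-- A discontinuous piecewise polynomial is bounded and measurable. -/
theorem IsDiscPw.bdd (hT : 0 < T) (hN : 1 ≤ N) {q : ℕ} {r : ℝ → ℝ}
    (hr : IsDiscPw T N q r) : Bdd T r := by
  obtain ⟨R, hR⟩ := hr.exists_ref hT hN
  obtain ⟨M, hM⟩ := exists_uniform_bound R N
  refine memLp_top_of_bound ?_ M (ae_restrict_Ioo (countable_nodes T N) fun t ht => ?_)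
  · have h1 : AEStronglyMeasurable r (volume.restrict (⋃ j : Fin N, elt T N j)) := by
      rw [aestronglyMeasurable_iUnion_iff]
      intro j
      obtain ⟨P, -, hP⟩ := hr j j.2
      rw [elt, interior_Icc] at hP
      rw [elt, ← Measure.restrict_congr_set Ioo_ae_eq_Icc]
      exact (P.continuous.continuousOn.congr hP).aestronglyMeasurable measurableSet_Ioo
    refine h1.mono_set fun t ht => ?_
    obtain ⟨j, hj, s, hs, rfl⟩ := WaveSpline.exists_ref hT hN (Ioo_subset_Icc_self ht)
    exact mem_iUnion.2 ⟨⟨j, hj⟩, ref_mem_elt hT hN hs⟩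
  · obtain ⟨j, hj, s, hs, rfl⟩ := exists_ref_interior hT hN ht.1 ht.2
    rw [(hR j hj).2 s hs]
    exact hM j hj s (Ioo_subset_Icc_self hs)

end Mesh

/-! ### Primitives and splines -/

/-- The primitive on `[0,T]` that vanishes at `0`, extended by zero. -/
noncomputable def prim (T : ℝ) (v : ℝ → ℝ) : ℝ → ℝ := (Icc 0 T).indicator fun t => ∫ s in 0..t, v s

theorem prim_apply {T : ℝ} {v : ℝ → ℝ} {t : ℝ} (ht : t ∈ Icc 0 T) :
    prim T v t = ∫ s in 0..t, v s := indicator_of_mem ht _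

theorem prim_of_notMem {T : ℝ} {v : ℝ → ℝ} {t : ℝ} (ht : t ∉ Icc 0 T) : prim T v t = 0 :=
  indicator_of_notMem ht _

theorem prim_zero {T : ℝ} (hT : 0 < T) {v : ℝ → ℝ} : prim T v 0 = 0 := by
  rw [prim_apply ⟨le_rfl, hT.le⟩, intervalIntegral.integral_same]

theorem hasDerivWithinAt_prim {T : ℝ} (hT : 0 < T) {v : ℝ → ℝ} (hv : ContinuousOn v (Icc 0 T))
    {t : ℝ} (ht : t ∈ Icc 0 T) : HasDerivWithinAt (prim T v) (v t) (Icc 0 T) t := by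
  set V : ℝ → ℝ := IccExtend hT.le ((Icc 0 T).domRestrict v)
  have hV : Continuous V := (continuousOn_iff_continuous_domRestrict.1 hv).Icc_extend'
  have hVv : ∀ s ∈ Icc 0 T, V s = v s := fun s hs => by
    simp [V, IccExtend_of_mem hT.le _ hs]
  have h1 := (hV.integral_hasStrictDerivAt 0 t).hasDerivAt.hasDerivWithinAt (s := Icc 0 T)
  rw [hVv t ht] at h1
  refine h1.congr_of_mem (fun x hx => ?_) ht
  rw [prim_apply hx]
  refine intervalIntegral.integral_congr fun s hs => ?_
  rw [uIcc_of_le hx.1] at hs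
  exact (hVv s ⟨hs.1, hs.2.trans hx.2⟩).symm

theorem tD_one_prim {T : ℝ} (hT : 0 < T) {v : ℝ → ℝ} (hv : ContinuousOn v (Icc 0 T)) {t : ℝ}
    (ht : t ∈ Icc 0 T) : tD T 1 (prim T v) t = v t :=
  tD_one_of_hasDerivWithinAt hT ht (hasDerivWithinAt_prim hT hv ht)

theorem prim_tD_one {T : ℝ} (hT : 0 < T) {w : ℝ → ℝ} (h0 : ∀ t, t ∉ Icc 0 T → w t = 0)
    (hw0 : w 0 = 0) (hw : ContDiffOn ℝ 1 w (Icc 0 T)) : prim T (tD T 1 w) = w := by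
  ext t
  by_cases ht : t ∈ Icc 0 T
  · have h1 : HasPwDeriv T w (tD T 1 w) := hasPwDeriv_of_hasDerivWithinAt
      (fun t ht => by simpa only [tD_zero] using hasDerivWithinAt_tD hT hw one_pos ht)
      (continuousOn_tD hT hw le_rfl)
    rw [prim_apply ht, h1.integral_eq ⟨le_rfl, hT.le⟩ ht, hw0, sub_zero]
  · rw [prim_of_notMem ht, h0 t ht]

section Mesh

variable {T : ℝ} {N : ℕ}

/-- On every element the primitive of a discontinuous piecewise polynomial is a polynomial. -/
theorem IsDiscPw.prim_eqOn (hT : 0 < T) (hN : 1 ≤ N) {q : ℕ} {r : ℝ → ℝ} (hr : IsDiscPw T N q r)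
    {j : ℕ} (hj : j < N) : ∃ Q : ℝ[X], Q.natDegree ≤ q ∧
      EqOn (prim T r) (fun t => Q.eval t) (elt T N j) ∧
      EqOn r (fun t => Q.derivative.eval t) (interior (elt T N j)) := by
  have hpos := mesh_pos hT hN
  obtain ⟨P, hP, hPr⟩ := hr j hj
  obtain ⟨Q, hQ, hQdeg⟩ : ∃ Q : ℝ[X], Q.derivative = P ∧ Q.natDegree ≤ q := by
    rcases eq_or_ne P 0 with rfl | hP0
    · exact ⟨0, by simp, by simp⟩
    · have h1 := (Polynomial.natDegree_lt_iff_degree_lt hP0).2 hP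
      obtain ⟨Q, hQ, hd⟩ := exists_antiderivative (show P.natDegree ≤ q - 1 by omega)
      exact ⟨Q, hQ, by omega⟩
  set a : ℝ := j * (T / N)
  have ha : a ∈ elt T N j := ⟨le_rfl, mul_le_mul_of_nonneg_right (by linarith) hpos.le⟩
  have ha0 := elt_subset hT hN hj ha
  have hint := (hr.bdd hT hN).intervalIntegrable hT.le
  have hsubint : ∀ x ∈ Icc 0 T, ∀ y ∈ Icc 0 T, IntervalIntegrable r volume x y :=
    fun x hx y hy => hint.mono_set (by rw [uIcc_of_le hT.le]; exact uIcc_subset_Icc hx hy)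
  refine ⟨Q + Polynomial.C (prim T r a - Q.eval a), Polynomial.natDegree_add_C.trans_le hQdeg,
    fun t ht => ?_, fun t ht => by rw [hPr ht]; simp [hQ]⟩
  have ht0 := elt_subset hT hN hj ht
  have h1 : ∫ s in a..t, r s = Q.eval t - Q.eval a := by
    rw [← intervalIntegral.integral_eq_sub_of_hasDerivAt (f := fun s => Q.eval s)
      (f' := fun s => P.eval s) (fun s _ => by rw [← hQ]; exact Q.hasDerivAt s)
      (P.continuous.intervalIntegrable _ _)]
    refine intervalIntegral.integral_congr_ae ?_
    filter_upwards [(countable_nodes T N).ae_notMem volume] with s hs hs'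
    rw [uIoc_of_le ht.1] at hs'
    refine hPr ?_
    rw [elt, interior_Icc]
    refine ⟨hs'.1, lt_of_le_of_ne (hs'.2.trans ht.2) fun h => hs ⟨j + 1, ?_⟩⟩
    push_cast; exact h.symm
  rw [prim_apply ht0, ← intervalIntegral.integral_add_adjacent_intervals
    (hsubint 0 ⟨le_rfl, hT.le⟩ a ha0) (hsubint a ha0 t ht0), h1, prim_apply ha0]
  simp; ring

theorem prim_mem_cpw (hT : 0 < T) (hN : 1 ≤ N) {q : ℕ} {r : ℝ → ℝ} (hr : IsDiscPw T N q r) :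
    prim T r ∈ cpw T N q := by
  have h : ∀ j < N, ∃ Q : ℝ[X], Q.natDegree ≤ q ∧
      EqOn (prim T r) (fun t => Q.eval t) (elt T N j) := fun j hj => by
    obtain ⟨Q, hQ, h1, -⟩ := hr.prim_eqOn hT hN hj
    exact ⟨Q, hQ, h1⟩
  refine ⟨fun t ht => prim_of_notMem ht, continuousOn_of_elt hN hT fun j hj => ?_, h⟩
  obtain ⟨Q, -, hQ⟩ := h j hj
  exact Q.continuous.continuousOn.congr hQ

theorem hasDerivAt_prim_of_isDiscPw (hT : 0 < T) (hN : 1 ≤ N) {q : ℕ} {r : ℝ → ℝ}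
    (hr : IsDiscPw T N q r) {t : ℝ} (ht : t ∈ Ioo 0 T \ nodes T N) :
    HasDerivAt (prim T r) (r t) t := by
  obtain ⟨j, hj, s, hs, rfl⟩ := exists_ref_interior hT hN ht.1 ht.2
  have hmem := ref_mem_interior hT hN (j := j) hs
  obtain ⟨Q, -, h1, h2⟩ := hr.prim_eqOn hT hN hj
  rw [h2 hmem]
  refine (Q.hasDerivAt _).congr_of_eventuallyEq ?_
  filter_upwards [isOpen_interior.mem_nhds hmem] with x hx
  exact h1 (interior_subset hx)

theorem isDiscPw_of_mem_cpw {q : ℕ} {w : ℝ → ℝ} (hw : w ∈ cpw T N q) :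
    IsDiscPw T N (q + 1) w := fun j hj => by
  obtain ⟨P, hP, h⟩ := hw.2.2 j hj
  exact ⟨P, (Polynomial.natDegree_le_iff_degree_le.1 hP).trans_lt
    (by exact_mod_cast Nat.lt_succ_self q), h.mono interior_subset⟩

theorem prim_mem_spline (hT : 0 < T) (hN : 1 ≤ N) {q : ℕ} {v : ℝ → ℝ} (hv : v ∈ cpw T N q) :
    prim T v ∈ spline T N (q + 1) :=
  ⟨prim_mem_cpw hT hN (isDiscPw_of_mem_cpw hv),
    contDiffOn_one_of_hasDerivWithinAt hT (fun _ ht => hasDerivWithinAt_prim hT hv.2.1 ht) hv.2.1,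
    prim_zero hT⟩

theorem prim_tD_one_of_mem_spline (hT : 0 < T) {p : ℕ} {w : ℝ → ℝ} (hw : w ∈ spline T N p) :
    prim T (tD T 1 w) = w := prim_tD_one hT hw.1.1 hw.2.2 hw.2.1

theorem tD_one_mem_cpw (hT : 0 < T) (hN : 1 ≤ N) {p : ℕ} {w : ℝ → ℝ} (hw : w ∈ spline T N p) :
    tD T 1 w ∈ cpw T N (p - 1) := by
  have hpos := mesh_pos hT hN
  have hc := continuousOn_tD hT hw.2.1 le_rfl
  refine ⟨fun t ht => tD_succ_of_notMem ht, hc, fun j hj => ?_⟩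
  obtain ⟨P, hP, hPw⟩ := hw.1.2.2 j hj
  refine ⟨P.derivative, (Polynomial.natDegree_derivative_le P).trans (by omega), ?_⟩
  have h1 : EqOn (tD T 1 w) (fun t => P.derivative.eval t) (interior (elt T N j)) := fun t ht => by
    refine tD_one_of_hasDerivAt hT (elt_subset hT hN hj (interior_subset ht)) ?_
    refine (P.hasDerivAt t).congr_of_eventuallyEq ?_
    filter_upwards [isOpen_interior.mem_nhds ht] with x hx
    exact hPw (interior_subset hx)
  refine h1.of_subset_closure (hc.mono (elt_subset hT hN hj))
    P.derivative.continuous.continuousOn interior_subset ?_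
  have : (j : ℝ) * (T / N) ≠ (j + 1) * (T / N) := by
    intro h; nlinarith
  rw [elt, interior_Icc, closure_Ioo this]

theorem hasDerivWithinAt_of_mem_spline (hT : 0 < T) {p : ℕ} {w : ℝ → ℝ} (hw : w ∈ spline T N p)
    {t : ℝ} (ht : t ∈ Icc 0 T) : HasDerivWithinAt w (tD T 1 w t) (Icc 0 T) t := by
  simpa only [tD_zero] using hasDerivWithinAt_tD hT hw.2.1 one_pos ht

theorem hasPwDeriv_tD_one_of_mem_spline (hT : 0 < T) (hN : 1 ≤ N) {p : ℕ} {w : ℝ → ℝ}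
    (hw : w ∈ spline T N p) : HasPwDeriv T (tD T 1 w) (tD T 2 w) := by
  have := hasPwDeriv_of_mem_cpw hT hN (tD_one_mem_cpw hT hN hw)
  rwa [tD_tD] at this

theorem spline_le_H20 (hT : 0 < T) (hN : 1 ≤ N) (p : ℕ) : spline T N p ≤ H20 hT := fun _ hw =>
  mem_H20_of_hasPwDeriv hT hw.1.1 hw.2.2 (fun _ ht => hasDerivWithinAt_of_mem_spline hT hw ht)
    (hasPwDeriv_tD_one_of_mem_spline hT hN hw)

theorem isDiscPw_tD_two (hT : 0 < T) (hN : 1 ≤ N) {p : ℕ} {w : ℝ → ℝ} (hw : w ∈ spline T N p) :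
    IsDiscPw T N (p - 1) (tD T 2 w) := by
  have := isDiscPw_tD_one hT hN (tD_one_mem_cpw hT hN hw)
  rwa [tD_tD] at this

/-- Every discontinuous piecewise polynomial is the second derivative of a spline. -/
theorem exists_spline_tD_two (hT : 0 < T) (hN : 1 ≤ N) {q : ℕ} {r : ℝ → ℝ}
    (hr : IsDiscPw T N q r) :
    ∃ w ∈ spline T N (q + 1), ∀ t ∈ Ioo 0 T \ nodes T N, tD T 2 w t = r t := by
  have h1 := prim_mem_cpw hT hN hr
  exact ⟨prim T (prim T r), prim_mem_spline hT hN h1, fun t ht =>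
    tD_two_of_hasDerivAt hT (fun _ ht => hasDerivWithinAt_prim hT h1.2.1 ht)
      (Ioo_subset_Icc_self ht.1) (hasDerivAt_prim_of_isDiscPw hT hN hr ht)⟩

/-! ### Existence and uniqueness of the projections -/

theorem mesh_exp (hT : 0 < T) (j : ℕ) (s : ℝ) :
    Real.exp (-(((j : ℝ) + s) * (T / N)) / T) =
      Real.exp (-(j / N)) * Real.exp (-(1 / N) * s) := by
  rw [← Real.exp_add]; congr 1; field_simp; ring

theorem inv_mem_Icc (hN : 1 ≤ N) : (1 / N : ℝ) ∈ Icc (0:ℝ) 1 := by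
  have : (1:ℝ) ≤ N := by exact_mod_cast hN
  exact ⟨by positivity, by rw [div_le_one (by linarith)]; exact this⟩

theorem continuousOn_ref (hT : 0 < T) (hN : 1 ≤ N) {f : ℝ → ℝ} (hf : ContinuousOn f (Icc 0 T))
    {j : ℕ} (hj : j < N) : ContinuousOn (fun s : ℝ => f (((j : ℝ) + s) * (T / N))) (Icc 0 1) :=
  hf.comp (by fun_prop) fun _ hs => ref_mem_Icc hT hN hj hs

theorem weighted_integral_ref (hT : 0 < T) (hN : 1 ≤ N) {q : ℕ} {f r : ℝ → ℝ}
    (hf : ContinuousOn f (Icc 0 T)) (hr : IsDiscPw T N q r) {R : ℕ → ℝ[X]}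
    (hR : ∀ j < N, ∀ s ∈ Ioo (0:ℝ) 1, r (((j : ℝ) + s) * (T / N)) = (R j).eval s) :
    ∫ t in 0..T, f t * (Real.exp (-t / T) * r t) =
      ∑ j ∈ Finset.range N, (T / N) * (Real.exp (-(j / N)) *
        ∫ s in (0:ℝ)..1, Real.exp (-(1 / N) * s) *
          (f (((j : ℝ) + s) * (T / N)) * (R j).eval s)) := by
  have hb : Bdd T (fun t => f t * (Real.exp (-t / T) * r t)) :=
    Bdd.mul (ContinuousOn.bdd hf) (Bdd.mul (ContinuousOn.bdd (by fun_prop)) (hr.bdd hT hN))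
  rw [integral_eq_sum_ref hT hN (hb.intervalIntegrable hT.le)]
  refine Finset.sum_congr rfl fun j hj => ?_
  congr 1
  rw [← intervalIntegral.integral_const_mul]
  refine integral_congr_Ioo zero_le_one countable_empty fun s hs => ?_
  rw [hR j (Finset.mem_range.1 hj) s hs.1, mesh_exp hT]
  ring

/-- The nodal projection is local: on every element it is the local projection determined by its
value at the right end point. -/
theorem IsNodalProj.isLocalProj (hT : 0 < T) (hN : 1 ≤ N) {q : ℕ} {v w : ℝ → ℝ}
    (hv : ContinuousOn v (Icc 0 T)) (h : IsNodalProj T N q v w) {W : ℕ → ℝ[X]}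
    (hW : ∀ j < N, (W j).natDegree ≤ q ∧
      ∀ s ∈ Icc (0:ℝ) 1, w (((j : ℝ) + s) * (T / N)) = (W j).eval s) {j : ℕ} (hj : j < N) :
    IsLocalProj (1 / N) q (fun s => v (((j : ℝ) + s) * (T / N))) ((W j).eval 1) (W j) := by
  have hpos := mesh_pos hT hN
  refine ⟨(hW j hj).1, rfl, fun R hR => ?_⟩
  -- the test function is `R` on the element `j` and vanishes on all other elements
  set S := R.comp (Polynomial.C (T / N)⁻¹ * Polynomial.X + Polynomial.C (-(j : ℝ)))
  set r : ℝ → ℝ := (interior (elt T N j)).indicator fun t => S.eval t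
  have hS : ∀ s : ℝ, S.eval (((j : ℝ) + s) * (T / N)) = R.eval s := fun s => by
    simp only [S, Polynomial.eval_comp, Polynomial.eval_add, Polynomial.eval_mul,
      Polynomial.eval_C, Polynomial.eval_X]
    congr 1; field_simp; ring
  have hne : ∀ i, i ≠ j → ∀ s ∈ Ioo (0:ℝ) 1, r (((i : ℝ) + s) * (T / N)) = 0 := by
    intro i hij s hs
    refine indicator_of_notMem (fun hmem => ?_) _
    obtain ⟨s', hs', h⟩ := exists_ref_of_mem_interior hT hN hmem
    have h1 : (i : ℝ) + s = j + s' := mul_right_cancel₀ hpos.ne' h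
    rcases lt_or_gt_of_ne hij with hlt | hlt
    · have : (i : ℝ) + 1 ≤ j := by exact_mod_cast hlt
      linarith [hs.2, hs'.1]
    · have : (j : ℝ) + 1 ≤ i := by exact_mod_cast hlt
      linarith [hs.1, hs'.2]
  have hr : IsDiscPw T N q r := by
    intro i hi
    rcases eq_or_ne i j with rfl | hij
    · exact ⟨S, degree_comp_linear_lt hR _ _, fun t ht => indicator_of_mem ht _⟩
    · refine ⟨0, by simp, fun t ht => ?_⟩
      obtain ⟨s, hs, rfl⟩ := exists_ref_of_mem_interior hT hN ht
      rw [hne i hij s hs]; simp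
  have hrR : ∀ i < N, ∀ s ∈ Ioo (0:ℝ) 1, r (((i : ℝ) + s) * (T / N)) =
      (if i = j then R else 0 : ℝ[X]).eval s := by
    intro i hi s hs
    rcases eq_or_ne i j with rfl | hij
    · rw [if_pos rfl, ← hS]
      exact indicator_of_mem (ref_mem_interior hT hN hs) _
    · rw [if_neg hij, hne i hij s hs]; simp
  have key := h.2.2 r hr
  have hsingle : ∀ f : ℝ → ℝ, ContinuousOn f (Icc 0 T) →
      ∫ t in 0..T, f t * (Real.exp (-t / T) * r t) = (T / N) * (Real.exp (-(j / N)) *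
        ∫ s in (0:ℝ)..1, Real.exp (-(1 / N) * s) *
          (f (((j : ℝ) + s) * (T / N)) * R.eval s)) := fun f hf => by
    rw [weighted_integral_ref hT hN hf hr (R := fun i => if i = j then R else 0) hrR,
      Finset.sum_eq_single j]
    · simp
    · intro i _ hij
      simp [hij]
    · intro hj'; exact absurd (Finset.mem_range.2 hj) hj'
  rw [hsingle w h.1.2.1, hsingle v hv] at key
  have key2 := mul_left_cancel₀ (Real.exp_pos _).ne' (mul_left_cancel₀ hpos.ne' key)
  rw [← key2]
  refine integral_congr_Ioo zero_le_one countable_empty fun s hs => ?_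
  rw [(hW j hj).2 s (Ioo_subset_Icc_self hs.1)]

theorem isNodalProj_of_local (hT : 0 < T) (hN : 1 ≤ N) {q : ℕ} {v w : ℝ → ℝ}
    (hv : ContinuousOn v (Icc 0 T)) (hw : w ∈ cpw T N q) (hwT : w T = v T) {W : ℕ → ℝ[X]}
    (hW : ∀ j < N, ∀ s ∈ Icc (0:ℝ) 1, w (((j : ℝ) + s) * (T / N)) = (W j).eval s)
    (hloc : ∀ j < N, ∃ b, IsLocalProj (1 / N) q (fun s => v (((j : ℝ) + s) * (T / N))) b (W j)) :
    IsNodalProj T N q v w := by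
  refine ⟨hw, hwT, fun r hr => ?_⟩
  obtain ⟨R, hR⟩ := hr.exists_ref hT hN
  rw [weighted_integral_ref hT hN hw.2.1 hr fun j hj => (hR j hj).2,
    weighted_integral_ref hT hN hv hr fun j hj => (hR j hj).2]
  refine Finset.sum_congr rfl fun j hj => ?_
  have hj' := Finset.mem_range.1 hj
  obtain ⟨b, hb⟩ := hloc j hj'
  congr 2
  rw [← hb.orth (R j) (hR j hj').1]
  refine integral_congr_Ioo zero_le_one countable_empty fun s hs => ?_
  rw [hW j hj' s (Ioo_subset_Icc_self hs.1)]

/-- The nodal projection is constructed element by element, backwards from the final time. -/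
theorem exists_isNodalProj (hT : 0 < T) (hN : 1 ≤ N) (q : ℕ) {v : ℝ → ℝ}
    (hv : ContinuousOn v (Icc 0 T)) : ∃ w, IsNodalProj T N q v w := by
  have key : ∀ k ≤ N, ∃ W : ℕ → ℝ[X], ∀ j < N, N ≤ j + k →
      IsLocalProj (1 / N) q (fun s => v (((j : ℝ) + s) * (T / N)))
        (if j + 1 = N then v T else (W (j + 1)).eval 0) (W j) := by
    intro k
    induction k with
    | zero => exact fun _ => ⟨0, fun j hj hj' => by omega⟩
    | succ k ih =>
      intro hk
      obtain ⟨W, hW⟩ := ih (by omega)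
      set i := N - (k + 1) with hi
      obtain ⟨P, hP⟩ := exists_isLocalProj (1 / N : ℝ) q
        (continuousOn_ref hT hN hv (show i < N by omega))
        (if i + 1 = N then v T else (W (i + 1)).eval 0)
      refine ⟨Function.update W i P, fun j hj hj' => ?_⟩
      rcases eq_or_ne j i with hji | hji
      · subst hji
        rw [Function.update_self, Function.update_of_ne (by omega)]
        exact hP
      · rw [Function.update_of_ne hji, Function.update_of_ne (by omega)]
        exact hW j hj (by omega)
  obtain ⟨W, hW⟩ := key N le_rfl
  have hW' := fun j hj => hW j hj (by omega)
  obtain ⟨w, hw, hwW⟩ := exists_glue hT hN (fun j hj => (hW' j hj).natDegree_le) fun j hj => by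
    have := (hW' j (by omega)).eval_one
    rwa [if_neg (by omega)] at this
  refine ⟨w, isNodalProj_of_local hT hN hv hw ?_ hwW fun j hj => ⟨_, hW' j hj⟩⟩
  have h1 := hwW (N - 1) (by omega) 1 (by simp)
  rw [(hW' (N - 1) (by omega)).eval_one, if_pos (by omega), Nat.cast_sub hN] at h1
  push_cast at h1
  rwa [sub_add_cancel, mesh_last hN] at h1

theorem ref_match {W : ℕ → ℝ[X]} {w : ℝ → ℝ}
    (hW : ∀ j < N, ∀ s ∈ Icc (0:ℝ) 1, w (((j : ℝ) + s) * (T / N)) = (W j).eval s) {j : ℕ}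
    (hj : j + 1 < N) : (W j).eval 1 = (W (j + 1)).eval 0 := by
  rw [← hW j (by omega) 1 (by simp), ← hW (j + 1) hj 0 (by simp)]
  push_cast; congr 1; ring

theorem ref_last (hN : 1 ≤ N) {W : ℕ → ℝ[X]} {w : ℝ → ℝ}
    (hW : ∀ j < N, ∀ s ∈ Icc (0:ℝ) 1, w (((j : ℝ) + s) * (T / N)) = (W j).eval s) :
    (W (N - 1)).eval 1 = w T := by
  rw [← hW (N - 1) (by omega) 1 (by simp), Nat.cast_sub hN]
  push_cast
  rw [sub_add_cancel, mesh_last hN]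

theorem IsNodalProj.unique (hT : 0 < T) (hN : 1 ≤ N) {q : ℕ} {v w w' : ℝ → ℝ}
    (hv : ContinuousOn v (Icc 0 T)) (h : IsNodalProj T N q v w) (h' : IsNodalProj T N q v w') :
    w = w' := by
  obtain ⟨W, hW⟩ := exists_ref_of_mem_cpw hT hN h.1
  obtain ⟨W', hW'⟩ := exists_ref_of_mem_cpw hT hN h'.1
  have key : ∀ k < N, W (N - 1 - k) = W' (N - 1 - k) := by
    intro k hk
    have h1 := h.isLocalProj hT hN hv hW (show N - 1 - k < N by omega)
    have h2 := h'.isLocalProj hT hN hv hW' (show N - 1 - k < N by omega)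
    have hc := continuousOn_ref hT hN hv (show N - 1 - k < N by omega)
    suffices he : (W (N - 1 - k)).eval 1 = (W' (N - 1 - k)).eval 1 by
      rw [he] at h1
      exact h1.unique (inv_mem_Icc hN) hc h2
    clear h1 h2 hc
    induction k with
    | zero =>
      rw [Nat.sub_zero, ref_last hN fun j hj => (hW j hj).2, ref_last hN fun j hj => (hW' j hj).2,
        h.2.1, h'.2.1]
    | succ k ih =>
      have ih' := ih (by omega)
      have h1 := h.isLocalProj hT hN hv hW (show N - 1 - k < N by omega)
      have h2 := h'.isLocalProj hT hN hv hW' (show N - 1 - k < N by omega)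
      rw [ih'] at h1
      have h3 := h1.unique (inv_mem_Icc hN)
        (continuousOn_ref hT hN hv (show N - 1 - k < N by omega)) h2
      rw [ref_match (fun j hj => (hW j hj).2) (by omega),
        ref_match (fun j hj => (hW' j hj).2) (by omega),
        show N - 1 - (k + 1) + 1 = N - 1 - k by omega, h3]
  ext t
  by_cases ht : t ∈ Icc 0 T
  · obtain ⟨j, hj, s, hs, rfl⟩ := exists_ref hT hN ht
    rw [(hW j hj).2 s hs, (hW' j hj).2 s hs]
    have := key (N - 1 - j) (by omega)
    rw [show N - 1 - (N - 1 - j) = j by omega] at this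
    rw [this]
  · rw [h.1.1 t ht, h'.1.1 t ht]

theorem IsNodalProj.add (hT : 0 < T) (hN : 1 ≤ N) {q : ℕ} {v v' w w' : ℝ → ℝ}
    (hv : ContinuousOn v (Icc 0 T)) (hv' : ContinuousOn v' (Icc 0 T))
    (h : IsNodalProj T N q v w) (h' : IsNodalProj T N q v' w') :
    IsNodalProj T N q (v + v') (w + w') := by
  refine ⟨add_mem h.1 h'.1, by simp [h.2.1, h'.2.1], fun r hr => ?_⟩
  have hi : ∀ f : ℝ → ℝ, ContinuousOn f (Icc 0 T) →
      IntervalIntegrable (fun t => f t * (Real.exp (-t / T) * r t)) volume 0 T := fun f hf =>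
    Bdd.intervalIntegrable hT.le (Bdd.mul (ContinuousOn.bdd hf)
      (Bdd.mul (ContinuousOn.bdd (by fun_prop)) (hr.bdd hT hN)))
  simp only [Pi.add_apply, add_mul]
  rw [intervalIntegral.integral_add (hi _ h.1.2.1) (hi _ h'.1.2.1),
    intervalIntegral.integral_add (hi _ hv) (hi _ hv'), h.2.2 r hr, h'.2.2 r hr]

theorem IsNodalProj.smul {q : ℕ} {v w : ℝ → ℝ} (h : IsNodalProj T N q v w) (c : ℝ) :
    IsNodalProj T N q (c • v) (c • w) := by
  refine ⟨Submodule.smul_mem _ c h.1, by simp [h.2.1], fun r hr => ?_⟩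
  simp only [Pi.smul_apply, smul_eq_mul, mul_assoc]
  rw [intervalIntegral.integral_const_mul, intervalIntegral.integral_const_mul, h.2.2 r hr]

/-- The weighted projection is the primitive of the nodal projection of the derivative. -/
theorem isWeightedProj_iff (hT : 0 < T) (hN : 1 ≤ N) {q : ℕ} {u w : ℝ → ℝ} :
    IsWeightedProj T (spline T N (q + 1)) u w ↔
      ∃ v, IsNodalProj T N q (tD T 1 u) v ∧ w = prim T v := by
  constructor
  · rintro ⟨hw, hwT, hwo⟩
    refine ⟨tD T 1 w, ⟨tD_one_mem_cpw hT hN hw, hwT, fun r hr => ?_⟩,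
      (prim_tD_one_of_mem_spline hT hw).symm⟩
    obtain ⟨wh, hwh, hwr⟩ := exists_spline_tD_two hT hN hr
    have e : ∀ f : ℝ → ℝ, ∫ t in 0..T, f t * (Real.exp (-t / T) * tD T 2 wh t) =
        ∫ t in 0..T, f t * (Real.exp (-t / T) * r t) := fun f =>
      integral_congr_Ioo hT.le (countable_nodes T N) fun t ht => by rw [hwr t ht]
    rw [← e, ← e]
    exact hwo wh hwh
  · rintro ⟨v, hv, rfl⟩
    refine ⟨prim_mem_spline hT hN hv.1, ?_, fun wh hwh => ?_⟩
    · rw [tD_one_prim hT hv.1.2.1 ⟨hT.le, le_rfl⟩, hv.2.1]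
    · rw [← hv.2.2 _ (isDiscPw_tD_two hT hN hwh)]
      refine integral_congr_Ioo hT.le countable_empty fun t ht => ?_
      rw [tD_one_prim hT hv.1.2.1 (Ioo_subset_Icc_self ht.1)]

end Mesh

theorem continuousOn_of_mem_H1 {T : ℝ} (hT : 0 < T) (v : H1 hT) :
    ContinuousOn (v : ℝ → ℝ) (Icc 0 T) := by
  have := v.2.2.1
  exact this.continuousOn

/-- The operators `𝒫_h^q` (zero for `N = 0`, where there is no mesh). -/
theorem exists_nodalProj {T : ℝ} (hT : 0 < T) (q : ℕ) :
    ∃ P : ∀ N : ℕ, H1 hT →ₗ[ℝ] cpw T N q, ∀ N : ℕ, 1 ≤ N → ∀ (v : H1 hT) (w : ℝ → ℝ),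
      IsNodalProj T N q v w ↔ w = P N v := by
  have key : ∀ N : ℕ, ∃ P : H1 hT →ₗ[ℝ] cpw T N q, 1 ≤ N → ∀ (v : H1 hT) (w : ℝ → ℝ),
      IsNodalProj T N q v w ↔ w = P v := by
    intro N
    rcases Nat.eq_zero_or_pos N with rfl | hN
    · exact ⟨0, fun h => by omega⟩
    choose P hP using fun v : H1 hT => exists_isNodalProj hT hN q (continuousOn_of_mem_H1 hT v)
    refine ⟨{ toFun := fun v => ⟨P v, (hP v).1⟩, map_add' := fun v v' => ?_,
              map_smul' := fun c v => ?_ }, fun _ v w => ⟨fun h => ?_, ?_⟩⟩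
    · exact Subtype.ext ((hP _).unique hT hN (continuousOn_of_mem_H1 hT _)
        ((hP v).add hT hN (continuousOn_of_mem_H1 hT _) (continuousOn_of_mem_H1 hT _) (hP v')))
    · exact Subtype.ext ((hP _).unique hT hN (continuousOn_of_mem_H1 hT _) ((hP v).smul c))
    · exact h.unique hT hN (continuousOn_of_mem_H1 hT _) (hP v)
    · rintro rfl; exact hP v
  choose P hP using key
  exact ⟨P, hP⟩

/-- The operators `Q_h`, as primitives of `𝒫_h ∂_t`. -/
theorem exists_weightedProj {T : ℝ} (hT : 0 < T) {q : ℕ}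
    (P : ∀ N : ℕ, H1 hT →ₗ[ℝ] cpw T N q) (hP : ∀ N : ℕ, 1 ≤ N → ∀ (v : H1 hT) (w : ℝ → ℝ),
      IsNodalProj T N q v w ↔ w = P N v) :
    ∃ Q : ∀ N : ℕ, H20 hT →ₗ[ℝ] spline T N (q + 1), ∀ N : ℕ, 1 ≤ N →
      ∀ u : H20 hT, (∀ w, IsWeightedProj T (spline T N (q + 1)) u w ↔ w = Q N u) ∧
        (Q N u : ℝ → ℝ) = prim T (P N (dt hT u)) := by
  have key : ∀ N : ℕ, ∃ Q : H20 hT →ₗ[ℝ] spline T N (q + 1), 1 ≤ N →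
      ∀ u : H20 hT, (∀ w, IsWeightedProj T (spline T N (q + 1)) u w ↔ w = Q u) ∧
        (Q u : ℝ → ℝ) = prim T (P N (dt hT u)) := by
    intro N
    rcases Nat.eq_zero_or_pos N with rfl | hN
    · exact ⟨0, fun h => by omega⟩
    have hiff : ∀ (u : H20 hT) w, IsWeightedProj T (spline T N (q + 1)) u w ↔
        w = prim T (P N (dt hT u)) := fun u w => by
      rw [isWeightedProj_iff hT hN]
      constructor
      · rintro ⟨v, hv, rfl⟩
        rw [(hP N hN (dt hT u) v).1 hv]
      · rintro rfl
        exact ⟨_, (hP N hN (dt hT u) _).2 rfl, rfl⟩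
    have hc : ∀ v : H1 hT, ContinuousOn (P N v : ℝ → ℝ) (Icc 0 T) := fun v => (P N v).2.2.1
    have hii : ∀ (v : H1 hT), ∀ t ∈ Icc 0 T, IntervalIntegrable (P N v : ℝ → ℝ) volume 0 t :=
      fun v t ht => ((hc v).mono (Icc_subset_Icc_right ht.2)).intervalIntegrable_of_Icc ht.1
    have hdt_add : ∀ u u' : H20 hT, dt hT (u + u') = dt hT u + dt hT u' := fun u u' => by
      ext t
      change tD T 1 (u + u' : ℝ → ℝ) t = tD T 1 u t + tD T 1 u' t
      by_cases ht : t ∈ Icc 0 T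
      · have h1 := u.2.1.2.1
        have h2 := u'.2.1.2.1
        have := (hasDerivWithinAt_tD hT h1 one_pos ht).add (hasDerivWithinAt_tD hT h2 one_pos ht)
        simp only [tD_zero] at this
        exact tD_one_of_hasDerivWithinAt hT ht this
      · rw [tD_succ_of_notMem ht, tD_succ_of_notMem ht, tD_succ_of_notMem ht, add_zero]
    have hdt_smul : ∀ (c : ℝ) (u : H20 hT), dt hT (c • u) = c • dt hT u := fun c u => by
      ext t
      exact iteratedDerivWithin_const_smul_field c _
    refine ⟨{ toFun := fun u => ⟨prim T (P N (dt hT u)), prim_mem_spline hT hN (P N (dt hT u)).2⟩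
              map_add' := fun u u' => ?_, map_smul' := fun c u => ?_ },
      fun _ u => ⟨hiff u, rfl⟩⟩
    · ext t
      rw [hdt_add, map_add]
      change prim T _ t = prim T _ t + prim T _ t
      by_cases ht : t ∈ Icc 0 T
      · rw [prim_apply ht, prim_apply ht, prim_apply ht,
          ← intervalIntegral.integral_add (hii _ t ht) (hii _ t ht)]
        rfl
      · simp [prim_of_notMem ht]
    · ext t
      rw [hdt_smul, map_smul]
      change prim T _ t = c * prim T _ t
      by_cases ht : t ∈ Icc 0 T
      · rw [prim_apply ht, prim_apply ht, ← intervalIntegral.integral_const_mul]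
        rfl
      · simp [prim_of_notMem ht]
  choose Q hQ using key
  exact ⟨Q, hQ⟩

/-! ### The error of the nodal projection -/

/-- Error propagation with a negative amplification factor: contributions of neighbouring steps
cancel, so that slowly varying contributions `r` do not accumulate. The deviation of `x (k + 1)`
from the fixed point `r k / (1 - A)` is what is propagated. -/
theorem abs_le_of_alternating {A κ R0 R1 : ℝ} (hA : A < 0) (hAκ : |A| ≤ 1 + κ) (hκ : 0 ≤ κ)
    (hR1 : 0 ≤ R1) {N : ℕ} {r x : ℕ → ℝ} (hx0 : x 0 = 0)
    (hx : ∀ k < N, x (k + 1) = r k + A * x k) (hr : ∀ k < N, |r k| ≤ R0)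
    (hdr : ∀ k, k + 1 < N → |r k - r (k + 1)| ≤ R1) :
    ∀ k < N, |x (k + 1)| ≤ (1 + κ) ^ N * (2 * R0 + N * R1) := by
  have hA1 : 0 < 1 - A := by linarith
  have hquot : |A / (1 - A)| ≤ 1 := by
    rw [abs_div, abs_of_neg hA, abs_of_pos hA1, div_le_one hA1]; linarith
  have hinv : |1 / (1 - A)| ≤ 1 := by
    rw [abs_div, abs_one, abs_of_pos hA1, div_le_one hA1]; linarith
  have key : ∀ k < N, |x (k + 1) - r k / (1 - A)| ≤ (1 + κ) ^ k * (R0 + k * R1) := by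
    intro k
    induction k with
    | zero =>
      intro h
      have e : x (0 + 1) - r 0 / (1 - A) = -(A / (1 - A)) * r 0 := by
        rw [hx 0 h, hx0]; field_simp; ring
      rw [e, abs_mul, abs_neg]
      simp only [pow_zero, Nat.cast_zero, zero_mul, add_zero, one_mul]
      calc _ ≤ 1 * |r 0| := mul_le_mul_of_nonneg_right hquot (abs_nonneg _)
        _ ≤ R0 := by rw [one_mul]; exact hr 0 h
    | succ k ih =>
      intro h
      have ih' := ih (by omega)
      have e : x (k + 1 + 1) - r (k + 1) / (1 - A) =
          A * (x (k + 1) - r k / (1 - A)) + (A / (1 - A)) * (r k - r (k + 1)) := by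
        rw [hx (k + 1) h]; field_simp; ring
      have hp : 1 ≤ (1 + κ) ^ (k + 1) := one_le_pow₀ (by linarith)
      rw [e]
      calc _ ≤ |A| * |x (k + 1) - r k / (1 - A)| + |A / (1 - A)| * |r k - r (k + 1)| := by
            rw [← abs_mul, ← abs_mul]; exact abs_add_le _ _
        _ ≤ (1 + κ) * ((1 + κ) ^ k * (R0 + k * R1)) + 1 * R1 := by
            refine add_le_add (mul_le_mul hAκ ih' (abs_nonneg _) (by linarith))
              (mul_le_mul hquot (hdr k h) (abs_nonneg _) zero_le_one)
        _ ≤ (1 + κ) ^ (k + 1) * (R0 + (k + 1 : ℕ) * R1) := by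
            push_cast
            have := mul_le_mul_of_nonneg_right hp hR1
            rw [pow_succ] at *
            nlinarith
  intro k hk
  have h1 := key k hk
  have hR0 : 0 ≤ R0 := (abs_nonneg _).trans (hr k hk)
  have hp : (1 + κ) ^ k ≤ (1 + κ) ^ N := pow_le_pow_right₀ (by linarith) hk.le
  have hp1 : 1 ≤ (1 + κ) ^ N := one_le_pow₀ (by linarith)
  have hkN : (k : ℝ) * R1 ≤ N * R1 := mul_le_mul_of_nonneg_right (by exact_mod_cast hk.le) hR1
  calc |x (k + 1)| = |(x (k + 1) - r k / (1 - A)) + (1 / (1 - A)) * r k| := by congr 1; ring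
    _ ≤ |x (k + 1) - r k / (1 - A)| + |1 / (1 - A)| * |r k| := by
        rw [← abs_mul]; exact abs_add_le _ _
    _ ≤ (1 + κ) ^ N * (R0 + N * R1) + (1 + κ) ^ N * R0 := by
        refine add_le_add (h1.trans ?_) ?_
        · exact mul_le_mul hp (by linarith) (by positivity) (by positivity)
        · calc _ ≤ 1 * R0 := mul_le_mul hinv (hr k hk) (abs_nonneg _) zero_le_one
            _ ≤ _ := mul_le_mul_of_nonneg_right hp1 hR0
    _ = _ := by ring

theorem IsLocalProj.congr {ε : ℝ} {q : ℕ} {g g' : ℝ → ℝ} {b b' : ℝ} {P : ℝ[X]}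
    (h : IsLocalProj ε q g b P) (hg : ∀ s, g s = g' s) (hb : b = b') : IsLocalProj ε q g' b' P := by
  rwa [← hb, ← funext hg]

section Mesh

variable {T : ℝ} {N : ℕ}

theorem hasDerivWithinAt_ref (hT : 0 < T) (hN : 1 ≤ N) {V : ℕ → ℝ → ℝ} {i : ℕ}
    (hV : ∀ t ∈ Icc 0 T, HasDerivWithinAt (V i) (V (i + 1) t) (Icc 0 T) t) {j : ℕ} (hj : j < N)
    {s : ℝ} (hs : s ∈ Icc (0:ℝ) 1) :
    HasDerivWithinAt (fun s : ℝ => (T / N) ^ i * V i (((j : ℝ) + s) * (T / N)))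
      ((T / N) ^ (i + 1) * V (i + 1) (((j : ℝ) + s) * (T / N))) (Icc 0 1) s := by
  have h1 : HasDerivWithinAt (fun s : ℝ => ((j : ℝ) + s) * (T / N)) (T / N) (Icc 0 1) s := by
    have := (((hasDerivAt_id s).const_add (j : ℝ)).mul_const (T / N)).hasDerivWithinAt
      (s := Icc (0:ℝ) 1)
    rwa [one_mul] at this
  have h2 := ((hV _ (ref_mem_Icc hT hN hj hs)).scomp s h1
    (fun _ hs' => ref_mem_Icc hT hN hj hs')).const_mul ((T / N) ^ i)
  refine h2.congr_deriv ?_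
  rw [smul_eq_mul, pow_succ, mul_assoc]

/-- The error of the nodal projection of odd degree `q` in the maximum norm: it is of the optimal
order `q + 1`, provided that one more derivative than usual is bounded. -/
theorem exists_nodalProj_error (hT : 0 < T) {q : ℕ} (hq : Odd q) : ∃ C : ℝ, 0 < C ∧
    ∀ N : ℕ, 1 ≤ N → ∀ (V : ℕ → ℝ → ℝ) (M0 M1 : ℝ) (w : ℝ → ℝ),
      (∀ i ≤ q, ∀ t ∈ Icc 0 T, HasDerivWithinAt (V i) (V (i + 1) t) (Icc 0 T) t) →
      (∀ t ∈ Icc 0 T, |V (q + 1) t| ≤ M0) → 0 ≤ M1 →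
      (∀ t ∈ Icc 0 T, ∀ t' ∈ Icc 0 T, |V (q + 1) t - V (q + 1) t'| ≤ M1 * |t - t'|) →
      IsNodalProj T N q (V 0) w →
      (∀ t ∈ Icc 0 T, |w t - V 0 t| ≤ C * (T / N) ^ (q + 1) * (M0 + M1)) ∧
      ∀ t ∈ Ioo 0 T \ nodes T N, |tD T 1 w t - V 1 t| ≤ C * (T / N) ^ q * (M0 + M1) := by
  obtain ⟨C1, hC1, hloc⟩ := exists_local_error q
  obtain ⟨C2, hC2, hamp⟩ := IsLocalProj.amplification hq
  obtain ⟨C3, hC3, hder⟩ := exists_derivative_error q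
  set K := C1 + Real.exp C2 * (C1 * (2 + T)) * C2 with hK
  have hKpos : 0 < K := by positivity
  refine ⟨K + C3 * (1 + K), by positivity, fun N hN V M0 M1 w hV hM0 hM1 hlip hw => ?_⟩
  set h := T / N with hh
  have hpos : 0 < h := mesh_pos hT hN
  have hM0' : 0 ≤ M0 := (abs_nonneg _).trans (hM0 0 ⟨le_rfl, hT.le⟩)
  have hε := inv_mem_Icc hN
  have hcont : ContinuousOn (V 0) (Icc 0 T) := fun t ht =>
    (hV 0 (Nat.zero_le _) t ht).continuousWithinAt
  -- the derivatives of `V 0` on the element `j`, scaled to the reference element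
  set g : ℕ → ℕ → ℝ → ℝ := fun j i s => h ^ i * V i (((j : ℝ) + s) * h) with hg
  have hg0 : ∀ j s, g j 0 s = V 0 (((j : ℝ) + s) * h) := fun j s => by simp [hg]
  have hgder : ∀ j < N, ∀ i ≤ q, ∀ s ∈ Icc (0:ℝ) 1,
      HasDerivWithinAt (g j i) (g j (i + 1) s) (Icc 0 1) s := fun j hj i hi s hs =>
    hasDerivWithinAt_ref hT hN (hV i hi) hj hs
  have hgcont : ∀ j < N, ContinuousOn (g j 0) (Icc 0 1) := fun j hj s hs =>
    (hgder j hj 0 (Nat.zero_le _) s hs).continuousWithinAt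
  have hgtop : ∀ j < N, ∀ s ∈ Icc (0:ℝ) 1, |g j (q + 1) s| ≤ h ^ (q + 1) * M0 := by
    intro j hj s hs
    rw [hg, abs_mul, abs_of_pos (pow_pos hpos _)]
    exact mul_le_mul_of_nonneg_left (hM0 _ (ref_mem_Icc hT hN hj hs)) (by positivity)
  obtain ⟨W, hW⟩ := exists_ref_of_mem_cpw hT hN hw.1
  obtain ⟨L, hL⟩ := exists_isLocalProj (1 / N : ℝ) q (g := 0) continuousOn_const 1
  obtain ⟨hLb, hLneg, hLamp⟩ := hamp _ hε L hL
  -- the local projections `G j` with the exact value at the right end point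
  have hG : ∀ j, ∃ G, j < N → IsLocalProj (1 / N : ℝ) q (g j 0) (g j 0 1) G := fun j => by
    by_cases hj : j < N
    · obtain ⟨G, hG⟩ := exists_isLocalProj (1 / N : ℝ) q (hgcont j hj) (g j 0 1)
      exact ⟨G, fun _ => hG⟩
    · exact ⟨0, fun h => absurd h hj⟩
  choose G hG using hG
  -- on every element, `w` differs from the local projection by a multiple of `L`
  have hdecomp : ∀ j < N, ∀ s, (W j).eval s =
      (G j).eval s + ((W j).eval 1 - g j 0 1) * L.eval s := by
    intro j hj s
    have h1 := hw.isLocalProj hT hN hcont hW hj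
    have h2 := (h1.congr (fun s => (hg0 j s).symm) rfl).sub (hgcont j hj) (hgcont j hj) (hG j hj)
    have h3 := (h2.congr (g' := 0) (fun s => by simp) rfl).unique hε continuousOn_const
      ((hL.smul ((W j).eval 1 - g j 0 1)).congr (g' := 0) (fun s => by simp) (by simp))
    have h4 := congrArg (Polynomial.eval s) h3
    simp only [Polynomial.eval_sub, Polynomial.eval_smul, smul_eq_mul] at h4
    linarith
  -- the nodal errors and the local errors, numbered backwards from `T`
  set x : ℕ → ℝ := fun k => w (((N : ℝ) - k) * h) - V 0 (((N : ℝ) - k) * h) with hx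
  set r : ℕ → ℝ := fun k => (G (N - 1 - k)).eval 0 - g (N - 1 - k) 0 0 with hr
  have hx0 : x 0 = 0 := by
    simp only [hx, Nat.cast_zero, sub_zero, hh, mesh_last hN, hw.2.1, sub_self]
  have hcast : ∀ k < N, ((N - 1 - k : ℕ) : ℝ) = N - 1 - k := fun k hk => by
    rw [Nat.cast_sub (by omega), Nat.cast_sub hN]; simp
  have hx1 : ∀ k < N, x k = (W (N - 1 - k)).eval 1 - g (N - 1 - k) 0 1 := fun k hk => by
    rw [hg0, ← (hW (N - 1 - k) (by omega)).2 1 (by simp), hcast k hk, ← hh]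
    simp only [hx]
    rw [show (N : ℝ) - k = N - 1 - k + 1 by ring]
  have hx2 : ∀ k < N, x (k + 1) = (W (N - 1 - k)).eval 0 - g (N - 1 - k) 0 0 := fun k hk => by
    rw [hg0, ← (hW (N - 1 - k) (by omega)).2 0 (by simp), hcast k hk, ← hh]
    simp only [hx]
    push_cast
    rw [show (N : ℝ) - (k + 1) = N - 1 - k + 0 by ring]
  have hrec : ∀ k < N, x (k + 1) = r k + L.eval 0 * x k := fun k hk => by
    rw [hx2 k hk, hx1 k hk, hdecomp (N - 1 - k) (by omega) 0]; simp only [hr]; ring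
  have hGerr : ∀ j < N, ∀ s ∈ Icc (0:ℝ) 1, |(G j).eval s - g j 0 s| ≤ C1 * (h ^ (q + 1) * M0) :=
    fun j hj s hs => hloc _ hε (g j) _ _ (hgder j hj) (hgtop j hj) (hG j hj) s hs
  have hrb : ∀ k < N, |r k| ≤ C1 * (h ^ (q + 1) * M0) := fun k hk =>
    hGerr _ (by omega) 0 (by simp)
  -- the difference of two local errors is the local error of the difference of the functions on
  -- neighbouring elements, whose top derivative gains a power of `h` by Lipschitz continuity
  have hrd : ∀ k, k + 1 < N → |r k - r (k + 1)| ≤ C1 * (h ^ (q + 1) * (M1 * h)) := by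
    intro k hk
    have hj1 : N - 1 - k < N := by omega
    have hj2 : N - 1 - (k + 1) < N := by omega
    have h1 := hloc _ hε (fun i s => g (N - 1 - k) i s - g (N - 1 - (k + 1)) i s)
      (h ^ (q + 1) * (M1 * h)) _
      (fun i hi s hs => (hgder _ hj1 i hi s hs).sub (hgder _ hj2 i hi s hs))
      (fun s hs => by
        simp only [hg]
        rw [← mul_sub, abs_mul, abs_of_pos (pow_pos hpos _)]
        refine mul_le_mul_of_nonneg_left ((hlip _ (ref_mem_Icc hT hN hj1 hs) _
          (ref_mem_Icc hT hN hj2 hs)).trans_eq ?_) (by positivity)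
        rw [hcast k (by omega), hcast (k + 1) hk, ← hh]
        push_cast
        rw [show ((N : ℝ) - 1 - k + s) * h - (N - 1 - (k + 1) + s) * h = h by ring, abs_of_pos hpos])
      ((hG _ hj1).sub (hgcont _ hj1) (hgcont _ hj2) (hG _ hj2)) 0 (by simp)
    simp only [Polynomial.eval_sub] at h1
    simp only [hr]
    convert h1 using 2
    ring
  have hxb : ∀ k < N, |x k| ≤ Real.exp C2 * (C1 * (2 + T)) * (h ^ (q + 1) * (M0 + M1)) := by
    intro k hk
    rcases k with _ | k
    · rw [hx0, abs_zero]; positivity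
    refine (abs_le_of_alternating hLneg hLamp (by positivity) (by positivity) hx0 hrec hrb hrd k
      (by omega)).trans ?_
    have hN0 : (0:ℝ) < N := by exact_mod_cast hN
    have h1 : (1 + C2 * (1 / N)) ^ N ≤ Real.exp C2 := by
      have : (1 + C2 * (1 / N)) ^ N ≤ (Real.exp (C2 * (1 / N))) ^ N :=
        pow_le_pow_left₀ (by positivity) (by linarith [Real.add_one_le_exp (C2 * (1 / (N:ℝ)))]) _
      rwa [← Real.exp_nat_mul, show (N : ℝ) * (C2 * (1 / N)) = C2 by field_simp] at this
    have h2 : 2 * (C1 * (h ^ (q + 1) * M0)) + N * (C1 * (h ^ (q + 1) * (M1 * h))) ≤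
        C1 * (2 + T) * (h ^ (q + 1) * (M0 + M1)) := by
      have e : (N : ℝ) * (C1 * (h ^ (q + 1) * (M1 * h))) = C1 * (h ^ (q + 1) * (M1 * T)) := by
        rw [← mesh_last (T := T) hN, ← hh]; ring
      rw [e]
      have ha : 0 ≤ C1 * (h ^ (q + 1) * M1) := by positivity
      have hb : 0 ≤ C1 * (h ^ (q + 1) * (M0 * T)) := by positivity
      nlinarith
    calc _ ≤ Real.exp C2 * (C1 * (2 + T) * (h ^ (q + 1) * (M0 + M1))) :=
          mul_le_mul h1 h2 (by positivity) (Real.exp_pos _).le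
      _ = _ := by ring
  have hWerr : ∀ j < N, ∀ s ∈ Icc (0:ℝ) 1,
      |(W j).eval s - g j 0 s| ≤ K * (h ^ (q + 1) * (M0 + M1)) := by
    intro j hj s hs
    have h1 := hxb (N - 1 - j) (by omega)
    rw [hx1 _ (by omega), show N - 1 - (N - 1 - j) = j by omega] at h1
    have h2 := mul_le_mul h1 (hLb s hs) (abs_nonneg _) (by positivity)
    rw [← abs_mul] at h2
    have h3 : 0 ≤ C1 * (h ^ (q + 1) * M1) := by positivity
    calc |(W j).eval s - g j 0 s|
        = |((G j).eval s - g j 0 s) + ((W j).eval 1 - g j 0 1) * L.eval s| := by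
          rw [hdecomp j hj s]; congr 1; ring
      _ ≤ |(G j).eval s - g j 0 s| + |((W j).eval 1 - g j 0 1) * L.eval s| := abs_add_le _ _
      _ ≤ C1 * (h ^ (q + 1) * M0) +
          Real.exp C2 * (C1 * (2 + T)) * (h ^ (q + 1) * (M0 + M1)) * C2 :=
          add_le_add (hGerr j hj s hs) h2
      _ ≤ K * (h ^ (q + 1) * (M0 + M1)) := by rw [hK]; nlinarith
  constructor
  · intro t ht
    obtain ⟨j, hj, s, hs, rfl⟩ := exists_ref hT hN ht
    have h1 := hWerr j hj s hs
    rw [hg0, ← (hW j hj).2 s hs] at h1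
    refine h1.trans ?_
    have : 0 ≤ C3 * (1 + K) * (h ^ (q + 1) * (M0 + M1)) := by positivity
    linarith
  · intro t ht
    obtain ⟨j, hj, s, hs, rfl⟩ := exists_ref_interior hT hN ht.1 ht.2
    have h1 := hder (g j) _ _ (W j) (hgder j hj) (hgtop j hj) (hW j hj).1 (hWerr j hj) s
      (Ioo_subset_Icc_self hs)
    rw [tD_one_ref hT hN hj (hW j hj).2 hs, ← hh]
    have e : (W j).derivative.eval s / h - V 1 (((j : ℝ) + s) * h) =
        ((W j).derivative.eval s - g j 1 s) / h := by
      simp only [hg, pow_one]; field_simp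
    rw [e, abs_div, abs_of_pos hpos, div_le_iff₀ hpos]
    refine h1.trans ?_
    have h2 : 0 ≤ K * (h ^ q * (M0 + M1)) * h := by positivity
    have h3 : 0 ≤ C3 * (h ^ (q + 1) * M1) := by positivity
    calc C3 * (h ^ (q + 1) * M0 + K * (h ^ (q + 1) * (M0 + M1)))
        ≤ C3 * (1 + K) * (h ^ (q + 1) * (M0 + M1)) := by linarith
      _ = C3 * (1 + K) * (h ^ q * (M0 + M1)) * h := by ring
      _ ≤ _ := by linarith

end Mesh

/-! ### Error bounds for smooth functions -/

theorem abs_le_toReal_normL_top {T : ℝ} (hT : 0 < T) {f : ℝ → ℝ} (hf : ContinuousOn f (Icc 0 T))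
    {t : ℝ} (ht : t ∈ Icc 0 T) : |f t| ≤ (normL T ⊤ f).toReal := by
  set M := (normL T ⊤ f).toReal
  have hfin : normL T ⊤ f ≠ ⊤ := (ContinuousOn.bdd hf).2.ne
  have h1 : ∀ᵐ t ∂volume.restrict (Icc 0 T), |f t| ≤ M := by
    rw [← Measure.restrict_congr_set Ioo_ae_eq_Icc]
    filter_upwards [ae_le_eLpNormEssSup (f := f) (μ := volume.restrict (Ioo 0 T))] with t ht
    rw [← eLpNorm_exponent_top] at ht
    have := ENNReal.toReal_mono hfin ht
    rwa [toReal_enorm, Real.norm_eq_abs] at this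
  have h2 := Measure.eqOn_Icc_of_ae_eq volume hT.ne (f := fun t => |f t|)
    (g := fun t => min |f t| M) (by filter_upwards [h1] with t ht using (min_eq_left ht).symm)
    hf.abs (hf.abs.inf continuousOn_const) ht
  exact min_eq_left_iff.1 h2.symm

theorem lipschitz_of_mem_sobolev {T : ℝ} (hT : 0 < T) {m : ℕ} {u : ℝ → ℝ}
    (hu : u ∈ sobolev hT m ⊤) {t t' : ℝ} (ht : t ∈ Icc 0 T) (ht' : t' ∈ Icc 0 T) :
    |tD T m u t - tD T m u t'| ≤ (normL T ⊤ (tD T (m + 1) u)).toReal * |t - t'| := by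
  obtain ⟨-, -, hac, hmem⟩ := hu
  have hsub : uIcc t' t ⊆ Icc 0 T := uIcc_subset_Icc ht' ht
  have hac' : AbsolutelyContinuousOnInterval (tD T m u) t' t :=
    hac.mono (by rwa [uIcc_of_le hT.le])
  rw [← hac'.integral_deriv_eq_sub, ← Real.norm_eq_abs]
  refine intervalIntegral.norm_integral_le_of_norm_le_const_ae ?_
  have h1 := ae_le_eLpNormEssSup (f := tD T (m + 1) u) (μ := volume.restrict (Ioo 0 T))
  rw [ae_restrict_iff' measurableSet_Ioo] at h1
  filter_upwards [h1, (countable_singleton T).ae_notMem volume] with s hs hsT hs'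
  have h2 := hsub (uIoc_subset_uIcc hs')
  have h3 : 0 < s := (le_min ht'.1 ht.1).trans_lt hs'.1
  have h4 : s < T := lt_of_le_of_ne h2.2 hsT
  have h5 := ENNReal.toReal_mono (by rw [← eLpNorm_exponent_top]; exact hmem.2.ne) (hs ⟨h3, h4⟩)
  rwa [tD_succ, derivWithin_of_mem_nhds (Icc_mem_nhds h3 h4), toReal_enorm, ← tD_succ,
    ← eLpNorm_exponent_top] at h5

/-- The sum of the two maximum norms in the error bounds, as a real number. -/
noncomputable def smoothNorm (T : ℝ) (p : ℕ) (u : ℝ → ℝ) : ℝ :=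
  (normL T ⊤ (tD T (p + 1) u)).toReal + (normL T ⊤ (tD T (p + 2) u)).toReal

theorem smoothNorm_nonneg (T : ℝ) (p : ℕ) (u : ℝ → ℝ) : 0 ≤ smoothNorm T p u := by
  unfold smoothNorm; positivity

/-- Maximum norm bounds for the projection of `∂_t u`. -/
theorem exists_projection_error {T : ℝ} (hT : 0 < T) {p : ℕ} (hp : 2 ≤ p) (hev : Even p) :
    ∃ C : ℝ, 0 < C ∧ ∀ N : ℕ, 1 ≤ N → ∀ u ∈ sobolev hT (p + 1) ⊤, ∀ v,
      IsNodalProj T N (p - 1) (tD T 1 u) v →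
      (∀ t ∈ Icc 0 T, |v t - tD T 1 u t| ≤ C * (T / N) ^ p * smoothNorm T p u) ∧
      ∀ t ∈ Ioo 0 T \ nodes T N,
        |tD T 1 v t - tD T 2 u t| ≤ C * (T / N) ^ (p - 1) * smoothNorm T p u := by
  have hq : Odd (p - 1) := Nat.Even.sub_odd (by omega) hev odd_one
  obtain ⟨C, hC, h⟩ := exists_nodalProj_error hT hq
  refine ⟨C, hC, fun N hN u hu v hv => ?_⟩
  have hpq : p - 1 + 1 = p := by omega
  have h1 := h N hN (fun i => tD T (i + 1) u) (normL T ⊤ (tD T (p + 1) u)).toReal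
    (normL T ⊤ (tD T (p + 2) u)).toReal v
    (fun i hi t ht => hasDerivWithinAt_tD hT hu.2.1 (by omega) ht)
    (by
      rw [hpq]
      exact fun t ht => abs_le_toReal_normL_top hT (continuousOn_tD hT hu.2.1 le_rfl) ht)
    ENNReal.toReal_nonneg
    (by
      rw [hpq]
      exact fun t ht t' ht' => lipschitz_of_mem_sobolev hT hu ht ht') hv
  rwa [hpq] at h1

/-! ### Estimates in the norm of `L²` -/

theorem normL_two_le {T : ℝ} (hT : 0 < T) {f : ℝ → ℝ} (hf : Bdd T f) {K : ℝ} (hK : 0 ≤ K)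
    (h : ∫ t in 0..T, f t ^ 2 ≤ K ^ 2) : normL T 2 f ≤ ENNReal.ofReal K := by
  unfold normL
  rw [MemLp.eLpNorm_eq_integral_rpow_norm (by simp) (by simp)
    (hf.mono_exponent (p := 2) le_top)]
  refine ENNReal.ofReal_le_ofReal ?_
  rw [intervalIntegral.integral_of_le hT.le, integral_Ioc_eq_integral_Ioo] at h
  simp only [ENNReal.toReal_ofNat, Real.rpow_ofNat, Real.norm_eq_abs, sq_abs]
  rw [← Real.sqrt_sq hK, show (2:ℝ)⁻¹ = 1 / 2 by norm_num, ← Real.sqrt_eq_rpow]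
  exact Real.sqrt_le_sqrt h

theorem Bdd.add {T : ℝ} {f g : ℝ → ℝ} (hf : Bdd T f) (hg : Bdd T g) :
    Bdd T (fun t => f t + g t) := MemLp.add hf hg

theorem Bdd.sub {T : ℝ} {f g : ℝ → ℝ} (hf : Bdd T f) (hg : Bdd T g) :
    Bdd T (fun t => f t - g t) := MemLp.sub hf hg

theorem Bdd.sq {T : ℝ} {f : ℝ → ℝ} (hf : Bdd T f) : Bdd T (fun t => f t ^ 2) := by
  simpa only [pow_two] using hf.mul hf

theorem integral_mono_Ioo {T : ℝ} (hT : 0 < T) {f g : ℝ → ℝ} (hf : Bdd T f) (hg : Bdd T g)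
    {s : Set ℝ} (hs : s.Countable) (h : ∀ t ∈ Ioo 0 T \ s, f t ≤ g t) :
    ∫ t in 0..T, f t ≤ ∫ t in 0..T, g t := by
  rw [intervalIntegral.integral_of_le hT.le, intervalIntegral.integral_of_le hT.le,
    integral_Ioc_eq_integral_Ioo, integral_Ioc_eq_integral_Ioo]
  exact integral_mono_ae (hf.integrable le_top) (hg.integrable le_top) (ae_restrict_Ioo hs h)

theorem integral_sq_nonneg {T : ℝ} (hT : 0 < T) (f : ℝ → ℝ) : 0 ≤ ∫ t in 0..T, f t ^ 2 :=
  intervalIntegral.integral_nonneg hT.le fun _ _ => by positivity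

theorem integral_sq_le {T : ℝ} (hT : 0 < T) {f : ℝ → ℝ} (hf : Bdd T f) {K : ℝ} {s : Set ℝ}
    (hs : s.Countable) (h : ∀ t ∈ Ioo 0 T \ s, |f t| ≤ K) : ∫ t in 0..T, f t ^ 2 ≤ T * K ^ 2 := by
  have h1 : ∫ t in 0..T, f t ^ 2 ≤ ∫ t in 0..T, K ^ 2 :=
    integral_mono_Ioo hT hf.sq (ContinuousOn.bdd continuousOn_const) hs fun t ht => by
      rw [← sq_abs]; exact pow_le_pow_left₀ (abs_nonneg _) (h t ht) 2
  simpa using h1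

theorem integral_add_sq_le {T : ℝ} (hT : 0 < T) {f g : ℝ → ℝ} (hf : Bdd T f) (hg : Bdd T g) :
    ∫ t in 0..T, (f t + g t) ^ 2 ≤ 2 * (∫ t in 0..T, f t ^ 2) + 2 * ∫ t in 0..T, g t ^ 2 := by
  rw [← intervalIntegral.integral_const_mul, ← intervalIntegral.integral_const_mul,
    ← intervalIntegral.integral_add ((hf.sq.intervalIntegrable hT.le).const_mul 2)
      ((hg.sq.intervalIntegrable hT.le).const_mul 2)]
  refine intervalIntegral.integral_mono_on hT.le
    ((hf.add hg).sq.intervalIntegrable hT.le)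
    (((hf.sq.intervalIntegrable hT.le).const_mul 2).add
      ((hg.sq.intervalIntegrable hT.le).const_mul 2)) fun t _ => ?_
  nlinarith [sq_nonneg (f t - g t)]

/-- The Cauchy–Schwarz inequality. -/
theorem integral_mul_sq_le {T : ℝ} (hT : 0 < T) {f g : ℝ → ℝ} (hf : Bdd T f) (hg : Bdd T g) :
    (∫ t in 0..T, f t * g t) ^ 2 ≤ (∫ t in 0..T, f t ^ 2) * ∫ t in 0..T, g t ^ 2 := by
  have hfi := hf.sq.intervalIntegrable hT.le
  have hgi := hg.sq.intervalIntegrable hT.le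
  have hfgi := (hf.mul hg).intervalIntegrable hT.le
  have key : ∀ x : ℝ, 0 ≤ (∫ t in 0..T, g t ^ 2) * (x * x) +
      (2 * ∫ t in 0..T, f t * g t) * x + ∫ t in 0..T, f t ^ 2 := fun x => by
    have h1 := integral_sq_nonneg hT (fun t => f t + x * g t)
    have e : ∀ t, (f t + x * g t) ^ 2 = (x * x) * g t ^ 2 + (2 * x) * (f t * g t) + f t ^ 2 :=
      fun t => by ring
    simp_rw [e] at h1
    rw [intervalIntegral.integral_add ((hgi.const_mul _).add (hfgi.const_mul _)) hfi,
      intervalIntegral.integral_add (hgi.const_mul _) (hfgi.const_mul _),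
      intervalIntegral.integral_const_mul, intervalIntegral.integral_const_mul] at h1
    linarith
  have := discrim_le_zero key
  unfold discrim at this
  nlinarith

theorem integral_abs_sq_le {T : ℝ} (hT : 0 < T) {f : ℝ → ℝ} (hf : Bdd T f) :
    (∫ t in 0..T, |f t|) ^ 2 ≤ T * ∫ t in 0..T, f t ^ 2 := by
  have h1 := integral_mul_sq_le hT (f := fun t => |f t|) (g := fun _ => 1) hf.abs
    (ContinuousOn.bdd continuousOn_const)
  simp only [mul_one, sq_abs, one_pow, intervalIntegral.integral_const, smul_eq_mul,
    sub_zero] at h1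
  linarith

/-- A partial integral is bounded by the integral of the modulus. -/
theorem abs_integral_le_integral_abs {T : ℝ} (hT : 0 < T) {f : ℝ → ℝ} (hf : Bdd T f) {a b : ℝ}
    (ha : a ∈ Icc 0 T) (hb : b ∈ Icc 0 T) : |∫ t in a..b, f t| ≤ ∫ t in 0..T, |f t| := by
  have hT0 : ∀ x ∈ Icc 0 T, x ∈ uIcc 0 T := fun x hx => by rwa [uIcc_of_le hT.le]
  have h1 := intervalIntegral.norm_integral_le_abs_integral_norm (μ := volume) (f := f) (a := a)
    (b := b)
  have h2 : |∫ t in a..b, ‖f t‖| ≤ |∫ t in 0..T, ‖f t‖| :=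
    intervalIntegral.abs_integral_mono_interval
      (uIoc_subset_uIoc_of_uIcc_subset_uIcc (uIcc_subset_uIcc (hT0 a ha) (hT0 b hb)))
      (Filter.Eventually.of_forall fun _ => norm_nonneg _) (hf.intervalIntegrable hT.le).norm
  refine (h1.trans h2).trans_eq (abs_of_nonneg ?_)
  exact intervalIntegral.integral_nonneg hT.le fun _ _ => norm_nonneg _

/-! ### The duality argument -/

/-- The error of linear interpolation in `L²` on the reference element. -/
theorem interpolation_ref {F F1 F2 : ℝ → ℝ} (h1 : ∀ s, HasDerivAt F (F1 s) s)
    (h2 : ∀ s, HasDerivAt F1 (F2 s) s) (hc : Continuous F2) {s : ℝ} (hs : s ∈ Icc (0:ℝ) 1) :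
    (F s - (F 0 + (F 1 - F 0) * s)) ^ 2 ≤ ∫ s in (0:ℝ)..1, F2 s ^ 2 := by
  have hb : Bdd 1 F2 := ContinuousOn.bdd hc.continuousOn
  have hd : ∀ s, HasDerivAt (fun s => F s - (F 0 + (F 1 - F 0) * s)) (F1 s - (F 1 - F 0)) s :=
    fun s => by
      have := (h1 s).sub (((hasDerivAt_id s).const_mul (F 1 - F 0)).const_add (F 0))
      rwa [mul_one] at this
  obtain ⟨x, hx, hx0⟩ := exists_hasDerivAt_eq_zero (f := fun s => F s - (F 0 + (F 1 - F 0) * s))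
    one_pos (fun s _ => (hd s).continuousAt.continuousWithinAt) (by simp) (fun s _ => hd s)
  set I := ∫ s in (0:ℝ)..1, |F2 s|
  have hI : I ^ 2 ≤ ∫ s in (0:ℝ)..1, F2 s ^ 2 := by
    simpa using integral_abs_sq_le one_pos hb
  have hder : ∀ s ∈ Icc (0:ℝ) 1, |F1 s - (F 1 - F 0)| ≤ I := fun s hs => by
    have h3 := intervalIntegral.integral_eq_sub_of_hasDerivAt (a := x) (b := s)
      (fun s _ => h2 s) (hc.intervalIntegrable _ _)
    have h4 : F1 s - (F 1 - F 0) = ∫ y in x..s, F2 y := by rw [h3]; linarith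
    rw [h4]
    exact abs_integral_le_integral_abs one_pos hb (Ioo_subset_Icc_self hx) hs
  have h5 := (convex_Icc (0:ℝ) 1).norm_image_sub_le_of_norm_hasDerivWithin_le
    (fun s _ => (hd s).hasDerivWithinAt) hder (show (0:ℝ) ∈ Icc (0:ℝ) 1 by simp) hs
  simp only [mul_zero, add_zero, sub_self, sub_zero, Real.norm_eq_abs, abs_of_nonneg hs.1] at h5
  have h6 : |F s - (F 0 + (F 1 - F 0) * s)| ≤ I :=
    h5.trans (mul_le_of_le_one_right ((abs_nonneg _).trans (hder 0 (by simp))) hs.2)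
  rw [← sq_abs]
  exact (pow_le_pow_left₀ (abs_nonneg _) h6 2).trans hI

/-- Approximation of smooth functions by continuous piecewise linear functions. -/
theorem exists_interpolation {T : ℝ} (hT : 0 < T) {N : ℕ} (hN : 1 ≤ N) {q : ℕ} (hq : 1 ≤ q)
    {f f1 f2 : ℝ → ℝ} (h1 : ∀ t, HasDerivAt f (f1 t) t)
    (h2 : ∀ t, HasDerivAt f1 (f2 t) t) (hc : Continuous f2) :
    ∃ v ∈ cpw T N q, v 0 = f 0 ∧
      ∫ t in 0..T, (f t - v t) ^ 2 ≤ (T / N) ^ 4 * ∫ t in 0..T, f2 t ^ 2 := by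
  have hpos := mesh_pos hT hN
  set F : ℕ → ℝ → ℝ := fun j s => f (((j : ℝ) + s) * (T / N)) with hF
  set W : ℕ → ℝ[X] := fun j =>
    Polynomial.C (F j 1 - F j 0) * Polynomial.X + Polynomial.C (F j 0) with hW
  have hWe : ∀ j s, (W j).eval s = F j 0 + (F j 1 - F j 0) * s := fun j s => by
    simp [hW]; ring
  obtain ⟨v, hv, hvW⟩ := exists_glue hT hN (q := q) (W := W)
    (fun j _ => Polynomial.natDegree_linear_le.trans hq) (fun j hj => by
      rw [hWe, hWe]; simp only [hF]; push_cast
      ring_nf)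
  refine ⟨v, hv, ?_, ?_⟩
  · have := hvW 0 (by omega) 0 (by simp)
    simpa [hWe, hF] using this
  have hfc : Continuous f := continuous_iff_continuousAt.2 fun t => (h1 t).continuousAt
  have hb : Bdd T (fun t => (f t - v t) ^ 2) :=
    ContinuousOn.bdd ((hfc.continuousOn.sub hv.2.1).pow 2)
  rw [integral_eq_sum_ref hT hN (hb.intervalIntegrable hT.le),
    integral_eq_sum_ref hT hN (Continuous.intervalIntegrable (by fun_prop) _ _), Finset.mul_sum]
  refine Finset.sum_le_sum fun j hj => ?_
  have hj' : j < N := Finset.mem_range.1 hj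
  have hlin : ∀ s : ℝ, HasDerivAt (fun s : ℝ => ((j : ℝ) + s) * (T / N)) (T / N) s := fun s => by
    have := ((hasDerivAt_id s).const_add (j : ℝ)).mul_const (T / N)
    rwa [one_mul] at this
  have hloc : ∀ s ∈ Icc (0:ℝ) 1, (f (((j : ℝ) + s) * (T / N)) - v (((j : ℝ) + s) * (T / N))) ^ 2 ≤
      (T / N) ^ 4 * ∫ s in (0:ℝ)..1, f2 (((j : ℝ) + s) * (T / N)) ^ 2 := fun s hs => by
    have := interpolation_ref (F := F j) (F1 := fun s => (T / N) * f1 (((j : ℝ) + s) * (T / N)))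
      (F2 := fun s => (T / N) ^ 2 * f2 (((j : ℝ) + s) * (T / N)))
      (fun s => ((h1 _).scomp s (hlin s)))
      (fun s => (((h2 _).scomp s (hlin s)).const_mul (T / N)).congr_deriv (by
        rw [smul_eq_mul]; ring)) (by fun_prop) hs
    rw [hvW j hj' s hs, hWe]
    refine this.trans_eq ?_
    rw [← intervalIntegral.integral_const_mul]
    congr 1; ext s; ring
  have h3 := intervalIntegral.integral_mono_on (μ := volume) zero_le_one
    (ContinuousOn.intervalIntegrable_of_Icc zero_le_one
      (((hfc.comp (by fun_prop : Continuous fun s : ℝ => ((j : ℝ) + s) * (T / N))).continuousOn.sub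
        (continuousOn_ref hT hN hv.2.1 hj')).pow 2)) intervalIntegrable_const hloc
  rw [intervalIntegral.integral_const, sub_zero, one_smul] at h3
  calc _ ≤ (T / N) * ((T / N) ^ 4 * ∫ s in (0:ℝ)..1, f2 (((j : ℝ) + s) * (T / N)) ^ 2) :=
        mul_le_mul_of_nonneg_left h3 hpos.le
    _ = _ := by ring

/-- The form `a_μ(f, ℒ_T W)`, where `f1 = ∂_t f`, `f2 = ∂_t^2 f` and `w = ∂_t W` are passed
separately, so that no linearity of the derivatives is involved. -/
noncomputable def weightedForm (T μ : ℝ) (f f1 f2 w : ℝ → ℝ) : ℝ :=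
  (∫ t in 0..T, f2 t * (Real.exp (-t / T) * w t)) + f1 0 * w 0 +
    μ * ∫ t in 0..T, f t * (Real.exp (-t / T) * w t)

theorem HasPwDeriv.of_hasDerivAt {T : ℝ} {f f' : ℝ → ℝ} (h : ∀ t, HasDerivAt f (f' t) t)
    (hc : Continuous f') : HasPwDeriv T f f' :=
  hasPwDeriv_of_hasDerivWithinAt (fun t _ => (h t).hasDerivWithinAt) hc.continuousOn

/-- The dual problem is the backward problem `ψ'' + μ ψ = g`, `ψ(T) = ψ'(T) = 0`, which is solved
by the variation of constants formula, and `φ = e^{t/T} ψ`. -/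
theorem exists_dual_solution {T μ : ℝ} (hT : 0 < T) (hμ : 0 < μ) : ∃ C : ℝ, 0 < C ∧
    ∀ g : ℝ → ℝ, Continuous g → ∃ f f1 f2 : ℝ → ℝ, (∀ t, HasDerivAt f (f1 t) t) ∧
      (∀ t, HasDerivAt f1 (f2 t) t) ∧ Continuous f2 ∧
      ∫ t in 0..T, f2 t ^ 2 ≤ C * ∫ t in 0..T, g t ^ 2 ∧
      ∀ E E1 E2 : ℝ → ℝ, HasPwDeriv T E E1 → HasPwDeriv T E1 E2 → E 0 = 0 →
        weightedForm T μ E E1 E2 f = ∫ t in 0..T, E t * g t := by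
  set c := √μ with hc
  have hcpos : 0 < c := Real.sqrt_pos.2 hμ
  have hcc : c * c = μ := Real.mul_self_sqrt hμ.le
  set B : ℝ := μ * (2 / c) + 2 * 2 / T + (2 / c) / T ^ 2 with hB
  have hBpos : 0 < B := by positivity
  refine ⟨2 * Real.exp 1 ^ 2 * (1 + B ^ 2 * T ^ 2), by positivity, fun g hg => ?_⟩
  set Cg : ℝ → ℝ := fun t => ∫ s in T..t, Real.cos (c * s) * g s with hCg
  set Sg : ℝ → ℝ := fun t => ∫ s in T..t, Real.sin (c * s) * g s with hSg
  have hCd : ∀ t, HasDerivAt Cg (Real.cos (c * t) * g t) t := fun t =>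
    ((by fun_prop : Continuous fun s => Real.cos (c * s) * g s).integral_hasStrictDerivAt
      T t).hasDerivAt
  have hSd : ∀ t, HasDerivAt Sg (Real.sin (c * t) * g t) t := fun t =>
    ((by fun_prop : Continuous fun s => Real.sin (c * s) * g s).integral_hasStrictDerivAt
      T t).hasDerivAt
  have hCT : Cg T = 0 := by simp [hCg]
  have hST : Sg T = 0 := by simp [hSg]
  have hct : ∀ t, HasDerivAt (fun t : ℝ => c * t) c t := fun t => by
    simpa using (hasDerivAt_id t).const_mul c
  -- `ψ t = (1 / c) ∫_T^t sin (c (t - s)) g s ds` by the addition theorem, and its derivatives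
  set ψ : ℝ → ℝ := fun t => (Real.sin (c * t) * Cg t - Real.cos (c * t) * Sg t) / c with hψ
  set ψ1 : ℝ → ℝ := fun t => Real.cos (c * t) * Cg t + Real.sin (c * t) * Sg t with hψ1
  set ψ2 : ℝ → ℝ := fun t => g t - μ * ψ t with hψ2
  have hd : ∀ t, HasDerivAt ψ (ψ1 t) t := fun t => by
    refine ((((hct t).sin.mul (hCd t)).sub ((hct t).cos.mul (hSd t))).div_const c).congr_deriv ?_
    simp only [hψ1]; field_simp; ring
  have hd1 : ∀ t, HasDerivAt ψ1 (ψ2 t) t := fun t => by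
    refine (((hct t).cos.mul (hCd t)).add ((hct t).sin.mul (hSd t))).congr_deriv ?_
    have h1 : μ * ψ t = c * (Real.sin (c * t) * Cg t - Real.cos (c * t) * Sg t) := by
      simp only [hψ]; rw [← hcc]; field_simp
    simp only [hψ2]
    rw [h1]
    linear_combination (g t) * Real.sin_sq_add_cos_sq (c * t)
  have hψc : Continuous ψ := continuous_iff_continuousAt.2 fun t => (hd t).continuousAt
  have hψ1c : Continuous ψ1 := continuous_iff_continuousAt.2 fun t => (hd1 t).continuousAt
  have hψ2c : Continuous ψ2 := by fun_prop
  have het : ∀ t, HasDerivAt (fun t : ℝ => Real.exp (t / T)) (Real.exp (t / T) / T) t := fun t =>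
    ((hasDerivAt_id t).div_const T).exp.congr_deriv (by simp [div_eq_mul_inv])
  have hgb : Bdd T g := ContinuousOn.bdd hg.continuousOn
  have hTmem : T ∈ Icc 0 T := ⟨hT.le, le_rfl⟩
  set G := ∫ t in 0..T, |g t| with hG
  set D := ∫ t in 0..T, g t ^ 2 with hD
  have hG0 : 0 ≤ G := intervalIntegral.integral_nonneg hT.le fun _ _ => abs_nonneg _
  have hGD : G ^ 2 ≤ T * D := integral_abs_sq_le hT hgb
  -- `ψ` and `ψ'` are bounded in the maximum norm by the `L¹` norm of `g`
  have hpart : ∀ a : ℝ → ℝ, Continuous a → (∀ t, |a t| ≤ 1) → ∀ t ∈ Icc 0 T,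
      |∫ s in T..t, a s * g s| ≤ G := fun a ha ha1 t ht => by
    refine (abs_integral_le_integral_abs hT
      (ContinuousOn.bdd (ha.mul hg).continuousOn) hTmem ht).trans ?_
    refine intervalIntegral.integral_mono_on hT.le
      (Continuous.intervalIntegrable (ha.mul hg).abs _ _)
      (Continuous.intervalIntegrable hg.abs _ _) fun s _ => ?_
    rw [Pi.mul_apply, abs_mul]
    exact mul_le_of_le_one_left (abs_nonneg _) (ha1 s)
  have hCb : ∀ t ∈ Icc 0 T, |Cg t| ≤ G :=
    hpart _ (by fun_prop) fun t => Real.abs_cos_le_one _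
  have hSb : ∀ t ∈ Icc 0 T, |Sg t| ≤ G :=
    hpart _ (by fun_prop) fun t => Real.abs_sin_le_one _
  have htrig : ∀ x y a b : ℝ, |x| ≤ 1 → |y| ≤ 1 → |a| ≤ G → |b| ≤ G → |x * a + y * b| ≤ 2 * G :=
    fun x y a b hx hy ha hb => by
      refine (abs_add_le _ _).trans ?_
      rw [abs_mul, abs_mul]
      have h1 := mul_le_mul hx ha (abs_nonneg _) zero_le_one
      have h2 := mul_le_mul hy hb (abs_nonneg _) zero_le_one
      linarith
  have hψ1b : ∀ t ∈ Icc 0 T, |ψ1 t| ≤ 2 * G := fun t ht =>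
    htrig _ _ _ _ (Real.abs_cos_le_one _) (Real.abs_sin_le_one _) (hCb t ht) (hSb t ht)
  have hψb : ∀ t ∈ Icc 0 T, |ψ t| ≤ 2 / c * G := fun t ht => by
    have h1 := htrig (Real.sin (c * t)) (-Real.cos (c * t)) _ _ (Real.abs_sin_le_one _)
      (by rw [abs_neg]; exact Real.abs_cos_le_one _) (hCb t ht) (hSb t ht)
    simp only [hψ]
    rw [abs_div, abs_of_pos hcpos, div_le_iff₀ hcpos, sub_eq_add_neg, ← neg_mul]
    refine h1.trans_eq ?_
    field_simp
  set f2 : ℝ → ℝ := fun t => Real.exp (t / T) * (ψ2 t + 2 * ψ1 t / T + ψ t / T ^ 2) with hf2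
  have hf2c : Continuous f2 := by fun_prop
  refine ⟨fun t => Real.exp (t / T) * ψ t, fun t => Real.exp (t / T) * (ψ1 t + ψ t / T), f2,
    fun t => ?_, fun t => ?_, hf2c, ?_, fun E E1 E2 hE hE1 hE0 => ?_⟩
  · refine ((het t).mul (hd t)).congr_deriv ?_
    ring
  · refine ((het t).mul ((hd1 t).add ((hd t).div_const T))).congr_deriv ?_
    simp only [hf2, Pi.add_apply]; field_simp; ring
  · have hpt : ∀ t ∈ Ioo 0 T \ ∅, f2 t ^ 2 ≤
        2 * Real.exp 1 ^ 2 * g t ^ 2 + 2 * Real.exp 1 ^ 2 * (B * G) ^ 2 := fun t ht => by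
      have ht' := Ioo_subset_Icc_self ht.1
      have h1 : |ψ2 t + 2 * ψ1 t / T + ψ t / T ^ 2| ≤ |g t| + B * G := by
        have e : ψ2 t + 2 * ψ1 t / T + ψ t / T ^ 2 =
            g t + (-μ * ψ t + (2 / T * ψ1 t + 1 / T ^ 2 * ψ t)) := by simp only [hψ2]; ring
        rw [e]
        refine (abs_add_le _ _).trans (add_le_add le_rfl ?_)
        refine (abs_add_le _ _).trans ?_
        have h2 := abs_add_le (2 / T * ψ1 t) (1 / T ^ 2 * ψ t)
        rw [abs_mul, abs_mul, abs_of_pos (by positivity : 0 < 2 / T),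
          abs_of_pos (by positivity : 0 < 1 / T ^ 2)] at h2
        rw [abs_mul, abs_neg, abs_of_pos hμ]
        have h3 := mul_le_mul_of_nonneg_left (hψb t ht') hμ.le
        have h4 := mul_le_mul_of_nonneg_left (hψ1b t ht') (by positivity : 0 ≤ 2 / T)
        have h5 := mul_le_mul_of_nonneg_left (hψb t ht') (by positivity : 0 ≤ 1 / T ^ 2)
        calc _ ≤ μ * (2 / c * G) + (2 / T * (2 * G) + 1 / T ^ 2 * (2 / c * G)) := by linarith
          _ = B * G := by rw [hB]; ring
      have h2 : Real.exp (t / T) ≤ Real.exp 1 :=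
        Real.exp_le_exp.2 ((div_le_one hT).2 ht'.2)
      have h3 : |f2 t| ≤ Real.exp 1 * (|g t| + B * G) := by
        simp only [hf2]
        rw [abs_mul, Real.abs_exp]
        exact mul_le_mul h2 h1 (abs_nonneg _) (Real.exp_pos _).le
      rw [← sq_abs]
      refine (pow_le_pow_left₀ (abs_nonneg _) h3 2).trans ?_
      rw [mul_pow]
      have h4 : (|g t| + B * G) ^ 2 ≤ 2 * g t ^ 2 + 2 * (B * G) ^ 2 := by
        rw [← sq_abs (g t)]; nlinarith [sq_nonneg (|g t| - B * G)]
      calc _ ≤ Real.exp 1 ^ 2 * (2 * g t ^ 2 + 2 * (B * G) ^ 2) :=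
            mul_le_mul_of_nonneg_left h4 (by positivity)
        _ = _ := by ring
    have h1 := integral_mono_Ioo hT (ContinuousOn.bdd (by fun_prop))
      (ContinuousOn.bdd (by fun_prop)) countable_empty hpt
    rw [intervalIntegral.integral_add (Continuous.intervalIntegrable (by fun_prop) _ _)
      (by simp), intervalIntegral.integral_const_mul] at h1
    simp only [intervalIntegral.integral_const, sub_zero, smul_eq_mul] at h1
    refine h1.trans ?_
    have h2 : T * (2 * Real.exp 1 ^ 2 * (B * G) ^ 2) ≤
        2 * Real.exp 1 ^ 2 * (B ^ 2 * T ^ 2) * D := by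
      calc T * (2 * Real.exp 1 ^ 2 * (B * G) ^ 2) = (2 * Real.exp 1 ^ 2 * B ^ 2 * T) * G ^ 2 := by
            ring
        _ ≤ (2 * Real.exp 1 ^ 2 * B ^ 2 * T) * (T * D) :=
            mul_le_mul_of_nonneg_left hGD (by positivity)
        _ = _ := by ring
    linarith
  -- the weight cancels the factor `e^{t/T}`; then two integrations by parts
  · have e : ∀ t, Real.exp (-t / T) * (Real.exp (t / T) * ψ t) = ψ t := fun t => by
      rw [← mul_assoc, ← Real.exp_add, neg_div, neg_add_cancel, Real.exp_zero, one_mul]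
    simp only [weightedForm, e, zero_div, Real.exp_zero, one_mul]
    have hψp : HasPwDeriv T ψ ψ1 := HasPwDeriv.of_hasDerivAt hd hψ1c
    have hψp1 : HasPwDeriv T ψ1 ψ2 := HasPwDeriv.of_hasDerivAt hd1 hψ2c
    have h0mem : (0:ℝ) ∈ Icc 0 T := ⟨le_rfl, hT.le⟩
    have h1 := (hE1.mul hψp).integral_eq h0mem hTmem
    have h2 := (hE.mul hψp1).integral_eq h0mem hTmem
    have hψT : ψ T = 0 := by simp [hψ, hCT, hST]
    have hψ1T : ψ1 T = 0 := by simp [hψ1, hCT, hST]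
    rw [hψT] at h1
    rw [hψ1T, hE0] at h2
    have i1 := (hE1.bdd_deriv.mul hψp.bdd).intervalIntegrable hT.le
    have i2 := (hE1.bdd.mul hψp1.bdd).intervalIntegrable hT.le
    have i3 := (hE.bdd.mul hψp.bdd).intervalIntegrable hT.le
    have i4 := (hE.bdd.mul hgb).intervalIntegrable hT.le
    have e2 : ∀ t, E1 t * ψ1 t + E t * ψ2 t = E1 t * ψ1 t + (E t * g t - μ * (E t * ψ t)) :=
      fun t => by simp only [hψ2]; ring
    simp_rw [e2] at h2
    rw [intervalIntegral.integral_add i1 i2] at h1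
    rw [intervalIntegral.integral_add i2 (i4.sub (i3.const_mul μ)),
      intervalIntegral.integral_sub i4 (i3.const_mul μ),
      intervalIntegral.integral_const_mul] at h2
    linarith

/-! ### Coercivity and the discrete problem -/

theorem continuous_weight (T : ℝ) : Continuous fun t : ℝ => Real.exp (-t / T) := by fun_prop

theorem bdd_weight (T : ℝ) : Bdd T fun t : ℝ => Real.exp (-t / T) :=
  ContinuousOn.bdd (continuous_weight T).continuousOn

theorem hasPwDeriv_weight (T : ℝ) :
    HasPwDeriv T (fun t => Real.exp (-t / T)) (fun t => -(1 / T) * Real.exp (-t / T)) :=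
  HasPwDeriv.of_hasDerivAt (fun t => ((hasDerivAt_id t).neg.div_const T).exp.congr_deriv (by
    simp; ring)) (by fun_prop)

theorem weight_mem {T : ℝ} (hT : 0 < T) {t : ℝ} (ht : t ∈ Icc 0 T) :
    Real.exp (-1) ≤ Real.exp (-t / T) ∧ Real.exp (-t / T) ≤ 1 := by
  constructor
  · apply Real.exp_le_exp.2
    rw [neg_div]; exact neg_le_neg ((div_le_one hT).2 ht.2)
  · apply Real.exp_le_one_iff.2
    rw [neg_div]; exact neg_nonpos.2 (div_nonneg ht.1 hT.le)

section Mesh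

variable {T : ℝ} {N : ℕ}

theorem continuousOn_weight_tD_one (hT : 0 < T) {p : ℕ} {w : ℝ → ℝ} (hw : w ∈ spline T N p) :
    ContinuousOn (fun s => Real.exp (-s / T) * tD T 1 w s) (Icc 0 T) :=
  (continuous_weight T).continuousOn.mul (continuousOn_tD hT hw.2.1 le_rfl)

theorem tD_one_opL (hT : 0 < T) {p : ℕ} {w : ℝ → ℝ} (hw : w ∈ spline T N p) {t : ℝ}
    (ht : t ∈ Icc 0 T) : tD T 1 (opL T w) t = Real.exp (-t / T) * tD T 1 w t :=
  tD_one_prim hT (continuousOn_weight_tD_one hT hw) ht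

theorem opL_mem_H20 (hT : 0 < T) (hN : 1 ≤ N) {p : ℕ} {w : ℝ → ℝ} (hw : w ∈ spline T N p) :
    opL T w ∈ H20 hT :=
  mem_H20_of_hasPwDeriv hT (fun _ ht => prim_of_notMem ht) (prim_zero hT)
    (fun _ ht => hasDerivWithinAt_prim hT (continuousOn_weight_tD_one hT hw) ht)
    ((hasPwDeriv_weight T).mul (hasPwDeriv_tD_one_of_mem_spline hT hN hw))

theorem aForm_opL (hT : 0 < T) {p : ℕ} {w : ℝ → ℝ} (hw : w ∈ spline T N p) (μ : ℝ)
    (f : ℝ → ℝ) : aForm T μ f (opL T w) = weightedForm T μ f (tD T 1 f) (tD T 2 f) (tD T 1 w) := by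
  unfold aForm weightedForm
  rw [tD_one_opL hT hw ⟨le_rfl, hT.le⟩, neg_zero, zero_div, Real.exp_zero, one_mul]
  congr 2
  · refine integral_congr_Ioo hT.le countable_empty fun t ht => ?_
    rw [tD_one_opL hT hw (Ioo_subset_Icc_self ht.1)]
  · refine integral_congr_Ioo hT.le countable_empty fun t ht => ?_
    rw [tD_one_opL hT hw (Ioo_subset_Icc_self ht.1)]

theorem weightedForm_sub (hT : 0 < T) (μ : ℝ) {f f1 f2 g g1 g2 w : ℝ → ℝ} (hf : Bdd T f)
    (hf2 : Bdd T f2) (hg : Bdd T g) (hg2 : Bdd T g2) (hw : Bdd T w) :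
    weightedForm T μ (fun t => f t - g t) (fun t => f1 t - g1 t) (fun t => f2 t - g2 t) w =
      weightedForm T μ f f1 f2 w - weightedForm T μ g g1 g2 w := by
  have hi : ∀ f : ℝ → ℝ, Bdd T f →
      IntervalIntegrable (fun t => f t * (Real.exp (-t / T) * w t)) volume 0 T := fun f hf =>
    (hf.mul ((bdd_weight T).mul hw)).intervalIntegrable hT.le
  unfold weightedForm
  simp only [sub_mul]
  rw [intervalIntegral.integral_sub (hi _ hf2) (hi _ hg2),
    intervalIntegral.integral_sub (hi _ hf) (hi _ hg)]
  ring

theorem weightedForm_sub_right (hT : 0 < T) (μ : ℝ) {f f1 f2 w w' : ℝ → ℝ} (hf : Bdd T f)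
    (hf2 : Bdd T f2) (hw : Bdd T w) (hw' : Bdd T w') :
    weightedForm T μ f f1 f2 (fun t => w t - w' t) =
      weightedForm T μ f f1 f2 w - weightedForm T μ f f1 f2 w' := by
  have hi : ∀ f w : ℝ → ℝ, Bdd T f → Bdd T w →
      IntervalIntegrable (fun t => f t * (Real.exp (-t / T) * w t)) volume 0 T := fun f w hf hw =>
    (hf.mul ((bdd_weight T).mul hw)).intervalIntegrable hT.le
  unfold weightedForm
  simp only [mul_sub]
  rw [intervalIntegral.integral_sub (hi _ _ hf2 hw) (hi _ _ hf2 hw'),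
    intervalIntegral.integral_sub (hi _ _ hf hw) (hi _ _ hf hw')]
  ring

theorem weightedForm_congr (hT : 0 < T) (μ : ℝ) {f f1 f2 g g1 g2 w w' : ℝ → ℝ} {s : Set ℝ}
    (hs : s.Countable) (h : ∀ t ∈ Ioo 0 T \ s, f t = g t ∧ f2 t = g2 t ∧ w t = w' t)
    (h1 : f1 0 = g1 0) (hw : w 0 = w' 0) :
    weightedForm T μ f f1 f2 w = weightedForm T μ g g1 g2 w' := by
  unfold weightedForm
  rw [h1, hw, integral_congr_Ioo hT.le hs (fun t ht => by rw [(h t ht).2.1, (h t ht).2.2]),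
    integral_congr_Ioo hT.le hs (f := fun t => f t * (Real.exp (-t / T) * w t))
      (fun t ht => by rw [(h t ht).1, (h t ht).2.2])]

/-- Integration by parts with the weight `e^{-t/T}`: the derivative of the weight provides a
positive term. -/
theorem weighted_integral_deriv_mul_self (hT : 0 < T) {f f' : ℝ → ℝ} (hf : HasPwDeriv T f f') :
    ∫ t in 0..T, f' t * (Real.exp (-t / T) * f t) =
      (Real.exp (-1) * f T ^ 2 - f 0 ^ 2) / 2 +
        1 / (2 * T) * ∫ t in 0..T, Real.exp (-t / T) * f t ^ 2 := by
  have h1 := (hf.mul ((hasPwDeriv_weight T).mul hf)).integral_eq (⟨le_rfl, hT.le⟩ : (0:ℝ) ∈ Icc 0 T)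
    ⟨hT.le, le_rfl⟩
  have e : ∀ t, f' t * (Real.exp (-t / T) * f t) +
      f t * (-(1 / T) * Real.exp (-t / T) * f t + Real.exp (-t / T) * f' t) =
      2 * (f' t * (Real.exp (-t / T) * f t)) - 1 / T * (Real.exp (-t / T) * f t ^ 2) :=
    fun t => by ring
  simp_rw [e] at h1
  rw [intervalIntegral.integral_sub
    (((hf.bdd_deriv.mul ((bdd_weight T).mul hf.bdd)).intervalIntegrable hT.le).const_mul 2)
    ((((bdd_weight T).mul hf.bdd.sq).intervalIntegrable hT.le).const_mul _),
    intervalIntegral.integral_const_mul, intervalIntegral.integral_const_mul, neg_div,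
    div_self hT.ne', neg_zero, zero_div, Real.exp_zero] at h1
  have e2 : 1 / (2 * T) * ∫ t in 0..T, Real.exp (-t / T) * f t ^ 2 =
      1 / 2 * (1 / T * ∫ t in 0..T, Real.exp (-t / T) * f t ^ 2) := by field_simp
  rw [e2]
  linarith

/-- Coercivity of `(w, W) ↦ a_μ(w, ℒ_T W)`. -/
theorem weightedForm_coercive (hT : 0 < T) {μ : ℝ} (hμ : 0 < μ) {f f1 f2 : ℝ → ℝ}
    (hf : HasPwDeriv T f f1) (hf1 : HasPwDeriv T f1 f2) (hf0 : f 0 = 0) :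
    1 / (2 * T) * ∫ t in 0..T, Real.exp (-t / T) * f1 t ^ 2 ≤ weightedForm T μ f f1 f2 f1 := by
  have h1 := weighted_integral_deriv_mul_self hT hf1
  have h2 := weighted_integral_deriv_mul_self hT hf
  have e : ∫ t in 0..T, f t * (Real.exp (-t / T) * f1 t) =
      ∫ t in 0..T, f1 t * (Real.exp (-t / T) * f t) := by congr 1; ext t; ring
  unfold weightedForm
  rw [e, h1, h2, hf0]
  have h3 : 0 ≤ ∫ t in 0..T, Real.exp (-t / T) * f t ^ 2 :=
    intervalIntegral.integral_nonneg hT.le fun t _ => by positivity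
  have h4 : 0 ≤ μ * ((Real.exp (-1) * f T ^ 2 - 0 ^ 2) / 2 +
      1 / (2 * T) * ∫ t in 0..T, Real.exp (-t / T) * f t ^ 2) := by
    have : (0:ℝ) ^ 2 = 0 := by norm_num
    rw [this, sub_zero]; positivity
  have h5 : 0 ≤ Real.exp (-1) * f1 T ^ 2 := by positivity
  nlinarith [sq_nonneg (f1 0)]

theorem finiteDimensional_cpw (hT : 0 < T) (hN : 1 ≤ N) (q : ℕ) :
    FiniteDimensional ℝ (cpw T N q) := by
  let Φ : cpw T N q →ₗ[ℝ] (Fin N × Fin (q + 1) → ℝ) := LinearMap.pi fun i =>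
    (LinearMap.proj (R := ℝ) (φ := fun _ : ℝ => ℝ)
      ((((i.1 : ℕ) : ℝ) + ((i.2 : ℕ) : ℝ) / (q + 1)) * (T / N))).comp (cpw T N q).subtype
  refine FiniteDimensional.of_injective Φ ?_
  rw [← LinearMap.ker_eq_bot, LinearMap.ker_eq_bot']
  rintro ⟨w, hw⟩ hΦ
  obtain ⟨W, hW⟩ := exists_ref_of_mem_cpw hT hN hw
  have hq : (0:ℝ) < q + 1 := by positivity
  have hW0 : ∀ j < N, W j = 0 := by
    intro j hj
    refine Polynomial.eq_zero_of_natDegree_lt_card_of_eval_eq_zero (ι := Fin (q + 1)) (W j)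
      (f := fun i => ((i : ℕ) : ℝ) / (q + 1)) ?_ ?_ ?_
    · intro a b hab
      exact Fin.ext (by exact_mod_cast (div_left_inj' hq.ne').1 hab)
    · intro i
      have h1 : ((i : ℕ) : ℝ) ≤ q + 1 := by exact_mod_cast i.2.le
      rw [← (hW j hj).2 _ ⟨by positivity, (div_le_one hq).2 h1⟩]
      exact congrFun hΦ (⟨j, hj⟩, i)
    · simpa using Nat.lt_succ_of_le (hW j hj).1
  refine Subtype.ext (funext fun t => ?_)
  by_cases ht : t ∈ Icc 0 T
  · obtain ⟨j, hj, s, hs, rfl⟩ := exists_ref hT hN ht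
    exact ((hW j hj).2 s hs).trans (by rw [hW0 j hj]; simp)
  · exact hw.1 t ht

theorem finiteDimensional_spline (hT : 0 < T) (hN : 1 ≤ N) (p : ℕ) :
    FiniteDimensional ℝ (spline T N p) := by
  have := finiteDimensional_cpw hT hN p
  exact Submodule.finiteDimensional_of_le (S₂ := cpw T N p) fun w hw => hw.1

theorem tD_one_add_spline (hT : 0 < T) {p : ℕ} {w w' : ℝ → ℝ} (hw : w ∈ spline T N p)
    (hw' : w' ∈ spline T N p) (t : ℝ) : tD T 1 (w + w') t = tD T 1 w t + tD T 1 w' t := by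
  by_cases ht : t ∈ Icc 0 T
  · exact tD_one_of_hasDerivWithinAt hT ht ((hasDerivWithinAt_of_mem_spline hT hw ht).add
      (hasDerivWithinAt_of_mem_spline hT hw' ht))
  · rw [tD_succ_of_notMem ht, tD_succ_of_notMem ht, tD_succ_of_notMem ht, add_zero]

theorem tD_smul (T : ℝ) (k : ℕ) (c : ℝ) (u : ℝ → ℝ) (t : ℝ) :
    tD T k (c • u) t = c * tD T k u t :=
  iteratedDerivWithin_const_smul_field c u

theorem exists_hasDerivAt_tD_one (hT : 0 < T) (hN : 1 ≤ N) {p : ℕ} {w : ℝ → ℝ}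
    (hw : w ∈ spline T N p) : ∃ s : Set ℝ, s.Countable ∧ ∀ t ∈ Ioo 0 T \ s,
      HasDerivAt (tD T 1 w) (tD T 2 w t) t := by
  obtain ⟨s, hs, M, hM⟩ := (hasPwDeriv_tD_one_of_mem_spline hT hN hw).exists_bound
  exact ⟨s, hs, fun t ht => (hM t ht).1⟩

theorem exists_tD_two_add_spline (hT : 0 < T) (hN : 1 ≤ N) {p : ℕ} {w w' : ℝ → ℝ}
    (hw : w ∈ spline T N p) (hw' : w' ∈ spline T N p) :
    ∃ s : Set ℝ, s.Countable ∧ ∀ t ∈ Ioo 0 T \ s,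
      tD T 2 (w + w') t = tD T 2 w t + tD T 2 w' t := by
  obtain ⟨s, hs, h⟩ := exists_hasDerivAt_tD_one hT hN hw
  obtain ⟨s', hs', h'⟩ := exists_hasDerivAt_tD_one hT hN hw'
  refine ⟨s ∪ s', hs.union hs', fun t ht => ?_⟩
  have h1 := (h t ⟨ht.1, fun hh => ht.2 (Or.inl hh)⟩).add (h' t ⟨ht.1, fun hh => ht.2 (Or.inr hh)⟩)
  refine tD_two_of_hasDerivAt hT (fun t ht => ?_) (Ioo_subset_Icc_self ht.1) h1
  exact (hasDerivWithinAt_of_mem_spline hT hw ht).add (hasDerivWithinAt_of_mem_spline hT hw' ht)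

theorem weightedForm_tD_one_add (hT : 0 < T) (hN : 1 ≤ N) {μ : ℝ} {f f1 f2 : ℝ → ℝ}
    (hf : Bdd T f) (hf2 : Bdd T f2) {p : ℕ} {w w' : ℝ → ℝ} (hw : w ∈ spline T N p)
    (hw' : w' ∈ spline T N p) : weightedForm T μ f f1 f2 (tD T 1 (w + w')) =
      weightedForm T μ f f1 f2 (tD T 1 w) + weightedForm T μ f f1 f2 (tD T 1 w') := by
  have h1 := weightedForm_sub_right hT μ (f1 := f1) hf hf2
    (hasPwDeriv_tD_one_of_mem_spline hT hN (add_mem hw hw')).bdd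
    (hasPwDeriv_tD_one_of_mem_spline hT hN hw').bdd
  have e : (fun t => tD T 1 (w + w') t - tD T 1 w' t) = tD T 1 w := funext fun t => by
    rw [tD_one_add_spline hT hw hw']; ring
  rw [e] at h1
  linarith

theorem weightedForm_tD_one_smul (hT : 0 < T) (μ : ℝ) {f f1 f2 : ℝ → ℝ} (c : ℝ) {w : ℝ → ℝ} :
    weightedForm T μ f f1 f2 (tD T 1 (c • w)) = c • weightedForm T μ f f1 f2 (tD T 1 w) := by
  rw [weightedForm_congr hT μ (g := f) (g1 := f1) (g2 := f2)
    (w' := fun t => c * tD T 1 w t) countable_empty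
    (fun t _ => ⟨rfl, rfl, tD_smul T 1 c w t⟩) rfl (tD_smul T 1 c w 0)]
  unfold weightedForm
  have e : ∀ a b d : ℝ, a * (b * (c * d)) = c * (a * (b * d)) := fun a b d => by ring
  simp only [e]
  rw [intervalIntegral.integral_const_mul, intervalIntegral.integral_const_mul, smul_eq_mul]
  ring

/-- The bilinear form of the discrete problem. -/
noncomputable def discreteForm (hT : 0 < T) (hN : 1 ≤ N) (p : ℕ) (μ : ℝ) :
    spline T N p →ₗ[ℝ] spline T N p →ₗ[ℝ] ℝ :=
  LinearMap.mk₂ ℝ (fun x y => weightedForm T μ x (tD T 1 x) (tD T 2 x) (tD T 1 y))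
    (fun x x' y => by
      have hi : ∀ f : ℝ → ℝ, Bdd T f → IntervalIntegrable
          (fun t => f t * (Real.exp (-t / T) * tD T 1 (y : ℝ → ℝ) t)) volume 0 T := fun f hf =>
        (hf.mul ((bdd_weight T).mul
          (hasPwDeriv_tD_one_of_mem_spline hT hN y.2).bdd)).intervalIntegrable hT.le
      obtain ⟨s, hs, h⟩ := exists_tD_two_add_spline hT hN x.2 x'.2
      have hb := (hasPwDeriv_tD_one_of_mem_spline hT hN x.2).bdd_deriv
      have hb' := (hasPwDeriv_tD_one_of_mem_spline hT hN x'.2).bdd_deriv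
      have hc : Bdd T (x : ℝ → ℝ) := ContinuousOn.bdd x.2.1.2.1
      have hc' : Bdd T (x' : ℝ → ℝ) := ContinuousOn.bdd x'.2.1.2.1
      refine Eq.trans (weightedForm_congr hT μ (g := fun t => (x : ℝ → ℝ) t + (x' : ℝ → ℝ) t)
        (g1 := fun t => tD T 1 (x : ℝ → ℝ) t + tD T 1 (x' : ℝ → ℝ) t)
        (g2 := fun t => tD T 2 (x : ℝ → ℝ) t + tD T 2 (x' : ℝ → ℝ) t)
        (w' := tD T 1 (y : ℝ → ℝ)) hs
        (fun t ht => ⟨rfl, h t ht, rfl⟩) (tD_one_add_spline hT x.2 x'.2 0) rfl) ?_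
      unfold weightedForm
      simp only [add_mul]
      rw [intervalIntegral.integral_add (hi _ hb) (hi _ hb'),
        intervalIntegral.integral_add (hi _ hc) (hi _ hc')]
      ring)
    (fun c x y => by
      refine Eq.trans (weightedForm_congr hT μ (g := fun t => c * (x : ℝ → ℝ) t)
        (g1 := fun t => c * tD T 1 (x : ℝ → ℝ) t) (g2 := fun t => c * tD T 2 (x : ℝ → ℝ) t)
        (w' := tD T 1 (y : ℝ → ℝ)) countable_empty
        (fun t _ => ⟨rfl, tD_smul T 2 c x t, rfl⟩) (tD_smul T 1 c x 0) rfl) ?_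
      unfold weightedForm
      simp only [mul_assoc]
      rw [intervalIntegral.integral_const_mul, intervalIntegral.integral_const_mul, smul_eq_mul]
      ring)
    (fun x y y' => weightedForm_tD_one_add hT hN (ContinuousOn.bdd x.2.1.2.1)
      (hasPwDeriv_tD_one_of_mem_spline hT hN x.2).bdd_deriv y.2 y'.2)
    (fun c x y => weightedForm_tD_one_smul hT μ c)

theorem hasPwDeriv_of_mem_spline (hT : 0 < T) {p : ℕ} {w : ℝ → ℝ} (hw : w ∈ spline T N p) :
    HasPwDeriv T w (tD T 1 w) :=
  hasPwDeriv_of_hasDerivWithinAt (fun _ ht => hasDerivWithinAt_of_mem_spline hT hw ht)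
    (continuousOn_tD hT hw.2.1 le_rfl)

theorem discreteForm_posDef (hT : 0 < T) (hN : 1 ≤ N) (p : ℕ) {μ : ℝ} (hμ : 0 < μ)
    (x : spline T N p) (hx : discreteForm hT hN p μ x x = 0) : x = 0 := by
  have h1 := weightedForm_coercive hT hμ (hasPwDeriv_of_mem_spline hT x.2)
    (hasPwDeriv_tD_one_of_mem_spline hT hN x.2) x.2.2.2
  have h2 : weightedForm T μ x (tD T 1 x) (tD T 2 x) (tD T 1 x) = 0 := hx
  rw [h2] at h1
  have hc := continuousOn_tD hT x.2.2.1 le_rfl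
  have h3 : ∀ t ∈ Icc 0 T, tD T 1 (x : ℝ → ℝ) t = 0 := by
    by_contra hne
    push Not at hne
    obtain ⟨t, ht, hne⟩ := hne
    have h4 := intervalIntegral.integral_pos hT
      (((continuous_weight T).continuousOn (s := Icc 0 T)).mul (hc.pow 2))
      (fun s _ => mul_nonneg (Real.exp_pos _).le (sq_nonneg _))
      ⟨t, ht, mul_pos (Real.exp_pos _) (sq_pos_of_ne_zero hne)⟩
    have h5 : 0 < 1 / (2 * T) * ∫ t in 0..T, Real.exp (-t / T) * tD T 1 (x : ℝ → ℝ) t ^ 2 :=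
      mul_pos (by positivity) h4
    linarith
  refine Subtype.ext (funext fun t => ?_)
  rw [← prim_tD_one_of_mem_spline hT x.2]
  by_cases ht : t ∈ Icc 0 T
  · rw [prim_apply ht, integral_congr_Ioo ht.1 countable_empty (g := fun _ => 0) fun s hs =>
      h3 s ⟨hs.1.1.le, hs.1.2.le.trans ht.2⟩]
    simp
  · rw [prim_of_notMem ht]; rfl

/-- Unique solvability of the discrete problem; the solution is characterised by Galerkin
orthogonality. -/
theorem exists_discreteSolution (hT : 0 < T) (hN : 1 ≤ N) (p : ℕ) {μ : ℝ} (hμ : 0 < μ)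
    {f u : ℝ → ℝ} (hu : IsSolution hT μ f u) (hub : Bdd T u) (hu2 : Bdd T (tD T 2 u)) :
    ∃ uh, IsDiscreteSolution T μ f (spline T N p) uh ∧
      (∀ vh, IsDiscreteSolution T μ f (spline T N p) vh → vh = uh) ∧
      ∀ wh ∈ spline T N p, weightedForm T μ uh (tD T 1 uh) (tD T 2 uh) (tD T 1 wh) =
        weightedForm T μ u (tD T 1 u) (tD T 2 u) (tD T 1 wh) := by
  have := finiteDimensional_spline hT hN p
  have hiff : ∀ vh ∈ spline T N p, IsDiscreteSolution T μ f (spline T N p) vh ↔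
      ∀ wh ∈ spline T N p, weightedForm T μ vh (tD T 1 vh) (tD T 2 vh) (tD T 1 wh) =
        weightedForm T μ u (tD T 1 u) (tD T 2 u) (tD T 1 wh) := fun vh hvh => by
    refine ⟨fun h wh hwh => ?_, fun h => ⟨hvh, fun wh hwh => ?_⟩⟩
    · rw [← aForm_opL hT hwh, ← aForm_opL hT hwh, h.2 wh hwh, hu.2 _ (opL_mem_H20 hT hN hwh)]
    · rw [aForm_opL hT hwh, h wh hwh, ← aForm_opL hT hwh, hu.2 _ (opL_mem_H20 hT hN hwh)]
  let l : spline T N p →ₗ[ℝ] ℝ :=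
    { toFun := fun y => weightedForm T μ u (tD T 1 u) (tD T 2 u) (tD T 1 y)
      map_add' := fun y y' => weightedForm_tD_one_add hT hN hub hu2 y.2 y'.2
      map_smul' := fun c y => weightedForm_tD_one_smul hT μ c }
  obtain ⟨x, hx⟩ := exists_repr_of_posDef (discreteForm hT hN p μ)
    (discreteForm_posDef hT hN p hμ) l
  have hxo : ∀ wh ∈ spline T N p, weightedForm T μ x (tD T 1 x) (tD T 2 x) (tD T 1 wh) =
      weightedForm T μ u (tD T 1 u) (tD T 2 u) (tD T 1 wh) := fun wh hwh => hx ⟨wh, hwh⟩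
  refine ⟨x, (hiff x x.2).2 hxo, fun vh hvh => ?_, hxo⟩
  have hv := (hiff vh hvh.1).1 hvh
  have h0 : discreteForm hT hN p μ (⟨vh, hvh.1⟩ - x) (⟨vh, hvh.1⟩ - x) = 0 := by
    rw [map_sub (discreteForm hT hN p μ), LinearMap.sub_apply, sub_eq_zero]
    exact (hv _ (Subtype.mem _)).trans (hxo _ (Subtype.mem _)).symm
  exact congrArg Subtype.val (sub_eq_zero.1 (discreteForm_posDef hT hN p hμ _ h0))

end Mesh

/-! ### Error estimates for the discrete solution -/

/-- The inverse inequality for piecewise polynomials. -/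
theorem exists_inverse_inequality {T : ℝ} (hT : 0 < T) (q : ℕ) : ∃ C : ℝ, 0 < C ∧
    ∀ N : ℕ, 1 ≤ N → ∀ v ∈ cpw T N q,
      (T / N) ^ 2 * ∫ t in 0..T, tD T 1 v t ^ 2 ≤ C * ∫ t in 0..T, v t ^ 2 := by
  obtain ⟨C, hC, hb⟩ := eval_bound (q + 1)
  refine ⟨C, hC, fun N hN v hv => ?_⟩
  have hpos := mesh_pos hT hN
  have hpw := hasPwDeriv_of_mem_cpw hT hN hv
  obtain ⟨W, hW⟩ := exists_ref_of_mem_cpw hT hN hv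
  rw [integral_eq_sum_ref hT hN (hpw.bdd_deriv.sq.intervalIntegrable hT.le),
    integral_eq_sum_ref hT hN (hpw.bdd.sq.intervalIntegrable hT.le), Finset.mul_sum, Finset.mul_sum]
  refine Finset.sum_le_sum fun j hj => ?_
  have hj' : j < N := Finset.mem_range.1 hj
  have hdeg : (W j).degree < (q + 1 : ℕ) :=
    (Polynomial.natDegree_le_iff_degree_le.1 (hW j hj').1).trans_lt
      (by exact_mod_cast Nat.lt_succ_self q)
  have e1 : ∫ s in (0:ℝ)..1, tD T 1 v (((j : ℝ) + s) * (T / N)) ^ 2 =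
      ((T / N) ^ 2)⁻¹ * ∫ s in (0:ℝ)..1, (W j).derivative.eval s ^ 2 := by
    rw [← intervalIntegral.integral_const_mul]
    refine integral_congr_Ioo zero_le_one countable_empty fun s hs => ?_
    rw [tD_one_ref hT hN hj' (hW j hj').2 hs.1, div_pow]; ring
  have e2 : ∫ s in (0:ℝ)..1, v (((j : ℝ) + s) * (T / N)) ^ 2 =
      ∫ s in (0:ℝ)..1, (W j).eval s ^ 2 :=
    integral_congr_Ioo zero_le_one countable_empty fun s hs => by
      rw [(hW j hj').2 s (Ioo_subset_Icc_self hs.1)]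
  have h1 : ∫ s in (0:ℝ)..1, (1 - s) * ((W j).eval s * (W j).eval s) ≤
      ∫ s in (0:ℝ)..1, (W j).eval s ^ 2 := by
    refine intervalIntegral.integral_mono_on zero_le_one
      (by apply Continuous.intervalIntegrable; fun_prop)
      (by apply Continuous.intervalIntegrable; fun_prop) fun s hs => ?_
    rw [← sq]
    exact mul_le_of_le_one_left (sq_nonneg _) (by linarith [hs.1])
  have h2 : ∫ s in (0:ℝ)..1, (W j).derivative.eval s ^ 2 ≤
      C * ∫ s in (0:ℝ)..1, (W j).eval s ^ 2 := by
    have h3 := intervalIntegral.integral_mono_on (μ := volume)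
      (f := fun s => (W j).derivative.eval s ^ 2) zero_le_one
      (by apply Continuous.intervalIntegrable; fun_prop) intervalIntegrable_const
      fun s hs => (hb (W j) hdeg s hs).2
    rw [intervalIntegral.integral_const, sub_zero, one_smul] at h3
    exact h3.trans (mul_le_mul_of_nonneg_left h1 hC.le)
  rw [e1, e2]
  calc (T / N) ^ 2 * ((T / N) * (((T / N) ^ 2)⁻¹ * ∫ s in (0:ℝ)..1, (W j).derivative.eval s ^ 2))
      = (T / N) * ∫ s in (0:ℝ)..1, (W j).derivative.eval s ^ 2 := by field_simp
    _ ≤ (T / N) * (C * ∫ s in (0:ℝ)..1, (W j).eval s ^ 2) := mul_le_mul_of_nonneg_left h2 hpos.le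
    _ = _ := by ring

/-- The duality estimate: a function that is Galerkin orthogonal to the splines is smaller, by two
powers of the mesh size, than its second derivative. -/
theorem exists_duality_estimate {T μ : ℝ} (hT : 0 < T) (hμ : 0 < μ) : ∃ C : ℝ, 0 < C ∧
    ∀ N : ℕ, 1 ≤ N → ∀ p : ℕ, 2 ≤ p → ∀ E E1 E2 : ℝ → ℝ, HasPwDeriv T E E1 → HasPwDeriv T E1 E2 →
      E 0 = 0 → (∀ w ∈ spline T N p, weightedForm T μ E E1 E2 (tD T 1 w) = 0) →
      √(∫ t in 0..T, E t ^ 2) ≤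
        C * (T / N) ^ 2 * (√(∫ t in 0..T, E2 t ^ 2) + μ * √(∫ t in 0..T, E t ^ 2)) := by
  obtain ⟨C, hC, hdual⟩ := exists_dual_solution hT hμ
  refine ⟨√C, Real.sqrt_pos.2 hC, fun N hN p hp E E1 E2 hE hE1 hE0 horth => ?_⟩
  have hpos := mesh_pos hT hN
  -- the right-hand side of the dual problem is `E`, extended continuously to `ℝ`
  set g : ℝ → ℝ := IccExtend hT.le ((Icc 0 T).domRestrict E)
  have hg : Continuous g := (continuousOn_iff_continuous_domRestrict.1 hE.continuousOn).Icc_extend'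
  have hgE : ∀ s ∈ Icc 0 T, g s = E s := fun s hs => by
    simp [g, IccExtend_of_mem hT.le _ hs]
  obtain ⟨f, f1, f2, hf, hf1, hf2, hfb, hid⟩ := hdual g hg
  obtain ⟨v, hv, hv0, hvb⟩ := exists_interpolation hT hN (q := p - 1) (by omega) hf hf1 hf2
  set D := ∫ t in 0..T, E t ^ 2 with hD
  have hD0 : 0 ≤ D := integral_sq_nonneg hT E
  have hgD : ∫ t in 0..T, g t ^ 2 = D := integral_congr_Ioo hT.le countable_empty fun t ht => by
    rw [hgE t (Ioo_subset_Icc_self ht.1)]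
  have hEg : ∫ t in 0..T, E t * g t = D := integral_congr_Ioo hT.le countable_empty fun t ht => by
    rw [hgE t (Ioo_subset_Icc_self ht.1), sq]
  rw [hgD] at hfb
  have h1 := hid E E1 E2 hE hE1 hE0
  rw [hEg] at h1
  have hfc : Continuous f := continuous_iff_continuousAt.2 fun t => (hf t).continuousAt
  have hfB : Bdd T f := ContinuousOn.bdd hfc.continuousOn
  have hvB : Bdd T v := ContinuousOn.bdd hv.2.1
  -- `v` is the derivative of a spline, so that Galerkin orthogonality applies
  have h2 : weightedForm T μ E E1 E2 v = 0 := by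
    have hmem := prim_mem_spline hT hN hv
    rw [show p - 1 + 1 = p by omega] at hmem
    rw [← horth _ hmem]
    refine weightedForm_congr hT μ countable_empty (fun t ht => ⟨rfl, rfl, ?_⟩) rfl ?_
    · rw [tD_one_prim hT hv.2.1 (Ioo_subset_Icc_self ht.1)]
    · rw [tD_one_prim hT hv.2.1 ⟨le_rfl, hT.le⟩]
  have h3 := weightedForm_sub_right hT μ (f1 := E1) hE.bdd hE1.bdd_deriv hfB hvB
  rw [h1, h2, sub_zero] at h3
  set R : ℝ → ℝ := fun t => f t - v t with hR
  have hRB : Bdd T R := hfB.sub hvB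
  -- the boundary term of the form vanishes, as the interpolation is exact at `0`
  have hR0 : R 0 = 0 := by simp only [hR]; rw [hv0, sub_self]
  have hRb : ∫ t in 0..T, (Real.exp (-t / T) * R t) ^ 2 ≤ ((T / N) ^ 2 * √C * √D) ^ 2 := by
    have h4 : ∫ t in 0..T, (Real.exp (-t / T) * R t) ^ 2 ≤ ∫ t in 0..T, R t ^ 2 := by
      refine integral_mono_Ioo hT ((bdd_weight T).mul hRB).sq hRB.sq countable_empty fun t ht => ?_
      rw [mul_pow]
      exact mul_le_of_le_one_left (sq_nonneg _) (pow_le_one₀ (Real.exp_pos _).le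
        (weight_mem hT (Ioo_subset_Icc_self ht.1)).2)
    refine (h4.trans (hvb.trans (mul_le_mul_of_nonneg_left hfb (by positivity)))).trans_eq ?_
    rw [mul_pow, mul_pow, Real.sq_sqrt hC.le, Real.sq_sqrt hD0]; ring
  have hcs : ∀ F : ℝ → ℝ, Bdd T F → |∫ t in 0..T, F t * (Real.exp (-t / T) * R t)| ≤
      √(∫ t in 0..T, F t ^ 2) * ((T / N) ^ 2 * √C * √D) := fun F hF => by
    refine abs_le_of_sq_le_sq ?_ (by positivity)
    refine (integral_mul_sq_le hT hF ((bdd_weight T).mul hRB)).trans ?_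
    rw [mul_pow (√_), Real.sq_sqrt (integral_sq_nonneg hT F)]
    exact mul_le_mul_of_nonneg_left hRb (integral_sq_nonneg hT F)
  have h5 := hcs E2 hE1.bdd_deriv
  have h6 := hcs E hE.bdd
  rw [← hD] at h6
  unfold weightedForm at h3
  rw [hR0, mul_zero, add_zero] at h3
  have h7 : √D * √D ≤ (√C * (T / N) ^ 2 * (√(∫ t in 0..T, E2 t ^ 2) + μ * √D)) * √D := by
    rw [Real.mul_self_sqrt hD0]
    have h8 := (le_abs_self _).trans h5
    have h9 := mul_le_mul_of_nonneg_left ((le_abs_self _).trans h6) hμ.le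
    nlinarith
  rcases (Real.sqrt_nonneg D).eq_or_lt with h0 | h0
  · rw [← h0]; positivity
  · exact le_of_mul_le_mul_right h7 h0

theorem tD_one_sub_spline {T : ℝ} {N : ℕ} (hT : 0 < T) {p : ℕ} {w w' : ℝ → ℝ}
    (hw : w ∈ spline T N p) (hw' : w' ∈ spline T N p) (t : ℝ) :
    tD T 1 (w - w') t = tD T 1 w t - tD T 1 w' t := by
  have := tD_one_add_spline hT (sub_mem hw hw') hw' t
  rw [sub_add_cancel] at this
  linarith

/-- The energy estimate: the discrete solution is close to the weighted projection, because the
leading part of the consistency error vanishes by the definition of the projection. -/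
theorem energy_estimate {T μ : ℝ} (hT : 0 < T) (hμ : 0 < μ) {N : ℕ} (hN : 1 ≤ N) {p : ℕ}
    {u w uh : ℝ → ℝ} {K : ℝ} (hu : ∀ t ∈ Icc 0 T, HasDerivWithinAt u (tD T 1 u t) (Icc 0 T) t)
    (hu1 : HasPwDeriv T (tD T 1 u) (tD T 2 u)) (hu0 : u 0 = 0)
    (hw : IsWeightedProj T (spline T N p) u w) (huh : uh ∈ spline T N p)
    (horth : ∀ wh ∈ spline T N p, weightedForm T μ uh (tD T 1 uh) (tD T 2 uh) (tD T 1 wh) =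
      weightedForm T μ u (tD T 1 u) (tD T 2 u) (tD T 1 wh))
    (hK : ∀ t ∈ Icc 0 T, |tD T 1 w t - tD T 1 u t| ≤ K) :
    ∫ t in 0..T, tD T 1 (w - uh) t ^ 2 ≤
      Real.exp 1 * (4 * T ^ 3 * ((1 / T + μ * T) * K) ^ 2) := by
  obtain ⟨hwS, hwT, hwo⟩ := hw
  have hK0 : 0 ≤ K := (abs_nonneg _).trans (hK 0 ⟨le_rfl, hT.le⟩)
  have hup : HasPwDeriv T u (tD T 1 u) := hasPwDeriv_of_hasDerivWithinAt hu hu1.continuousOn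
  have hwp := hasPwDeriv_of_mem_spline hT hwS
  have hwp1 := hasPwDeriv_tD_one_of_mem_spline hT hN hwS
  have hd := sub_mem hwS huh
  set d := w - uh with hddef
  have hdp := hasPwDeriv_of_mem_spline hT hd
  have hdp1 := hasPwDeriv_tD_one_of_mem_spline hT hN hd
  set e : ℝ → ℝ := fun t => u t - w t with he
  set e1 : ℝ → ℝ := fun t => tD T 1 u t - tD T 1 w t with he1
  set e2 : ℝ → ℝ := fun t => tD T 2 u t - tD T 2 w t with he2
  have hep : HasPwDeriv T e e1 := hup.sub hwp
  have hep1 : HasPwDeriv T e1 e2 := hu1.sub hwp1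
  have h0mem : (0:ℝ) ∈ Icc 0 T := ⟨le_rfl, hT.le⟩
  have he1b : ∀ t ∈ Icc 0 T, |e1 t| ≤ K := fun t ht => by rw [abs_sub_comm]; exact hK t ht
  have heb : ∀ t ∈ Icc 0 T, |e t| ≤ T * K := fun t ht => by
    have h1 := (convex_Icc 0 T).norm_image_sub_le_of_norm_hasDerivWithin_le (f := e) (f' := e1)
      (C := K) (fun s hs => (hu s hs).sub (hasDerivWithinAt_of_mem_spline hT hwS hs)) he1b h0mem ht
    have h2 : e 0 = 0 := by simp only [he]; rw [hu0, hwS.2.2, sub_self]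
    rw [h2, sub_zero, sub_zero, Real.norm_eq_abs, Real.norm_eq_abs, abs_of_nonneg ht.1] at h1
    refine h1.trans ?_
    rw [mul_comm]
    exact mul_le_mul_of_nonneg_right ht.2 hK0
  -- Galerkin orthogonality
  have hform : weightedForm T μ d (tD T 1 d) (tD T 2 d) (tD T 1 d) =
      -weightedForm T μ e e1 e2 (tD T 1 d) := by
    have h1 : weightedForm T μ d (tD T 1 d) (tD T 2 d) (tD T 1 d) =
        weightedForm T μ w (tD T 1 w) (tD T 2 w) (tD T 1 d) -
          weightedForm T μ uh (tD T 1 uh) (tD T 2 uh) (tD T 1 d) := by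
      change discreteForm hT hN p μ (⟨w, hwS⟩ - ⟨uh, huh⟩) ⟨d, hd⟩ = _
      rw [map_sub (discreteForm hT hN p μ), LinearMap.sub_apply]
      rfl
    rw [h1, horth d hd, weightedForm_sub hT μ hup.bdd hu1.bdd_deriv hwp.bdd hwp1.bdd_deriv hdp1.bdd]
    ring
  -- integration by parts moves the second derivative of the error `e` to `d`, where it is annihilated
  -- by the orthogonality of the projection
  have hparts := (hep1.mul ((hasPwDeriv_weight T).mul hdp1)).integral_eq h0mem ⟨hT.le, le_rfl⟩
  have he1T : e1 T = 0 := by simp only [he1]; rw [hwT, sub_self]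
  have hortho : ∫ t in 0..T, e1 t * (Real.exp (-t / T) * tD T 2 d t) = 0 := by
    have hb := (bdd_weight T).mul hdp1.bdd_deriv
    simp only [he1, sub_mul]
    rw [intervalIntegral.integral_sub ((hu1.bdd.mul hb).intervalIntegrable hT.le)
      ((hwp1.bdd.mul hb).intervalIntegrable hT.le), hwo d hd, sub_self]
  have hwd := (bdd_weight T).mul hdp1.bdd
  have i1 := (hep1.bdd_deriv.mul hwd).intervalIntegrable hT.le
  have i2 := (hep1.bdd.mul hwd).intervalIntegrable hT.le
  have i3 := (hep1.bdd.mul ((bdd_weight T).mul hdp1.bdd_deriv)).intervalIntegrable hT.le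
  have i4 := (hep.bdd.mul hwd).intervalIntegrable hT.le
  have hsplit : ∀ t, e2 t * (Real.exp (-t / T) * tD T 1 d t) +
      e1 t * (-(1 / T) * Real.exp (-t / T) * tD T 1 d t + Real.exp (-t / T) * tD T 2 d t) =
      e2 t * (Real.exp (-t / T) * tD T 1 d t) + (-(1 / T) * (e1 t * (Real.exp (-t / T) * tD T 1 d t))
        + e1 t * (Real.exp (-t / T) * tD T 2 d t)) := fun t => by ring
  simp_rw [hsplit] at hparts
  rw [intervalIntegral.integral_add i1 ((i2.const_mul _).add i3),
    intervalIntegral.integral_add (i2.const_mul _) i3, intervalIntegral.integral_const_mul, hortho,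
    he1T, neg_zero, zero_div, Real.exp_zero] at hparts
  have hcons : -weightedForm T μ e e1 e2 (tD T 1 d) =
      ∫ t in 0..T, Real.exp (-t / T) * ((-(1 / T) * e1 t - μ * e t) * tD T 1 d t) := by
    have h1 : ∀ t, Real.exp (-t / T) * ((-(1 / T) * e1 t - μ * e t) * tD T 1 d t) =
        -(1 / T) * (e1 t * (Real.exp (-t / T) * tD T 1 d t)) -
          μ * (e t * (Real.exp (-t / T) * tD T 1 d t)) := fun t => by ring
    simp_rw [h1]
    rw [intervalIntegral.integral_sub (i2.const_mul _) (i4.const_mul _),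
      intervalIntegral.integral_const_mul, intervalIntegral.integral_const_mul]
    unfold weightedForm
    linarith
  -- Young's inequality, with a constant such that half of the coercivity term absorbs the square
  -- of the derivative of `d`
  set B := (1 / T + μ * T) * K with hB
  have hyoung : ∫ t in 0..T, Real.exp (-t / T) * ((-(1 / T) * e1 t - μ * e t) * tD T 1 d t) ≤
      ∫ t in 0..T, (1 / (4 * T) * (Real.exp (-t / T) * tD T 1 d t ^ 2) + T * B ^ 2) := by
    refine integral_mono_Ioo hT ((bdd_weight T).mul (ContinuousOn.bdd ?_)) (ContinuousOn.bdd ?_)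
      countable_empty fun t ht => ?_
    · exact ((continuousOn_const.mul hep1.continuousOn).sub
        (continuousOn_const.mul hep.continuousOn)).mul hdp1.continuousOn
    · exact (continuousOn_const.mul ((continuous_weight T).continuousOn.mul
        (hdp1.continuousOn.pow 2))).add continuousOn_const
    · have ht' := Ioo_subset_Icc_self ht.1
      set x := -(1 / T) * e1 t - μ * e t with hx
      have hxB : |x| ≤ B := by
        rw [hx, hB]
        refine (abs_sub _ _).trans ?_
        rw [abs_mul, abs_mul, abs_neg, abs_of_pos (by positivity : 0 < 1 / T), abs_of_pos hμ]
        have h1 := mul_le_mul_of_nonneg_left (he1b t ht') (by positivity : 0 ≤ 1 / T)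
        have h2 := mul_le_mul_of_nonneg_left (heb t ht') hμ.le
        linarith
      have hxB2 : x ^ 2 ≤ B ^ 2 := by
        rw [← sq_abs]; exact pow_le_pow_left₀ (abs_nonneg _) hxB 2
      have hw1 := weight_mem hT ht'
      have h1 : x * tD T 1 d t ≤ 1 / (4 * T) * tD T 1 d t ^ 2 + T * B ^ 2 := by
        have h2 : 0 ≤ 1 / (4 * T) * (tD T 1 d t - 2 * T * x) ^ 2 := by positivity
        have h3 : 1 / (4 * T) * (tD T 1 d t - 2 * T * x) ^ 2 =
            1 / (4 * T) * tD T 1 d t ^ 2 - x * tD T 1 d t + T * x ^ 2 := by field_simp; ring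
        have h4 := mul_le_mul_of_nonneg_left hxB2 hT.le
        linarith
      have h2 := mul_le_mul_of_nonneg_left h1 (Real.exp_pos (-t / T)).le
      have h3 : Real.exp (-t / T) * (T * B ^ 2) ≤ T * B ^ 2 :=
        mul_le_of_le_one_left (by positivity) hw1.2
      linarith
  have i5 := ((bdd_weight T).mul hdp1.bdd.sq).intervalIntegrable hT.le
  rw [intervalIntegral.integral_add (i5.const_mul _) (by simp),
    intervalIntegral.integral_const_mul, intervalIntegral.integral_const, sub_zero,
    smul_eq_mul] at hyoung
  have hcoer := weightedForm_coercive hT hμ hdp hdp1 hd.2.2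
  rw [hform, hcons] at hcoer
  set I := ∫ t in 0..T, Real.exp (-t / T) * tD T 1 d t ^ 2 with hI
  have hIb : I ≤ 4 * T ^ 3 * B ^ 2 := by
    have h1 := hcoer.trans hyoung
    have h2 : 1 / (2 * T) * I = 2 * (1 / (4 * T) * I) := by field_simp; ring
    have h3 : 1 / (4 * T) * I ≤ T * (T * B ^ 2) := by linarith
    have h4 : I = 4 * T * (1 / (4 * T) * I) := by field_simp
    rw [h4]
    calc _ ≤ 4 * T * (T * (T * B ^ 2)) := mul_le_mul_of_nonneg_left h3 (by positivity)
      _ = _ := by ring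
  have hfin : ∫ t in 0..T, tD T 1 d t ^ 2 ≤
      ∫ t in 0..T, Real.exp 1 * (Real.exp (-t / T) * tD T 1 d t ^ 2) := by
    refine integral_mono_Ioo hT hdp1.bdd.sq ?_ countable_empty fun t ht => ?_
    · exact (ContinuousOn.bdd continuousOn_const).mul ((bdd_weight T).mul hdp1.bdd.sq)
    · have h1 := mul_le_mul_of_nonneg_left (weight_mem hT (Ioo_subset_Icc_self ht.1)).1
        (Real.exp_pos 1).le
      rw [← Real.exp_add, add_neg_cancel, Real.exp_zero] at h1
      rw [← mul_assoc]
      exact le_mul_of_one_le_left (sq_nonneg _) h1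
  rw [intervalIntegral.integral_const_mul] at hfin
  exact hfin.trans (mul_le_mul_of_nonneg_left hIb (Real.exp_pos _).le)

/-! ### Convergence of the projection and of the discrete solution -/

section Convergence

variable {T : ℝ} {N p : ℕ}

theorem exists_isWeightedProj (hT : 0 < T) (hN : 1 ≤ N) (hp : 1 ≤ p) {u : ℝ → ℝ}
    (hu : ContinuousOn (tD T 1 u) (Icc 0 T)) : ∃ w, IsWeightedProj T (spline T N p) u w := by
  obtain ⟨q, rfl⟩ := Nat.exists_eq_add_of_le' hp
  obtain ⟨v, hv⟩ := exists_isNodalProj hT hN q hu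
  exact ⟨_, (isWeightedProj_iff hT hN).2 ⟨v, hv, rfl⟩⟩

/-- Maximum norm bounds for the derivatives of the weighted projection. -/
theorem exists_weightedProj_error (hT : 0 < T) (hp : 2 ≤ p) (hev : Even p) :
    ∃ C : ℝ, 0 < C ∧ ∀ N : ℕ, 1 ≤ N → ∀ u ∈ sobolev hT (p + 1) ⊤, ∀ w,
      IsWeightedProj T (spline T N p) u w →
      (∀ t ∈ Icc 0 T, |tD T 1 w t - tD T 1 u t| ≤ C * (T / N) ^ p * smoothNorm T p u) ∧
      ∀ t ∈ Ioo 0 T \ nodes T N,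
        |tD T 2 w t - tD T 2 u t| ≤ C * (T / N) ^ (p - 1) * smoothNorm T p u := by
  obtain ⟨C, hC, h⟩ := exists_projection_error hT hp hev
  refine ⟨C, hC, fun N hN u hu w hw => ?_⟩
  have hw' : IsWeightedProj T (spline T N (p - 1 + 1)) u w := by
    rwa [Nat.sub_add_cancel (by omega)]
  obtain ⟨v, hv, rfl⟩ := (isWeightedProj_iff hT hN).1 hw'
  have e : tD T 1 (prim T v) = v := funext fun t => by
    by_cases ht : t ∈ Icc 0 T
    · exact tD_one_prim hT hv.1.2.1 ht
    · rw [tD_succ_of_notMem ht, hv.1.1 t ht]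
  rw [← tD_tD T 1 1 (prim T v), e]
  exact h N hN u hu v hv

theorem hasPwDeriv_tD_of_contDiffOn (hT : 0 < T) {m k : ℕ} {u : ℝ → ℝ}
    (hu : ContDiffOn ℝ m u (Icc 0 T)) (hk : k < m) : HasPwDeriv T (tD T k u) (tD T (k + 1) u) :=
  hasPwDeriv_of_hasDerivWithinAt (fun _ ht => hasDerivWithinAt_tD hT hu hk ht)
    (continuousOn_tD hT hu hk)

/-- The Poincaré inequality. -/
theorem HasPwDeriv.integral_sq_le (hT : 0 < T) {f f' : ℝ → ℝ} (hf : HasPwDeriv T f f')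
    (h0 : f 0 = 0) : ∫ t in 0..T, f t ^ 2 ≤ T ^ 2 * ∫ t in 0..T, f' t ^ 2 := by
  have h1 : ∀ t ∈ Ioo 0 T \ (∅ : Set ℝ), |f t| ≤ ∫ s in 0..T, |f' s| := fun t ht => by
    have ht' := Ioo_subset_Icc_self ht.1
    have h2 := hf.integral_eq ⟨le_rfl, hT.le⟩ ht'
    rw [h0, sub_zero] at h2
    rw [← h2]
    exact abs_integral_le_integral_abs hT hf.bdd_deriv ⟨le_rfl, hT.le⟩ ht'
  have h3 := WaveSpline.integral_sq_le hT hf.bdd countable_empty h1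
  have h4 := integral_abs_sq_le hT hf.bdd_deriv
  calc _ ≤ _ := h3
    _ ≤ T * (T * ∫ t in 0..T, f' t ^ 2) := mul_le_mul_of_nonneg_left h4 hT.le
    _ = _ := by ring

/-- The errors of the Galerkin approximation: `H¹` and `H²` bounds by comparison with the weighted
projection, the `L²` bound by duality. -/
theorem exists_galerkin_error (hT : 0 < T) (hp : 2 ≤ p) (hev : Even p) {μ : ℝ} (hμ : 0 < μ) :
    ∃ C : ℝ, 0 < C ∧ ∀ u ∈ sobolev hT (p + 1) ⊤, u 0 = 0 → ∀ N : ℕ, 1 ≤ N → ∀ uh ∈ spline T N p,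
      (∀ wh ∈ spline T N p, weightedForm T μ uh (tD T 1 uh) (tD T 2 uh) (tD T 1 wh) =
        weightedForm T μ u (tD T 1 u) (tD T 2 u) (tD T 1 wh)) →
      ∀ l ≤ 2, ∫ t in 0..T, (tD T l u t - tD T l uh t) ^ 2 ≤
        (C * (T / N) ^ (p + 1 - l) * smoothNorm T p u) ^ 2 := by
  obtain ⟨C₀, hC₀, hproj⟩ := exists_weightedProj_error hT hp hev
  obtain ⟨Ci, hCi, hinv⟩ := exists_inverse_inequality hT (p - 1)
  obtain ⟨Cd, hCd, hdual⟩ := exists_duality_estimate hT hμ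
  set C₁ : ℝ := Real.exp 1 * (4 * T ^ 3 * (1 / T + μ * T) ^ 2) with hC₁
  have hC₁0 : 0 ≤ C₁ := by positivity
  set c₁ : ℝ := √(2 * T + 2 * C₁)
  set c₂ : ℝ := √(2 * T + 2 * (Ci * C₁))
  have hc₁ : c₁ ^ 2 = 2 * T + 2 * C₁ := Real.sq_sqrt (by positivity)
  have hc₂ : c₂ ^ 2 = 2 * T + 2 * (Ci * C₁) := Real.sq_sqrt (by positivity)
  have hc₁0 : 0 < c₁ := Real.sqrt_pos.2 (by positivity)
  have hc₂0 : 0 < c₂ := Real.sqrt_pos.2 (by positivity)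
  set c₀ : ℝ := Cd * (c₂ + μ * (T * (c₁ * T))) with hc₀
  have hc₀0 : 0 < c₀ := by positivity
  refine ⟨C₀ * (c₀ + c₁ + c₂), by positivity, fun u hu hu0 N hN uh huh horth l hl => ?_⟩
  have hpos := mesh_pos hT hN
  have hhT : T / N ≤ T := div_le_self hT.le (by exact_mod_cast hN)
  set h : ℝ := T / N
  set M := smoothNorm T p u
  have hM : 0 ≤ M := smoothNorm_nonneg T p u
  -- the bound for the second derivative; the bound for the first one is `h * K`
  set K : ℝ := C₀ * h ^ (p - 1) * M
  have hK0 : 0 ≤ K := by positivity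
  have hhK : C₀ * h ^ p * M = h * K := by
    rw [show p = p - 1 + 1 by omega, pow_succ]; simp only [K]; ring
  -- the weighted projection and its distance to the discrete solution
  have hu01 : HasPwDeriv T u (tD T 1 u) := by
    simpa only [tD_zero] using hasPwDeriv_tD_of_contDiffOn hT hu.2.1 (Nat.succ_pos p)
  have hu12 : HasPwDeriv T (tD T 1 u) (tD T 2 u) :=
    hasPwDeriv_tD_of_contDiffOn hT hu.2.1 (by omega)
  obtain ⟨w, hw⟩ := exists_isWeightedProj (N := N) hT hN (by omega : 1 ≤ p) hu12.continuousOn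
  obtain ⟨hb1, hb2⟩ := hproj N hN u hu w hw
  rw [hhK] at hb1
  have hwS := hw.1
  have hd := sub_mem hwS huh
  have hen := energy_estimate hT hμ hN
    (fun t ht => by simpa only [tD_zero] using hasDerivWithinAt_tD hT hu.2.1 (Nat.succ_pos p) ht)
    hu12 hu0 hw huh horth hb1
  have hen' : ∫ t in 0..T, tD T 1 (w - uh) t ^ 2 ≤ C₁ * (h * K) ^ 2 :=
    hen.trans_eq (by rw [hC₁]; ring)
  have hinv' := hinv N hN _ (tD_one_mem_cpw hT hN hd)
  rw [tD_tD] at hinv'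
  have huh01 := hasPwDeriv_of_mem_spline hT huh
  have huh12 := hasPwDeriv_tD_one_of_mem_spline hT hN huh
  have hw12 := hasPwDeriv_tD_one_of_mem_spline hT hN hwS
  have hd12 := hasPwDeriv_tD_one_of_mem_spline hT hN hd
  have hE01 := hu01.sub huh01
  have hE12 := hu12.sub huh12
  have hA1 : ∫ t in 0..T, (tD T 1 u t - tD T 1 uh t) ^ 2 ≤ (c₁ * (h * K)) ^ 2 := by
    have e : ∫ t in 0..T, (tD T 1 u t - tD T 1 uh t) ^ 2 =
        ∫ t in 0..T, ((tD T 1 u t - tD T 1 w t) + tD T 1 (w - uh) t) ^ 2 := by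
      congr 1; ext t; rw [tD_one_sub_spline hT hwS huh]; ring
    have h1 := integral_sq_le hT (hu12.bdd.sub hw12.bdd) countable_empty (K := h * K)
      fun t ht => by rw [abs_sub_comm]; exact hb1 t (Ioo_subset_Icc_self ht.1)
    have h2 := integral_add_sq_le hT (hu12.bdd.sub hw12.bdd) hd12.bdd
    rw [e, mul_pow, hc₁]
    linarith
  have hA2 : ∫ t in 0..T, (tD T 2 u t - tD T 2 uh t) ^ 2 ≤ (c₂ * K) ^ 2 := by
    obtain ⟨s, hs, hsum⟩ := exists_tD_two_add_spline hT hN hd huh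
    have e : ∫ t in 0..T, (tD T 2 u t - tD T 2 uh t) ^ 2 =
        ∫ t in 0..T, ((tD T 2 u t - tD T 2 w t) + tD T 2 (w - uh) t) ^ 2 :=
      integral_congr_Ioo hT.le hs fun t ht => by
        have := hsum t ht
        rw [sub_add_cancel] at this
        rw [this]; ring
    have h1 := integral_sq_le hT (hu12.bdd_deriv.sub hw12.bdd_deriv) (countable_nodes T N) (K := K)
      fun t ht => by rw [abs_sub_comm]; exact hb2 t ht
    have h2 := integral_add_sq_le hT (hu12.bdd_deriv.sub hw12.bdd_deriv) hd12.bdd_deriv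
    have h3 : ∫ t in 0..T, tD T 2 (w - uh) t ^ 2 ≤ Ci * C₁ * K ^ 2 := by
      refine le_of_mul_le_mul_left ?_ (pow_pos hpos 2)
      calc _ ≤ _ := hinv'
        _ ≤ Ci * (C₁ * (h * K) ^ 2) := mul_le_mul_of_nonneg_left hen' hCi.le
        _ = _ := by ring
    rw [e, mul_pow, hc₂]
    linarith
  have hE0 : u 0 - uh 0 = 0 := by rw [hu0, huh.2.2, sub_zero]
  have hA0 : ∫ t in 0..T, (u t - uh t) ^ 2 ≤ (c₀ * (h ^ 2 * K)) ^ 2 := by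
    have h1 := hdual N hN p hp _ _ _ hE01 hE12 hE0 fun wh hwh => by
      rw [weightedForm_sub hT μ hu01.bdd hu12.bdd_deriv huh01.bdd huh12.bdd_deriv
        (hasPwDeriv_tD_one_of_mem_spline hT hN hwh).bdd, horth wh hwh, sub_self]
    have h2 : √(∫ t in 0..T, (tD T 2 u t - tD T 2 uh t) ^ 2) ≤ c₂ * K :=
      Real.sqrt_le_iff.2 ⟨by positivity, hA2⟩
    have h3 : √(∫ t in 0..T, (u t - uh t) ^ 2) ≤ T * (c₁ * T) * K := by
      refine Real.sqrt_le_iff.2 ⟨by positivity, ?_⟩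
      calc _ ≤ _ := hE01.integral_sq_le hT hE0
        _ ≤ T ^ 2 * (c₁ * (T * K)) ^ 2 := by gcongr; exact hA1.trans (by gcongr)
        _ = _ := by ring
    refine (Real.sqrt_le_left (by positivity)).1 (h1.trans ?_)
    calc _ ≤ Cd * h ^ 2 * (c₂ * K + μ * (T * (c₁ * T) * K)) := by gcongr
      _ = _ := by rw [hc₀]; ring
  -- all three bounds in terms of `K`
  have hp1 : h ^ (p + 1) = h ^ 2 * h ^ (p - 1) := by
    rw [← pow_add]; congr 1; omega
  have hp0 : h ^ p = h * h ^ (p - 1) := by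
    rw [← pow_succ']; congr 1; omega
  interval_cases l
  · simp only [tD_zero, Nat.sub_zero]
    refine hA0.trans (pow_le_pow_left₀ (by positivity) ?_ 2)
    rw [hp1, show C₀ * (c₀ + c₁ + c₂) * (h ^ 2 * h ^ (p - 1)) * M =
      (c₀ + c₁ + c₂) * (h ^ 2 * K) by simp only [K]; ring]
    gcongr; linarith
  · simp only [Nat.add_sub_cancel]
    refine hA1.trans (pow_le_pow_left₀ (by positivity) ?_ 2)
    rw [hp0, show C₀ * (c₀ + c₁ + c₂) * (h * h ^ (p - 1)) * M =
      (c₀ + c₁ + c₂) * (h * K) by simp only [K]; ring]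
    gcongr; linarith
  · rw [show p + 1 - 2 = p - 1 by omega]
    refine hA2.trans (pow_le_pow_left₀ (by positivity) ?_ 2)
    rw [show C₀ * (c₀ + c₁ + c₂) * h ^ (p - 1) * M = (c₀ + c₁ + c₂) * K by simp only [K]; ring]
    gcongr; linarith

theorem ofReal_mul_smoothNorm_le (T : ℝ) (p : ℕ) (u : ℝ → ℝ) {c : ℝ} (hc : 0 ≤ c) :
    ENNReal.ofReal (c * smoothNorm T p u) ≤
      ENNReal.ofReal c * (normL T ⊤ (tD T (p + 1) u) + normL T ⊤ (tD T (p + 2) u)) := by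
  rw [ENNReal.ofReal_mul hc]
  gcongr
  unfold smoothNorm
  rw [ENNReal.ofReal_add ENNReal.toReal_nonneg ENNReal.toReal_nonneg]
  exact add_le_add ENNReal.ofReal_toReal_le ENNReal.ofReal_toReal_le

end Convergence

end WaveSpline

open WaveSpline in
theorem corollary3p17 (T : ℝ) (hT : 0 < T) (p : ℕ) (hp : 2 ≤ p) (hev : Even p) :
    -- the discrete spaces are conforming
    (∀ N : ℕ, 1 ≤ N → spline T N p ≤ H20 hT) ∧
    -- the projection operators `𝒫_h^{p-1}` and `Q_h`, `h = T / N`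
    (∃ (P : ∀ N : ℕ, H1 hT →ₗ[ℝ] cpw T N (p - 1)) (Q : ∀ N : ℕ, H20 hT →ₗ[ℝ] spline T N p),
      (∀ N : ℕ, 1 ≤ N →
        (∀ (v : H1 hT) (w : ℝ → ℝ), IsNodalProj T N (p - 1) v w ↔ w = P N v) ∧
        (∀ (u : H20 hT) (w : ℝ → ℝ), IsWeightedProj T (spline T N p) u w ↔ w = Q N u) ∧
        (∀ u : H20 hT, (u : ℝ → ℝ) ∈ spline T N p → (Q N u : ℝ → ℝ) = u) ∧
        (∀ (u : H20 hT), ∀ t ∈ Set.Icc 0 T,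
          (Q N u : ℝ → ℝ) t = ∫ s in 0..t, (P N (dt hT u) : ℝ → ℝ) s)) ∧
      -- the approximation bound, with a constant depending only on `p` and `T`
      ∃ C : ℝ, 0 < C ∧ ∀ u : H20 hT, (u : ℝ → ℝ) ∈ sobolev hT (p + 1) ⊤ → ∀ N : ℕ, 1 ≤ N →
        normL T 2 (fun t => tD T 1 u t - tD T 1 (Q N u) t) ≤
          ENNReal.ofReal (C * (T / N) ^ p) *
            (normL T ⊤ (tD T (p + 1) u) + normL T ⊤ (tD T (p + 2) u))) ∧
    -- quasi-optimal convergence of the discrete solutions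
    (∀ (μ : ℝ), 0 < μ → ∀ f : ℝ → ℝ, MemLp f 2 (volume.restrict (Set.Ioo 0 T)) →
      ∀ u : ℝ → ℝ, IsSolution hT μ f u → u ∈ sobolev hT (p + 1) ⊤ →
      ∃ C : ℝ, 0 < C ∧ ∀ N : ℕ, 1 ≤ N →
        ∃ uh : ℝ → ℝ, IsDiscreteSolution T μ f (spline T N p) uh ∧
          (∀ vh : ℝ → ℝ, IsDiscreteSolution T μ f (spline T N p) vh → vh = uh) ∧
          ∀ l : ℕ, l ≤ 2 →
            normL T 2 (fun t => tD T l u t - tD T l uh t) ≤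
              ENNReal.ofReal (C * (T / N) ^ (p + 1 - l))) := by
  refine ⟨fun N hN => spline_le_H20 hT hN p, ?_, fun μ hμ f _ u hsol hu => ?_⟩
  · obtain ⟨P, hP⟩ := exists_nodalProj hT (p - 1)
    obtain ⟨Q, hQ⟩ : ∃ Q : ∀ N : ℕ, H20 hT →ₗ[ℝ] spline T N p, ∀ N : ℕ, 1 ≤ N →
        ∀ u : H20 hT, (∀ w, IsWeightedProj T (spline T N p) u w ↔ w = Q N u) ∧
          (Q N u : ℝ → ℝ) = prim T (P N (dt hT u)) := by
      have := exists_weightedProj hT P hP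
      rwa [Nat.sub_add_cancel (by omega : 1 ≤ p)] at this
    refine ⟨P, Q, fun N hN => ⟨hP N hN, fun u => (hQ N hN u).1, fun u hu => ?_,
      fun u t ht => ?_⟩, ?_⟩
    · exact (((hQ N hN u).1 u).1 ⟨hu, rfl, fun _ _ => rfl⟩).symm
    · rw [(hQ N hN u).2, prim_apply ht]
    · obtain ⟨C, hC, hb⟩ := exists_weightedProj_error hT hp hev
      refine ⟨√T * C, by positivity, fun u hu N hN => ?_⟩
      have hpos := mesh_pos hT hN
      obtain ⟨h1, -⟩ := hb N hN u hu _ (((hQ N hN u).1 _).2 rfl)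
      have hM := smoothNorm_nonneg T p u
      have hbd : Bdd T fun t => tD T 1 (u : ℝ → ℝ) t - tD T 1 (Q N u) t :=
        (ContinuousOn.bdd (continuousOn_tD hT hu.2.1 (by omega))).sub
          (ContinuousOn.bdd (continuousOn_tD hT (Q N u).2.2.1 le_rfl))
      refine (normL_two_le hT hbd (K := √T * C * (T / N) ^ p * smoothNorm T p u)
        (by positivity) ?_).trans (ofReal_mul_smoothNorm_le T p u (by positivity))
      refine (integral_sq_le hT hbd Set.countable_empty fun t ht => by
        rw [abs_sub_comm]; exact h1 t (Set.Ioo_subset_Icc_self ht.1)).trans_eq ?_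
      simp only [mul_pow, Real.sq_sqrt hT.le]
      ring
  · obtain ⟨C, hC, herr⟩ := exists_galerkin_error hT hp hev hμ
    have hM := smoothNorm_nonneg T p u
    have hcont : ∀ k ≤ 2, Bdd T (tD T k u) := fun k hk =>
      ContinuousOn.bdd (continuousOn_tD hT hu.2.1 (by omega))
    refine ⟨C * smoothNorm T p u + 1, by positivity, fun N hN => ?_⟩
    have hpos := mesh_pos hT hN
    obtain ⟨uh, huh, huniq, horth⟩ := exists_discreteSolution hT hN p hμ hsol
      (by simpa only [tD_zero] using hcont 0 (by omega)) (hcont 2 le_rfl)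
    refine ⟨uh, huh, huniq, fun l hl => normL_two_le hT ?_ (by positivity) ?_⟩
    · refine (hcont l hl).sub ?_
      have h1 := hasPwDeriv_tD_one_of_mem_spline hT hN huh.1
      interval_cases l
      · rw [tD_zero]; exact (hasPwDeriv_of_mem_spline hT huh.1).bdd
      · exact h1.bdd
      · exact h1.bdd_deriv
    · refine (herr u hu hsol.1.2 N hN uh huh.1 horth l hl).trans
        (pow_le_pow_left₀ (by positivity) ?_ 2)
      rw [add_mul, mul_right_comm]
      exact le_add_of_nonneg_right (by positivity)
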